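/- Let $d\ge 1$, let $\Omega\subset\mathbb R^d$ be a bounded Lipschitz domain (open, connected, nonempty), $T\in(0,\infty)$ and $v_0\in L^2_\sigma(\Omega)$, where $L^2_\sigma(\Omega)$ is the closure of $\{\varphi\in C_c^\infty(\Omega;\mathbb R^d):\operatorname{div}\varphi=0\}$ in $L^2(\Omega;\mathbb R^d)$. Write $\mathcal E(u)=\frac12\|u\|_{L^2(\Omega)}^2$. *Test fields* are the $\varphi\in C^1(\overline\Omega\times[0,T];\mathbb R^d)$ with $\operatorname{div}\varphi=0$ in $\Omega\times[0,T]$ and $\varphi\cdot n=0$ on $\partial\Omega\times[0,T]$ (wherever the outer unit normal $n$ exists). Put $\mathcal K(\varphi)(\tau)=2\,\|(\nabla\varphi(\tau))_{\mathrm{sym},-}\|_{L^\infty(\Omega)}$, where $(A)_{\mathrm{sym},-}$ is the negative semidefinite part of the symmetric part of $A$ and matrices carry the spectral norm. Functions in $BV([0,T])$ are identified if they agree almost everywhere; their pointwise values are those of the representative of bounded variation that is right-continuous on $[0,T)$ and left-continuous at $T$. The subscript $w^*$ denotes weakly* measurable, essentially bounded families. **(i)** $(v,E)$ is an *energy-variational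 solution* of the incompressible Euler equations with initial velocity $v_0$ if $v\in L^\infty(0,T;L^2_\sigma(\Omega))$, $E\in BV([0,T])$, $E(t)\ge\mathcal E(v(t))$ for a.e. $t\in(0,T)$, and for every test field $\varphi$ $$\Big[E-\int_\Omega v\cdot\varphi\,dx\Big]\Big|_s^t+\int_s^t\Big(\int_\Omega v\cdot\partial_t\varphi+(v\otimes v):\nabla\varphi\,dx+\mathcal K(\varphi)\,[\mathcal E(v)-E]\Big)d\tau\le 0$$ for a.a. $s<t$ in $(0,T)$, and also for $s=0$ and a.e. $t\in(0,T)$, with $v(0)=v_0$. **(ii)** $(v,E)$ is a *dissipative weak solution* with initial velocity $v_0$ if $v\in L^\infty(0,T;L^2_\sigma(\Omega))$, $E\in BV([0,T])$ is non-increasing, and there is $\mathfrak R\in L^\infty_{w^*}(0,T;\mathcal M(\overline\Omega;\mathbb R^{d\times d}_{\mathrm{sym},+}))$ such that for every test field $\varphi$ $$\int_\Omega v\cdot\varphi\,dx\Big|_s^t=\int_s^t\int_\Omega v\cdot\partial_t\varphi+(v\otimes v):\nabla\varphi\,dx\,d\tau+\int_s^t\int_{\overline\Omega}\nabla\varphi:d\mathfrak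 R_\tau\,d\tau$$ for a.a. $s,t\in(0,T)$, and also for $s=0$ and a.e. $t\in(0,T)$, with $v(0)=v_0$, and $$\mathcal E(v(t))+\tfrac12\int_{\overline\Omega}I:d\mathfrak R_t\le E(t)\quad\text{for a.e. }t\in(0,T).$$ **(iii)** $(\nu^o,\lambda,\nu^\infty)$ is a *measure-valued solution* with initial velocity $v_0$ if $\nu^o\in L^\infty_{w^*}(\Omega\times(0,T);\mathcal P(\mathbb R^d))$ has $\int_\Omega\langle\nu^o_{x,t},|\xi|^2\rangle\,dx$ essentially bounded in $t\in(0,T)$, $\lambda\in L^\infty_{w^*}(0,T;\mathcal M^+(\overline\Omega))$, $\nu^\infty\in L^\infty_{w^*}(\overline\Omega\times(0,T),\lambda_t\otimes dt;\mathcal P(\mathcal S^{d-1}))$, if for every test field $\varphi$ $$\int_\Omega\langle\nu^o,\xi\rangle\cdot\varphi\,dx\Big|_s^t=\int_s^t\int_\Omega\langle\nu^o,\xi\rangle\cdot\partial_t\varphi+\langle\nu^o,\xi\otimes\xi\rangle:\nabla\varphi\,dx\,d\tau+\int_s^t\int_{\overline\Omega}\nabla\varphi:\langle\nu^\infty,\theta\otimes\theta\rangle\,d\lambda_\tau\,d\tau$$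 for a.a. $s<t$ in $(0,T)$, if $\langle\nu^o_{\cdot,t},\xi\rangle\in L^2_\sigma(\Omega)$ for a.e. $t$, if $$\tfrac12\int_\Omega\langle\nu^o_{x,t},|\xi|^2\rangle dx+\tfrac12\lambda_t(\overline\Omega)\le\tfrac12\int_\Omega\langle\nu^o_{x,s},|\xi|^2\rangle dx+\tfrac12\lambda_s(\overline\Omega)$$ for a.a. $s<t$ in $(0,T)$, and if for every $\psi\in C(\overline\Omega;\mathbb R^d)$ the function $t\mapsto\int_\Omega\langle\nu^o_{x,t},\xi\rangle\cdot\psi(x)\,dx$ agrees a.e. with a continuous function on $[0,T]$ whose value at $0$ is $\int_\Omega v_0\cdot\psi\,dx$. **Theorem.** For $v:\Omega\times(0,T)\to\mathbb R^d$ and $E:(0,T)\to\mathbb R$, both understood up to null sets, the following are equivalent: 1. $(v,E)$ is an energy-variational solution in the sense of (i); 2. $(v,E)$ is a dissipative weak solution in the sense of (ii); 3. there is a measure-valued solution $(\nu^o,\lambda,\nu^\infty)$ in the sense of (iii) with $\langle\nu^o_{x,t},\xi\rangle=v(x,t)$ for a.e. $(x,t)\in\Omega\times(0,T)$ and $E(t)=\frac12\int_\Omega\langle\nu^o_{x,t},|\xi|^2\rangle\,dx+\frac12\lambda_t(\overline\Omega)$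 for a.e. $t\in(0,T)$. -/

import Mathlib

open MeasureTheory ProbabilityTheory Set Filter Topology
open scoped ENNReal ContDiff

noncomputable section

namespace IncompressibleEuler

/-- The Euclidean space `ℝ^d`. -/
abbrev Space (d : ℕ) := EuclideanSpace ℝ (Fin d)

/-- Real `d × d` matrices. -/
abbrev Mat (d : ℕ) := Matrix (Fin d) (Fin d) ℝ

variable {d : ℕ}

/-! ### Domains -/

/-- `Ω` is a bounded Lipschitz domain: open, connected, nonempty, bounded, and near every boundary
point `Ω` is the region strictly below the graph of a Lipschitz function in some direction `e`
(the value `h (y - ⟪e, y⟫ e)` depends only on the component of `y` orthogonal to `e`). -/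
structure IsBoundedLipschitzDomain (Ω : Set (Space d)) : Prop where
  isOpen : IsOpen Ω
  isConnected : IsConnected Ω
  isBounded : Bornology.IsBounded Ω
  localGraph : ∀ x ∈ frontier Ω, ∃ e : Space d, ‖e‖ = 1 ∧
    ∃ (L : NNReal) (h : Space d → ℝ), LipschitzWith L h ∧
      ∀ᶠ y in 𝓝 x, (y ∈ Ω ↔ inner ℝ e y < h (y - inner ℝ e y • e))

/-- `n` is the outer unit normal to `Ω` at the boundary point `x`: the boundary is tangent at `x` to
the hyperplane through `x` orthogonal to `n`, and `n` points from `Ω` to the exterior. For a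
Lipschitz domain it exists exactly where the local graph function is differentiable, hence almost
everywhere on the boundary, and it is then unique. -/
structure IsOuterNormal (Ω : Set (Space d)) (x n : Space d) : Prop where
  mem_frontier : x ∈ frontier Ω
  norm_eq : ‖n‖ = 1
  tangent : Tendsto (fun y => inner ℝ n (y - x) / ‖y - x‖) (𝓝[frontier Ω \ {x}] x) (𝓝 0)
  outward : ∀ᶠ r : ℝ in 𝓝[>] 0, x - r • n ∈ Ω ∧ x + r • n ∉ closure Ω

/-! ### Matrices -/

/-- The Frobenius product `A : B`. -/
def frob (A B : Mat d) : ℝ := ∑ i, ∑ j, A i j * B i j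

/-- The symmetric part of a matrix. -/
def symPart (A : Mat d) : Mat d := (1 / 2 : ℝ) • (A + A.transpose)

theorem isHermitian_symPart (A : Mat d) : (symPart A).IsHermitian := by
  ext i j
  simp [symPart]
  ring

/-- The negative semidefinite part `(A)_{sym,-}` of the symmetric part of `A`: in the spectral
decomposition every eigenvalue `r` is replaced by `min r 0`. -/
def symNeg (A : Mat d) : Mat d := (isHermitian_symPart A).cfc (fun r => min r 0)

/-- The spectral norm of a matrix. -/
def specNorm (A : Mat d) : ℝ := ‖Matrix.toEuclideanCLM (𝕜 := ℝ) A‖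

/-! ### Test functions -/

/-- A `C^1` vector field `φ` on `closure Ω × [0,T]` (time is written first): `φ` is differentiable
in the interior, and `φ` and its derivatives extend continuously to `closure Ω × [0,T]`; `dt` and
`grad` denote the extended derivatives, `grad i j` being the derivative of the component `φ i` in
the direction `j`. Moreover `φ` is divergence free and tangential on the boundary. -/
structure TestField (Ω : Set (Space d)) (T : ℝ) where
  toFun : ℝ × Space d → Space d
  dt : ℝ × Space d → Space d
  grad : ℝ × Space d → Mat d
  continuousOn_toFun : ContinuousOn toFun (Icc 0 T ×ˢ closure Ω)
  continuousOn_dt : ContinuousOn dt (Icc 0 T ×ˢ closure Ω)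
  continuousOn_grad : ContinuousOn grad (Icc 0 T ×ˢ closure Ω)
  hasFDerivAt : ∀ p ∈ Ioo 0 T ×ˢ Ω, HasFDerivAt toFun
    ((ContinuousLinearMap.fst ℝ ℝ (Space d)).smulRight (dt p) +
      (Matrix.toEuclideanCLM (𝕜 := ℝ) (grad p)).comp (ContinuousLinearMap.snd ℝ ℝ (Space d))) p
  div_eq_zero : ∀ p ∈ Icc 0 T ×ˢ Ω, (grad p).trace = 0
  tangential : ∀ t ∈ Icc 0 T, ∀ x n, IsOuterNormal Ω x n → inner ℝ (toFun (t, x)) n = 0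

/-- The regularity weight `𝒦(φ) = 2 ‖(∇φ)_{sym,-}‖_{L^∞(Ω)}` at time `τ`, with the spectral norm on
matrices. -/
def regWeight (Ω : Set (Space d)) {T : ℝ} (φ : TestField Ω T) (τ : ℝ) : ℝ :=
  2 * (eLpNorm (fun x => specNorm (symNeg (φ.grad (τ, x)))) ∞ (volume.restrict Ω)).toReal

/-! ### Function spaces -/

/-- `u ∈ L^2_σ(Ω)`: `u` lies in the closure in `L^2(Ω)` of the smooth divergence-free vector fields
with compact support in `Ω`. -/
structure MemLsigma (Ω : Set (Space d)) (u : Space d → Space d) : Prop where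
  memLp : MemLp u 2 (volume.restrict Ω)
  approx : ∀ ε : ℝ, 0 < ε → ∃ ψ : Space d → Space d,
    ContDiff ℝ ∞ ψ ∧ HasCompactSupport ψ ∧ tsupport ψ ⊆ Ω ∧
    (∀ x, LinearMap.trace ℝ (Space d) (fderiv ℝ ψ x).toLinearMap = 0) ∧
    eLpNorm (u - ψ) 2 (volume.restrict Ω) < ENNReal.ofReal ε

/-- Lebesgue measure on the time interval `(0,T)`. -/
abbrev timeMeasure (T : ℝ) : Measure ℝ := volume.restrict (Ioo 0 T)

/-- Lebesgue measure on `(0,T) × Ω`. -/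
abbrev cylMeasure (Ω : Set (Space d)) (T : ℝ) : Measure (ℝ × Space d) :=
  (timeMeasure T).prod (volume.restrict Ω)

/-- `v ∈ L^∞(0,T; L^2_σ(Ω))`. -/
structure MemLinftyLsigma (Ω : Set (Space d)) (T : ℝ) (v : ℝ → Space d → Space d) : Prop where
  aestronglyMeasurable : AEStronglyMeasurable (fun p : ℝ × Space d => v p.1 p.2) (cylMeasure Ω T)
  mem : ∀ᵐ t ∂timeMeasure T, MemLsigma Ω (v t)
  bounded : ∃ C : ℝ, ∀ᵐ t ∂timeMeasure T,
    eLpNorm (v t) 2 (volume.restrict Ω) ≤ ENNReal.ofReal C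

/-- Functions in `BV([0,T])` are identified when they agree almost everywhere; pointwise values are
those of the representative which has bounded variation on `[0,T]`, is right-continuous on `[0,T)`
and is left-continuous at `T`. `IsGoodRep T E Eg` says that `Eg` is this representative of `E`. -/
structure IsGoodRep (T : ℝ) (E Eg : ℝ → ℝ) : Prop where
  boundedVariationOn : BoundedVariationOn Eg (Icc 0 T)
  right_cont : ∀ t ∈ Ico 0 T, ContinuousWithinAt Eg (Ioi t) t
  left_cont : ContinuousWithinAt Eg (Iio T) T
  ae_eq : ∀ᵐ t ∂timeMeasure T, Eg t = E t

/-- The kinetic energy `½ ‖u‖²_{L^2(Ω)}`. -/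
def kinEnergy (Ω : Set (Space d)) (u : Space d → Space d) : ℝ :=
  (1 / 2) * ∫ x in Ω, ‖u x‖ ^ 2

/-- `∫_Ω u · φ(t) dx`. -/
def pairing (Ω : Set (Space d)) {T : ℝ} (u : Space d → Space d) (φ : TestField Ω T) (t : ℝ) : ℝ :=
  ∫ x in Ω, inner ℝ (u x) (φ.toFun (t, x))

/-- `∫_Ω u · ∂_t φ(τ) + M : ∇φ(τ) dx` for a vector field `u` and a matrix field `M`. -/
def flux (Ω : Set (Space d)) {T : ℝ} (u : Space d → Space d) (M : Space d → Mat d)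
    (φ : TestField Ω T) (τ : ℝ) : ℝ :=
  ∫ x in Ω, (inner ℝ (u x) (φ.dt (τ, x)) + frob (M x) (φ.grad (τ, x)))

/-- The matrix field `u ⊗ u`. -/
def tensorSq (u : Space d → Space d) (x : Space d) : Mat d := fun i j => u x i * u x j

/-! ### Energy-variational solutions -/

/-- The energy-variational inequality between the times `s` and `t`, where `us` is the velocity at
time `s`. -/
def EnVarInequality (Ω : Set (Space d)) {T : ℝ} (v : ℝ → Space d → Space d) (E : ℝ → ℝ)
    (φ : TestField Ω T) (s : ℝ) (us : Space d → Space d) (t : ℝ) : Prop :=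
  (E t - pairing Ω (v t) φ t) - (E s - pairing Ω us φ s) +
    ∫ τ in s..t, (flux Ω (v τ) (tensorSq (v τ)) φ τ +
      regWeight Ω φ τ * (kinEnergy Ω (v τ) - E τ)) ≤ 0

/-- `(v,E)` is an energy-variational solution on `Ω × (0,T)` with initial velocity `v₀`. -/
structure IsEnergyVariationalSolution (Ω : Set (Space d)) (T : ℝ) (v₀ : Space d → Space d)
    (v : ℝ → Space d → Space d) (E : ℝ → ℝ) : Prop where
  velocity : MemLinftyLsigma Ω T v
  energy : ∃ Eg : ℝ → ℝ, IsGoodRep T E Eg ∧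
    (∀ᵐ t ∂timeMeasure T, kinEnergy Ω (v t) ≤ Eg t) ∧
    ∀ φ : TestField Ω T,
      (∀ᵐ s ∂timeMeasure T, ∀ᵐ t ∂timeMeasure T, s < t → EnVarInequality Ω v Eg φ s (v s) t) ∧
      (∀ᵐ t ∂timeMeasure T, EnVarInequality Ω v Eg φ 0 v₀ t)

/-! ### Dissipative weak solutions -/

/-- Matrix-valued finite Radon measures on `closure Ω`, given by their entries. -/
abbrev MatMeasure (Ω : Set (Space d)) := Fin d → Fin d → SignedMeasure (closure Ω)

/-- The integral of a real function against a signed measure. -/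
def sintegral {X : Type*} [MeasurableSpace X] (μ : SignedMeasure X) (f : X → ℝ) : ℝ :=
  VectorMeasure.integral μ f (ContinuousLinearMap.lsmul ℝ ℝ)

/-- `∫_{closure Ω} A : dR`. -/
def matIntegral {Ω : Set (Space d)} (R : MatMeasure Ω) (A : Space d → Mat d) : ℝ :=
  ∑ i, ∑ j, sintegral (R i j) (fun x => A x i j)

/-- `R ∈ L^∞_{w*}(0,T; 𝓜(closure Ω; ℝ^{d×d}_{sym,+}))`: weakly* measurable, essentially bounded in
total variation, and `R_t(A)` is a symmetric positive semidefinite matrix for every Borel set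
`A ⊆ closure Ω`. -/
structure IsReynoldsDefect (Ω : Set (Space d)) (T : ℝ) (R : ℝ → MatMeasure Ω) : Prop where
  measurable : ∀ i j, ∀ f : C(closure Ω, ℝ),
    AEMeasurable (fun t => sintegral (R t i j) f) (timeMeasure T)
  bounded : ∃ C : ℝ, ∀ᵐ t ∂timeMeasure T, ∀ i j,
    (R t i j).variation univ ≤ ENNReal.ofReal C
  posSemidef : ∀ᵐ t ∂timeMeasure T, ∀ A : Set (closure Ω), MeasurableSet A →
    (Matrix.of fun i j => R t i j A).PosSemidef

/-- The weak momentum equation between the times `s` and `t`, where `us` is the velocity at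
time `s`. -/
def DissWeakEquation (Ω : Set (Space d)) {T : ℝ} (v : ℝ → Space d → Space d) (R : ℝ → MatMeasure Ω)
    (φ : TestField Ω T) (s : ℝ) (us : Space d → Space d) (t : ℝ) : Prop :=
  pairing Ω (v t) φ t - pairing Ω us φ s =
    (∫ τ in s..t, flux Ω (v τ) (tensorSq (v τ)) φ τ) +
      ∫ τ in s..t, matIntegral (R τ) (fun x => φ.grad (τ, x))

/-- `(v,E)` is a dissipative weak solution on `Ω × (0,T)` with initial velocity `v₀`. -/
structure IsDissipativeWeakSolution (Ω : Set (Space d)) (T : ℝ) (v₀ : Space d → Space d)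
    (v : ℝ → Space d → Space d) (E : ℝ → ℝ) : Prop where
  velocity : MemLinftyLsigma Ω T v
  defect : ∃ (Eg : ℝ → ℝ) (R : ℝ → MatMeasure Ω), IsGoodRep T E Eg ∧ IsReynoldsDefect Ω T R ∧
    (∀ φ : TestField Ω T,
      (∀ᵐ s ∂timeMeasure T, ∀ᵐ t ∂timeMeasure T, DissWeakEquation Ω v R φ s (v s) t) ∧
      (∀ᵐ t ∂timeMeasure T, DissWeakEquation Ω v R φ 0 v₀ t)) ∧
    AntitoneOn Eg (Icc 0 T) ∧
    ∀ᵐ t ∂timeMeasure T, kinEnergy Ω (v t) + (1 / 2) * ∑ i, R t i i univ ≤ Eg t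

/-! ### Measure-valued solutions

Weakly* measurable families of measures are represented by kernels, that is, by Borel measurable
families. Every weakly* measurable, essentially bounded family of nonnegative measures agrees almost
everywhere with such a kernel, and conversely. -/

/-- The unit sphere of `ℝ^d`. -/
abbrev Sphere (d : ℕ) := Metric.sphere (0 : Space d) 1

/-- The mean `⟨ν, ξ⟩`. -/
def mean (ν : Measure (Space d)) : Space d := ∫ ξ, ξ ∂ν

/-- The second moments `⟨ν, ξ ⊗ ξ⟩`. -/
def secondMoment (ν : Measure (Space d)) : Mat d := fun i j => ∫ ξ, ξ i * ξ j ∂ν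

/-- The second moments `⟨ν, θ ⊗ θ⟩` on the sphere. -/
def sphereMoment (ν : Measure (Sphere d)) : Mat d := fun i j => ∫ θ, θ.1 i * θ.1 j ∂ν

/-- The energy `½ ∫_Ω ⟨ν^o_{x,t}, |ξ|²⟩ dx + ½ λ_t(closure Ω)`. -/
def mvEnergy (Ω : Set (Space d)) (νo : Kernel (ℝ × Space d) (Space d))
    (lam : Kernel ℝ (closure Ω)) (t : ℝ) : ℝ :=
  (1 / 2) * (∫ x in Ω, ∫ ξ, ‖ξ‖ ^ 2 ∂(νo (t, x))) + (1 / 2) * (lam t).real univ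

/-- `(ν^o, λ, ν^∞)` is a measure-valued solution on `Ω × (0,T)` with initial velocity `v₀`. The
field `finite_energy` is the bound on the second moments of `ν^o` under which all terms are
defined. -/
structure IsMeasureValuedSolution (Ω : Set (Space d)) (T : ℝ) (v₀ : Space d → Space d)
    (νo : Kernel (ℝ × Space d) (Space d)) (lam : Kernel ℝ (closure Ω))
    (νinf : Kernel (ℝ × closure Ω) (Sphere d)) : Prop where
  oscillation : IsMarkovKernel νo
  concentration : IsFiniteKernel lam
  angle : IsMarkovKernel νinf
  finite_energy : ∃ C : ℝ, ∀ᵐ t ∂timeMeasure T,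
    ∫⁻ x in Ω, ∫⁻ ξ, ‖ξ‖ₑ ^ 2 ∂(νo (t, x)) ≤ ENNReal.ofReal C
  equation : ∀ φ : TestField Ω T, ∀ᵐ s ∂timeMeasure T, ∀ᵐ t ∂timeMeasure T, s < t →
    pairing Ω (fun x => mean (νo (t, x))) φ t - pairing Ω (fun x => mean (νo (s, x))) φ s =
      (∫ τ in s..t, flux Ω (fun x => mean (νo (τ, x))) (fun x => secondMoment (νo (τ, x))) φ τ) +
      ∫ τ in s..t, ∫ x : closure Ω, frob (φ.grad (τ, x.1)) (sphereMoment (νinf (τ, x))) ∂(lam τ)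
  solenoidal : ∀ᵐ t ∂timeMeasure T, MemLsigma Ω (fun x => mean (νo (t, x)))
  energy_ineq : ∀ᵐ s ∂timeMeasure T, ∀ᵐ t ∂timeMeasure T, s < t →
    mvEnergy Ω νo lam t ≤ mvEnergy Ω νo lam s
  initial : ∀ ψ : Space d → Space d, ContinuousOn ψ (closure Ω) → ∃ g : ℝ → ℝ,
    ContinuousOn g (Icc 0 T) ∧
    (∀ᵐ t ∂timeMeasure T, g t = ∫ x in Ω, inner ℝ (mean (νo (t, x))) (ψ x)) ∧
    g 0 = ∫ x in Ω, inner ℝ (v₀ x) (ψ x)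

end IncompressibleEuler

end

open IncompressibleEuler

/-!
The three notions are linked by the cycle: energy-variational solutions yield measure-valued ones,
these yield dissipative weak ones, and these are energy-variational. Write `quad A ξ = ξᵀ A ξ`.

*From the inequality to measures.* The energy-variational inequality may be applied to `c φ` for
every `c ≥ 0`. Dividing by `c` and letting `c → ∞` removes the energies; for `φ` vanishing at time
`T`, the linear functional `φ ↦ ∫ v₀ · φ(0) + ∫∫ v · ∂ₜφ + (v ⊗ v) : ∇φ` is then bounded by
`∫ w(τ) sup_{x, θ} (-quad (∇φ(τ, x)) θ) dτ` with `w = 2 (E - 𝓔(v)) ≥ 0`; here the weight `𝒦(φ)` is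
expressed through the quadratic form of `∇φ` on the unit sphere (`regWeight_eq`), the supremum being
nonnegative because `∇φ` is trace free. The bound depends on `φ` only through the function
`(τ, x, θ) ↦ quad (∇φ(τ, x)) θ` on `[0,T] × closure Ω × S^{d-1}`. Hahn–Banach extends the
functional to all continuous functions; up to sign it is positive, hence a measure by the
Riesz–Markov theorem, and its time marginal is `w dτ` (`exists_measure_of_le_supFunctional`).
Disintegration of this measure yields `λ` and `ν^∞` (`exists_concentration`), `ν^o` is the Dirac
mass at `v`, and the mass `w` of `λ` is twice the excess of `E` over `𝓔(v)`. Testing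
with `η(t) φ` and the lemma of du Bois-Reymond recover the equation between two times. Weak
continuity against arbitrary fields follows from that against smooth solenoidal ones, which are
dense in `L^2_σ` (`exists_continuous_pairing`).

*From measures to a defect.* The Reynolds defect is the covariance of `ν^o` plus the second moments
of the concentrations. Both are second moments, in the second variable, of one family of positive
measures on `closure Ω × ℝ^d` (`defectKernel`), which makes positivity, measurability and the trace
identity immediate. The energy is replaced by its monotone representative
(`exists_isGoodRep_antitoneOn`); the initial velocity enters the equation through weak continuity
(`ae_eq_add_of_ae_increment`).

*From a defect to the inequality.* For a positive semidefinite matrix measure `R`, the lower bound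
of `quad (∇φ)` gives `-∫ ∇φ : dR ≤ ½ 𝒦(φ) tr R(closure Ω) ≤ 𝒦(φ) (E - 𝓔(v))` (`neg_matIntegral_le`).
-/

namespace IncompressibleEuler

variable {d : ℕ}

/-! ### Quadratic forms and the negative part of a matrix -/

/-- The quadratic form `ξ ↦ ξᵀ A ξ`. -/
noncomputable def quad (A : Mat d) (ξ : Space d) : ℝ := frob A fun i j => ξ i * ξ j

theorem frob_comm (A B : Mat d) : frob A B = frob B A := by
  simp only [frob, mul_comm]

theorem quad_eq_dotProduct (A : Mat d) (ξ : Space d) :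
    quad A ξ = ξ.ofLp ⬝ᵥ (A.mulVec ξ.ofLp) := by
  simp only [quad, frob, dotProduct, Matrix.mulVec, Finset.mul_sum]
  exact Finset.sum_congr rfl fun i _ => Finset.sum_congr rfl fun j _ => by ring

theorem quad_eq_inner (A : Mat d) (ξ : Space d) :
    quad A ξ = inner ℝ ξ (Matrix.toEuclideanCLM (𝕜 := ℝ) A ξ) := by
  rw [Matrix.inner_toEuclideanCLM, quad_eq_dotProduct]

theorem quad_smul_right (A : Mat d) (c : ℝ) (ξ : Space d) : quad A (c • ξ) = c ^ 2 * quad A ξ := by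
  simp only [quad, frob, Finset.mul_sum, PiLp.smul_apply, smul_eq_mul]
  exact Finset.sum_congr rfl fun i _ => Finset.sum_congr rfl fun j _ => by ring

theorem quad_add (A B : Mat d) (ξ : Space d) : quad (A + B) ξ = quad A ξ + quad B ξ := by
  simp [quad, frob, add_mul, Finset.sum_add_distrib]

theorem quad_smul (c : ℝ) (A : Mat d) (ξ : Space d) : quad (c • A) ξ = c * quad A ξ := by
  simp [quad, frob, Finset.mul_sum, mul_assoc]

theorem quad_transpose (A : Mat d) (ξ : Space d) : quad A.transpose ξ = quad A ξ := by
  simp only [quad, frob, Matrix.transpose_apply]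
  rw [Finset.sum_comm]
  exact Finset.sum_congr rfl fun i _ => Finset.sum_congr rfl fun j _ => by ring

theorem quad_symPart (A : Mat d) (ξ : Space d) : quad (symPart A) ξ = quad A ξ := by
  rw [symPart, quad_smul, quad_add, quad_transpose]
  ring

theorem continuous_quad : Continuous fun p : Mat d × Space d => quad p.1 p.2 := by
  unfold quad frob
  fun_prop

theorem sum_quad_single (A : Mat d) :
    ∑ i, quad A (EuclideanSpace.single i 1) = A.trace := by
  simp [quad, frob, Matrix.trace]

open scoped MatrixOrder Matrix.Norms.L2Operator in
/-- A matrix bounded below as a quadratic form is bounded below in the Frobenius pairing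
with positive semidefinite matrices. -/
theorem neg_frob_le_of_posSemidef {A P : Mat d} {c : ℝ} (hA : ∀ ξ, -quad A ξ ≤ c * ‖ξ‖ ^ 2)
    (hP : P.PosSemidef) : -frob A P ≤ c * P.trace := by
  obtain ⟨B, rfl⟩ := CStarAlgebra.nonneg_iff_eq_star_mul_self.mp hP.nonneg
  rw [Matrix.star_eq_conjTranspose] at *
  -- With `P = Bᵀ B`, both sides are sums over the rows of `B`.
  have h1 : frob A (B.conjTranspose * B) = ∑ k, quad A (WithLp.toLp 2 (B k)) := by
    simp only [frob, quad, Matrix.mul_apply, Matrix.conjTranspose_apply, star_trivial,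
      Finset.mul_sum]
    rw [Finset.sum_comm]
    conv_rhs => rw [Finset.sum_comm]
    rw [Finset.sum_comm]
    exact Finset.sum_congr rfl fun i _ => Finset.sum_comm
  have h2 : (B.conjTranspose * B).trace = ∑ k, ‖(WithLp.toLp 2 (B k) : Space d)‖ ^ 2 := by
    simp only [Matrix.trace, Matrix.diag, Matrix.mul_apply, Matrix.conjTranspose_apply,
      star_trivial, EuclideanSpace.norm_sq_eq, Real.norm_eq_abs, sq_abs]
    rw [Finset.sum_comm]
    exact Finset.sum_congr rfl fun i _ => Finset.sum_congr rfl fun j _ => by ring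
  rw [h1, h2, Finset.mul_sum, ← Finset.sum_neg_distrib]
  exact Finset.sum_le_sum fun k _ => hA _

open scoped Matrix.Norms.L2Operator in
theorem specNorm_eq_norm_conj (U : unitary (Mat d)) (D : Fin d → ℝ) :
    specNorm (Unitary.conjStarAlgAut ℝ (Mat d) U (Matrix.diagonal D)) = ‖D‖ := by
  rw [specNorm, ← Matrix.cstar_norm_def, Unitary.conjStarAlgAut_apply]
  rw [← Unitary.coe_star, CStarRing.norm_mul_coe_unitary, CStarRing.norm_coe_unitary_mul,
    Matrix.l2_opNorm_diagonal]

/-- The spectral norm of the negative part controls the negative values of the quadratic form. -/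
theorem neg_quad_le_specNorm_symNeg (A : Mat d) (ξ : Space d) :
    -quad A ξ ≤ specNorm (symNeg A) * ‖ξ‖ ^ 2 := by
  have hle : quad (symNeg A) ξ ≤ quad A ξ := by
    have hs := isHermitian_symPart A
    set U := hs.eigenvectorUnitary
    have hpsd : (symPart A - symNeg A).PosSemidef := by
      have h1 : symPart A - symNeg A = Unitary.conjStarAlgAut ℝ (Mat d) U
          (Matrix.diagonal (fun i => hs.eigenvalues i - min (hs.eigenvalues i) 0)) := by
        conv_lhs => rw [hs.spectral_theorem]
        rw [symNeg, Matrix.IsHermitian.cfc, ← map_sub, Matrix.diagonal_sub]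
        rfl
      rw [h1, Unitary.conjStarAlgAut_apply]
      refine Matrix.PosSemidef.mul_mul_conjTranspose_same (Matrix.PosSemidef.diagonal ?_) _
      intro i
      simp
    have h2 := hpsd.dotProduct_mulVec_nonneg ξ.ofLp
    rw [star_trivial, ← quad_eq_dotProduct, sub_eq_add_neg, quad_add, quad_symPart,
      ← neg_one_smul ℝ, quad_smul] at h2
    linarith
  have h2 : -quad (symNeg A) ξ ≤ specNorm (symNeg A) * ‖ξ‖ ^ 2 := by
    rw [quad_eq_inner]
    have h := abs_real_inner_le_norm ξ (Matrix.toEuclideanCLM (𝕜 := ℝ) (symNeg A) ξ)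
    have h' := (Matrix.toEuclideanCLM (𝕜 := ℝ) (symNeg A)).le_opNorm ξ
    have := neg_abs_le (inner ℝ ξ (Matrix.toEuclideanCLM (𝕜 := ℝ) (symNeg A) ξ))
    calc _ ≤ ‖ξ‖ * (‖Matrix.toEuclideanCLM (𝕜 := ℝ) (symNeg A)‖ * ‖ξ‖) := by
          nlinarith [norm_nonneg ξ, mul_le_mul_of_nonneg_left h' (norm_nonneg ξ)]
      _ = _ := by rw [specNorm]; ring
  linarith

theorem specNorm_symNeg_le {A : Mat d} {c : ℝ} (hc : 0 ≤ c)
    (h : ∀ ξ : Space d, ‖ξ‖ = 1 → -quad A ξ ≤ c) : specNorm (symNeg A) ≤ c := by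
  rw [symNeg, Matrix.IsHermitian.cfc, specNorm_eq_norm_conj, pi_norm_le_iff_of_nonneg hc]
  intro i
  have hi := (isHermitian_symPart A).eigenvalues_eq i
  have hn : ‖(isHermitian_symPart A).eigenvectorBasis i‖ = 1 := by simp
  have := h _ hn
  rw [← quad_symPart, quad_eq_dotProduct] at this
  simp only [star_trivial, RCLike.re_to_real] at hi
  rw [← hi] at this
  simp only [Function.comp_apply, RCLike.ofReal_real_eq_id, id_eq, Real.norm_eq_abs, abs_le]
  exact ⟨le_min (by linarith) (by linarith), (min_le_right _ _).trans hc⟩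

/-! ### The regularity weight as a supremum -/

section NegSup

variable {Z Y : Type*} [TopologicalSpace Z] [TopologicalSpace Y]

/-- The function `z ↦ sup_y (-f (z, y))`. -/
noncomputable def negSup (f : C(Z × Y, ℝ)) (z : Z) : ℝ := ⨆ y, -f (z, y)

theorem bddAbove_range_neg [CompactSpace Y] (f : C(Z × Y, ℝ)) (z : Z) :
    BddAbove (range fun y => -f (z, y)) :=
  (isCompact_range (by fun_prop)).bddAbove

theorem neg_le_negSup [CompactSpace Y] (f : C(Z × Y, ℝ)) (z : Z) (y : Y) : -f (z, y) ≤ negSup f z :=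
  le_ciSup (bddAbove_range_neg f z) y

theorem negSup_le [Nonempty Y] {f : C(Z × Y, ℝ)} {z : Z} {c : ℝ} (h : ∀ y, -f (z, y) ≤ c) :
    negSup f z ≤ c :=
  ciSup_le h

theorem continuous_negSup [CompactSpace Y] (f : C(Z × Y, ℝ)) : Continuous (negSup f) := by
  have := isCompact_univ.continuous_sSup (K := (univ : Set Y)) (f := fun z y => -f (z, y))
    f.continuous.neg
  simpa only [image_univ] using! this

theorem negSup_add_le [CompactSpace Y] [Nonempty Y] (f g : C(Z × Y, ℝ)) (z : Z) :
    negSup (f + g) z ≤ negSup f z + negSup g z := by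
  refine negSup_le fun y => ?_
  have h1 := neg_le_negSup f z y
  have h2 := neg_le_negSup g z y
  simp only [ContinuousMap.add_apply]
  linarith

theorem negSup_smul {c : ℝ} (hc : 0 ≤ c) (f : C(Z × Y, ℝ)) (z : Z) :
    negSup (c • f) z = c * negSup f z := by
  simp only [negSup, Real.mul_iSup_of_nonneg hc, ContinuousMap.smul_apply, smul_eq_mul, mul_neg]

theorem negSup_of_forall_eq [Nonempty Y] {f : C(Z × Y, ℝ)} {z : Z} {c : ℝ}
    (h : ∀ y, f (z, y) = c) : negSup f z = -c := by
  simp [negSup, h]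

end NegSup

variable {Ω : Set (Space d)} {T : ℝ}

theorem IsBoundedLipschitzDomain.compactSpace (hΩ : IsBoundedLipschitzDomain Ω) :
    CompactSpace (closure Ω) :=
  isCompact_iff_compactSpace.mp hΩ.isBounded.isCompact_closure

theorem IsBoundedLipschitzDomain.nonempty_closure (hΩ : IsBoundedLipschitzDomain Ω) :
    Nonempty (closure Ω) :=
  hΩ.isConnected.nonempty.closure.to_subtype

theorem nonempty_sphere (hd : 1 ≤ d) : Nonempty (Sphere d) :=
  ⟨⟨EuclideanSpace.single ⟨0, hd⟩ 1, by simp⟩⟩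

/-- The function `(τ, x, θ) ↦ θᵀ ∇φ(τ, x) θ` on `[0,T] × closure Ω × S^{d-1}`. -/
noncomputable def symbol (φ : TestField Ω T) : C(Icc 0 T × (closure Ω × Sphere d), ℝ) where
  toFun p := quad (φ.grad (p.1, p.2.1)) p.2.2
  continuous_toFun := by
    refine continuous_quad.comp (Continuous.prodMk ?_ (by fun_prop))
    exact φ.continuousOn_grad.comp_continuous (by fun_prop) fun p => ⟨p.1.2, p.2.1.2⟩

@[simp]
theorem symbol_apply (φ : TestField Ω T) (p : Icc 0 T × (closure Ω × Sphere d)) :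
    symbol φ p = quad (φ.grad (p.1, p.2.1)) p.2.2 := rfl

/-- A trace-free matrix is not positive definite, so the supremum of `-θᵀ ∇φ θ` is nonnegative. -/
theorem negSup_symbol_nonneg (hd : 1 ≤ d) (hΩ : IsBoundedLipschitzDomain Ω) (φ : TestField Ω T)
    (τ : Icc 0 T) : 0 ≤ negSup (symbol φ) τ := by
  have := hΩ.compactSpace
  obtain ⟨x, hx⟩ := hΩ.isConnected.nonempty
  have h0 : ∑ i, quad (φ.grad (τ, x)) (EuclideanSpace.single i 1) = 0 := by
    rw [sum_quad_single, φ.div_eq_zero _ ⟨τ.2, hx⟩]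
  have hne : (Finset.univ : Finset (Fin d)).Nonempty := ⟨⟨0, hd⟩, Finset.mem_univ _⟩
  obtain ⟨i, -, hi⟩ := Finset.exists_le_of_sum_le hne
    (show ∑ i, quad (φ.grad (τ, x)) (EuclideanSpace.single i 1) ≤ ∑ _i : Fin d, (0 : ℝ) by
      simp [h0])
  have := neg_le_negSup (symbol φ) τ
    (⟨x, subset_closure hx⟩, ⟨EuclideanSpace.single i 1, by simp⟩)
  simp only [symbol_apply] at this
  linarith

theorem neg_quad_le_negSup_symbol [CompactSpace (closure Ω)] (φ : TestField Ω T) (τ : Icc 0 T)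
    {x : Space d} (hx : x ∈ closure Ω) (ξ : Space d) :
    -quad (φ.grad (τ, x)) ξ ≤ negSup (symbol φ) τ * ‖ξ‖ ^ 2 := by
  rcases eq_or_ne ξ 0 with rfl | h
  · simp [quad, frob]
  have h' : ‖ξ‖ ≠ 0 := norm_ne_zero_iff.mpr h
  have h1 := neg_le_negSup (symbol φ) τ (⟨x, hx⟩, ⟨‖ξ‖⁻¹ • ξ, by simp [norm_smul, h']⟩)
  simp only [symbol_apply, quad_smul_right] at h1
  calc -quad (φ.grad (τ, x)) ξ = -(‖ξ‖⁻¹ ^ 2 * quad (φ.grad (τ, x)) ξ) * ‖ξ‖ ^ 2 := by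
        field_simp
    _ ≤ _ := by gcongr

/-- By continuity of `∇φ`, the essential supremum over `Ω` defining the regularity weight is the
supremum over `closure Ω`. -/
theorem regWeight_eq (hd : 1 ≤ d) (hΩ : IsBoundedLipschitzDomain Ω) (φ : TestField Ω T)
    (τ : Icc 0 T) : regWeight Ω φ τ = 2 * negSup (symbol φ) τ := by
  have := hΩ.compactSpace
  have := hΩ.nonempty_closure
  have := nonempty_sphere hd
  set g : Space d → ℝ := fun x => specNorm (symNeg (φ.grad (τ, x))) with hg
  have hg0 : ∀ x, 0 ≤ g x := fun x => norm_nonneg _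
  have hub : eLpNorm g ⊤ (volume.restrict Ω) ≤ ENNReal.ofReal (negSup (symbol φ) τ) := by
    rw [eLpNorm_exponent_top]
    refine eLpNormEssSup_le_of_ae_bound ?_
    filter_upwards [ae_restrict_mem hΩ.isOpen.measurableSet] with x hx
    rw [Real.norm_of_nonneg (hg0 x)]
    refine specNorm_symNeg_le (negSup_symbol_nonneg hd hΩ φ τ) fun ξ hξ => ?_
    simpa [hξ] using neg_quad_le_negSup_symbol φ τ (subset_closure hx) ξ
  have hlb : negSup (symbol φ) τ ≤ (eLpNorm g ⊤ (volume.restrict Ω)).toReal := by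
    have hfin : eLpNorm g ⊤ (volume.restrict Ω) ≠ ⊤ := (hub.trans_lt ENNReal.ofReal_lt_top).ne
    refine negSup_le fun y => ?_
    obtain ⟨⟨x, hx⟩, θ⟩ := y
    have hcont : ContinuousOn (fun x => -quad (φ.grad (τ, x)) θ) (closure Ω) := by
      refine (continuous_quad.comp_continuousOn
        (ContinuousOn.prodMk (φ.continuousOn_grad.comp (by fun_prop) fun x hx => ⟨τ.2, hx⟩)
          continuousOn_const)).neg
    refine le_on_closure (f := fun x => -quad (φ.grad (τ, x)) θ)
      (g := fun _ => (eLpNorm g ⊤ (volume.restrict Ω)).toReal) ?_ hcont continuousOn_const hx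
    by_contra! hne
    obtain ⟨z, hz, hzlt⟩ := hne
    have hopen := (hcont.mono subset_closure).isOpen_inter_preimage hΩ.isOpen
      (isOpen_Ioi (a := (eLpNorm g ⊤ (volume.restrict Ω)).toReal))
    refine hopen.measure_ne_zero volume ⟨z, hz, hzlt⟩ ?_
    have hae := (ae_restrict_iff' hΩ.isOpen.measurableSet).mp
      (ae_le_eLpNormEssSup (f := g) (μ := volume.restrict Ω))
    refine measure_mono_null ?_ (ae_iff.mp hae)
    rintro w ⟨hw, hlt⟩ hcontra
    have h1 := hcontra hw
    rw [← eLpNorm_exponent_top] at h1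
    have h2 := ENNReal.toReal_mono hfin h1
    rw [toReal_enorm, Real.norm_of_nonneg (hg0 w)] at h2
    have h3 := neg_quad_le_specNorm_symNeg (φ.grad (τ, w)) θ
    rw [show ‖(θ : Space d)‖ = 1 by simp] at h3
    simp only [mem_preimage, mem_Ioi] at hlt
    simp only [hg] at h2
    linarith
  rw [regWeight]
  congr 1
  refine le_antisymm ?_ hlb
  exact ENNReal.toReal_le_of_le_ofReal (negSup_symbol_nonneg hd hΩ φ τ) hub

/-! ### Bounded families of integrable functions -/

/-- `f ∈ L^∞(0,T; L^1(Ω))`. -/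
structure LinftyL1 {F : Type*} [NormedAddCommGroup F] (Ω : Set (Space d)) (T : ℝ)
    (f : ℝ × Space d → F) : Prop where
  aestronglyMeasurable : AEStronglyMeasurable f (cylMeasure Ω T)
  bounded : ∃ C : ℝ, ∀ᵐ t ∂timeMeasure T, ∫⁻ x in Ω, ‖f (t, x)‖ₑ ≤ ENNReal.ofReal C

namespace LinftyL1

variable {F : Type*} [NormedAddCommGroup F] {f g : ℝ × Space d → F}

theorem ae_integrable (hf : LinftyL1 Ω T f) :
    ∀ᵐ t ∂timeMeasure T, Integrable (fun x => f (t, x)) (volume.restrict Ω) := by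
  obtain ⟨C, hC⟩ := hf.bounded
  filter_upwards [hC, hf.aestronglyMeasurable.prodMk_left] with t h1 h2
  exact ⟨h2, h1.trans_lt ENNReal.ofReal_lt_top⟩

theorem exists_integral_norm_le (hf : LinftyL1 Ω T f) :
    ∃ C : ℝ, 0 ≤ C ∧ ∀ᵐ t ∂timeMeasure T, ∫ x in Ω, ‖f (t, x)‖ ≤ C := by
  obtain ⟨C, hC⟩ := hf.bounded
  refine ⟨max C 0, le_max_right _ _, ?_⟩
  filter_upwards [hC, hf.ae_integrable] with t h1 h2
  rw [integral_norm_eq_lintegral_enorm h2.1]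
  refine ENNReal.toReal_le_of_le_ofReal (le_max_right _ _) (h1.trans ?_)
  exact ENNReal.ofReal_le_ofReal (le_max_left _ _)

theorem add (hf : LinftyL1 Ω T f) (hg : LinftyL1 Ω T g) : LinftyL1 Ω T (f + g) := by
  obtain ⟨C, hC⟩ := hf.bounded
  obtain ⟨D, hD⟩ := hg.bounded
  refine ⟨hf.aestronglyMeasurable.add hg.aestronglyMeasurable, max C 0 + max D 0, ?_⟩
  filter_upwards [hC, hD, hf.ae_integrable] with t h1 h2 h3
  calc ∫⁻ x in Ω, ‖(f + g) (t, x)‖ₑ ≤ ∫⁻ x in Ω, (‖f (t, x)‖ₑ + ‖g (t, x)‖ₑ) :=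
        lintegral_mono fun x => enorm_add_le _ _
    _ = (∫⁻ x in Ω, ‖f (t, x)‖ₑ) + ∫⁻ x in Ω, ‖g (t, x)‖ₑ := lintegral_add_left' h3.1.enorm _
    _ ≤ ENNReal.ofReal C + ENNReal.ofReal D := add_le_add h1 h2
    _ ≤ _ := by
      rw [ENNReal.ofReal_add (le_max_right _ _) (le_max_right _ _)]
      gcongr <;> exact le_max_left _ _

theorem sum {ι : Type*} (s : Finset ι) {f : ι → ℝ × Space d → F}
    (hf : ∀ i ∈ s, LinftyL1 Ω T (f i)) : LinftyL1 Ω T (∑ i ∈ s, f i) := by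
  classical
  induction s using Finset.induction_on with
  | empty => exact ⟨by simpa using aestronglyMeasurable_zero, 0, by simp⟩
  | insert a s ha ih =>
    rw [Finset.sum_insert ha]
    exact (hf a (Finset.mem_insert_self _ _)).add
      (ih fun i hi => hf i (Finset.mem_insert_of_mem hi))

/-- Domination by a bounded multiple preserves `L^∞(0,T; L^1(Ω))`. -/
theorem of_le {G : Type*} [NormedAddCommGroup G] {g : ℝ × Space d → G} (hf : LinftyL1 Ω T f)
    (hg : AEStronglyMeasurable g (cylMeasure Ω T)) {B : ℝ}
    (h : ∀ᵐ t ∂timeMeasure T, ∀ᵐ x ∂volume.restrict Ω, ‖g (t, x)‖ ≤ B * ‖f (t, x)‖) :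
    LinftyL1 Ω T g := by
  obtain ⟨C, hC⟩ := hf.bounded
  refine ⟨hg, max B 0 * C, ?_⟩
  filter_upwards [hC, h, hf.ae_integrable] with t h1 h2 h3
  calc ∫⁻ x in Ω, ‖g (t, x)‖ₑ ≤ ∫⁻ x in Ω, ENNReal.ofReal (max B 0) * ‖f (t, x)‖ₑ := by
        refine lintegral_mono_ae ?_
        filter_upwards [h2] with x hx
        rw [← ofReal_norm, ← ofReal_norm,
          ← ENNReal.ofReal_mul (le_max_right _ _)]
        refine ENNReal.ofReal_le_ofReal (hx.trans ?_)
        gcongr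
        exact le_max_left _ _
    _ = ENNReal.ofReal (max B 0) * ∫⁻ x in Ω, ‖f (t, x)‖ₑ :=
        lintegral_const_mul' _ _ ENNReal.ofReal_ne_top
    _ ≤ _ := by
      rw [ENNReal.ofReal_mul (le_max_right _ _)]
      gcongr

theorem integrable_integral [NormedSpace ℝ F] (hf : LinftyL1 Ω T f) :
    Integrable (fun t => ∫ x in Ω, f (t, x)) (timeMeasure T) := by
  obtain ⟨C, hC0, hC⟩ := hf.exists_integral_norm_le
  refine Integrable.of_bound hf.aestronglyMeasurable.integral_prod_right' C ?_
  filter_upwards [hC] with t ht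
  exact (norm_integral_le_integral_norm _).trans ht

end LinftyL1

theorem exists_bound_of_continuousOn [hc : CompactSpace (closure Ω)] {F : Type*}
    [SeminormedAddCommGroup F] {a : ℝ × Space d → F}
    (ha : ContinuousOn a (Icc 0 T ×ˢ closure Ω)) :
    ∃ B : ℝ, 0 ≤ B ∧ ∀ p ∈ Icc 0 T ×ˢ closure Ω, ‖a p‖ ≤ B := by
  obtain ⟨B, hB⟩ := (isCompact_Icc.prod
    (isCompact_iff_compactSpace.mpr hc)).exists_bound_of_continuousOn ha
  exact ⟨max B 0, le_max_right _ _, fun p hp => (hB p hp).trans (le_max_left _ _)⟩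

theorem aestronglyMeasurable_of_continuousOn (hΩ : IsOpen Ω) {F : Type*} [TopologicalSpace F]
    [TopologicalSpace.PseudoMetrizableSpace F] {a : ℝ × Space d → F}
    (ha : ContinuousOn a (Icc 0 T ×ˢ closure Ω)) :
    AEStronglyMeasurable a (cylMeasure Ω T) := by
  rw [cylMeasure, timeMeasure, Measure.prod_restrict]
  exact (ha.mono (prod_mono Ioo_subset_Icc_self subset_closure)).aestronglyMeasurable
    (measurableSet_Ioo.prod hΩ.measurableSet)

theorem LinftyL1.mul_continuousOn [CompactSpace (closure Ω)] (hΩ : IsOpen Ω)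
    {f a : ℝ × Space d → ℝ} (hf : LinftyL1 Ω T f) (ha : ContinuousOn a (Icc 0 T ×ˢ closure Ω)) :
    LinftyL1 Ω T fun p => f p * a p := by
  obtain ⟨B, hB0, hB⟩ := exists_bound_of_continuousOn ha
  refine hf.of_le (hf.aestronglyMeasurable.mul (aestronglyMeasurable_of_continuousOn hΩ ha))
    (B := B) ?_
  filter_upwards [ae_restrict_mem measurableSet_Ioo] with t ht
  filter_upwards [ae_restrict_mem hΩ.measurableSet] with x hx
  rw [norm_mul, mul_comm]
  gcongr
  exact hB _ ⟨Ioo_subset_Icc_self ht, subset_closure hx⟩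

theorem LinftyL1.inner_continuousOn [CompactSpace (closure Ω)] (hΩ : IsOpen Ω)
    {f a : ℝ × Space d → Space d} (hf : LinftyL1 Ω T f)
    (ha : ContinuousOn a (Icc 0 T ×ˢ closure Ω)) :
    LinftyL1 Ω T fun p => inner ℝ (f p) (a p) := by
  obtain ⟨B, hB0, hB⟩ := exists_bound_of_continuousOn ha
  refine hf.of_le (hf.aestronglyMeasurable.inner (aestronglyMeasurable_of_continuousOn hΩ ha))
    (B := B) ?_
  filter_upwards [ae_restrict_mem measurableSet_Ioo] with t ht
  filter_upwards [ae_restrict_mem hΩ.measurableSet] with x hx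
  refine (norm_inner_le_norm _ _).trans ?_
  rw [mul_comm]
  gcongr
  exact hB _ ⟨Ioo_subset_Icc_self ht, subset_closure hx⟩

/-- A velocity and a momentum flux for which all terms of the momentum equation are defined. -/
structure IsFluxPair (Ω : Set (Space d)) (T : ℝ) (u : ℝ → Space d → Space d)
    (M : ℝ → Space d → Mat d) : Prop where
  velocity : LinftyL1 Ω T fun p => u p.1 p.2
  momentum : ∀ i j, LinftyL1 Ω T fun p => M p.1 p.2 i j

theorem IsFluxPair.linftyL1 [CompactSpace (closure Ω)] (hΩ : IsOpen Ω)
    {u : ℝ → Space d → Space d} {M : ℝ → Space d → Mat d} (h : IsFluxPair Ω T u M)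
    (φ : TestField Ω T) :
    LinftyL1 Ω T fun p => inner ℝ (u p.1 p.2) (φ.dt p) + frob (M p.1 p.2) (φ.grad p) := by
  have h1 := LinftyL1.inner_continuousOn hΩ h.velocity φ.continuousOn_dt
  have h2 : ∀ i j, LinftyL1 Ω T fun p => M p.1 p.2 i j * φ.grad p i j := fun i j =>
    (h.momentum i j).mul_continuousOn hΩ
      (continuousOn_pi.mp (continuousOn_pi.mp φ.continuousOn_grad i) j)
  have h3 := h1.add (LinftyL1.sum Finset.univ fun i _ => LinftyL1.sum Finset.univ fun j _ => h2 i j)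
  convert h3 using 1
  ext p
  simp [frob]

theorem IsFluxPair.integrable_flux [CompactSpace (closure Ω)] (hΩ : IsOpen Ω)
    {u : ℝ → Space d → Space d} {M : ℝ → Space d → Mat d} (h : IsFluxPair Ω T u M)
    (φ : TestField Ω T) : Integrable (fun τ => flux Ω (u τ) (M τ) φ τ) (timeMeasure T) :=
  (h.linftyL1 hΩ φ).integrable_integral

theorem IsFluxPair.integrable_pairing [CompactSpace (closure Ω)] (hΩ : IsOpen Ω)
    {u : ℝ → Space d → Space d} {M : ℝ → Space d → Mat d} (h : IsFluxPair Ω T u M)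
    (φ : TestField Ω T) : Integrable (fun τ => pairing Ω (u τ) φ τ) (timeMeasure T) :=
  (h.velocity.inner_continuousOn hΩ φ.continuousOn_toFun).integrable_integral

theorem MemLinftyLsigma.linftyL1_norm_sq {v : ℝ → Space d → Space d}
    (hv : MemLinftyLsigma Ω T v) : LinftyL1 Ω T fun p => ‖v p.1 p.2‖ ^ 2 := by
  obtain ⟨C, hC⟩ := hv.bounded
  refine ⟨hv.aestronglyMeasurable.norm.pow 2, (max C 0) ^ 2, ?_⟩
  filter_upwards [hC] with t ht
  have h1 : ∫⁻ x in Ω, ‖‖v t x‖ ^ 2‖ₑ = eLpNorm (v t) 2 (volume.restrict Ω) ^ 2 := by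
    rw [eLpNorm_eq_lintegral_rpow_enorm_toReal (by simp) (by simp)]
    simp only [ENNReal.toReal_ofNat, one_div, enorm_pow, enorm_norm, ENNReal.rpow_ofNat]
    rw [← ENNReal.rpow_natCast, ← ENNReal.rpow_mul]
    simp
  rw [h1, ENNReal.ofReal_pow (le_max_right _ _)]
  gcongr
  exact ht.trans (ENNReal.ofReal_le_ofReal (le_max_left _ _))

theorem linftyL1_const [CompactSpace (closure Ω)] : LinftyL1 Ω T fun _ => (1 : ℝ) := by
  refine ⟨aestronglyMeasurable_const, (volume Ω).toReal, ae_of_all _ fun t => ?_⟩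
  have : volume Ω ≠ ⊤ := ((measure_mono subset_closure).trans_lt
    (isCompact_iff_compactSpace.mpr ‹_›).measure_lt_top).ne
  simp [ENNReal.ofReal_toReal this]

theorem MemLinftyLsigma.linftyL1 [CompactSpace (closure Ω)] {v : ℝ → Space d → Space d}
    (hv : MemLinftyLsigma Ω T v) : LinftyL1 Ω T fun p => v p.1 p.2 := by
  refine (linftyL1_const.add hv.linftyL1_norm_sq).of_le hv.aestronglyMeasurable (B := 1) ?_
  refine ae_of_all _ fun t => ae_of_all _ fun x => ?_
  simp only [Pi.add_apply]
  rw [Real.norm_of_nonneg (by positivity)]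
  nlinarith [sq_nonneg (‖v t x‖ - 1)]

theorem abs_coord_mul_le (ξ : Space d) (i j : Fin d) : |ξ i * ξ j| ≤ ‖ξ‖ ^ 2 := by
  rw [abs_mul, sq]
  have := PiLp.norm_apply_le ξ i
  have := PiLp.norm_apply_le ξ j
  simp only [Real.norm_eq_abs] at *
  gcongr

theorem MemLinftyLsigma.isFluxPair [CompactSpace (closure Ω)] {v : ℝ → Space d → Space d}
    (hv : MemLinftyLsigma Ω T v) : IsFluxPair Ω T v fun t => tensorSq (v t) := by
  refine ⟨hv.linftyL1, fun i j => hv.linftyL1_norm_sq.of_le (B := 1) ?_ ?_⟩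
  · have hc : ∀ k, AEStronglyMeasurable (fun p : ℝ × Space d => v p.1 p.2 k) (cylMeasure Ω T) :=
      fun k => (EuclideanSpace.proj (𝕜 := ℝ) k).continuous.comp_aestronglyMeasurable
        hv.aestronglyMeasurable
    exact (hc i).mul (hc j)
  · refine ae_of_all _ fun t => ae_of_all _ fun x => ?_
    rw [one_mul, norm_pow, norm_norm]
    exact abs_coord_mul_le _ i j

theorem MemLinftyLsigma.integrable_kinEnergy {v : ℝ → Space d → Space d}
    (hv : MemLinftyLsigma Ω T v) : Integrable (fun t => kinEnergy Ω (v t)) (timeMeasure T) :=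
  hv.linftyL1_norm_sq.integrable_integral.const_mul _

/-! ### Operations on test fields -/

namespace TestField

/-- The sum of two test fields. -/
noncomputable def add (φ ψ : TestField Ω T) : TestField Ω T where
  toFun p := φ.toFun p + ψ.toFun p
  dt p := φ.dt p + ψ.dt p
  grad p := φ.grad p + ψ.grad p
  continuousOn_toFun := φ.continuousOn_toFun.add ψ.continuousOn_toFun
  continuousOn_dt := φ.continuousOn_dt.add ψ.continuousOn_dt
  continuousOn_grad := φ.continuousOn_grad.add ψ.continuousOn_grad
  hasFDerivAt p hp := by
    refine ((φ.hasFDerivAt p hp).fun_add (ψ.hasFDerivAt p hp)).congr_fderiv ?_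
    refine ContinuousLinearMap.ext fun q => ?_
    simp only [add_apply, ContinuousLinearMap.smulRight_apply,
      ContinuousLinearMap.comp_apply, map_add, smul_add]
    abel
  div_eq_zero p hp := by
    rw [Matrix.trace_add, φ.div_eq_zero p hp, ψ.div_eq_zero p hp, add_zero]
  tangential t ht x n hn := by
    rw [inner_add_left, φ.tangential t ht x n hn, ψ.tangential t ht x n hn, add_zero]

/-- The product of a test field with a `C^1` function of time. -/
noncomputable def timeMul {η : ℝ → ℝ} (hη : ContDiff ℝ 1 η) (φ : TestField Ω T) :
    TestField Ω T where
  toFun p := η p.1 • φ.toFun p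
  dt p := deriv η p.1 • φ.toFun p + η p.1 • φ.dt p
  grad p := η p.1 • φ.grad p
  continuousOn_toFun :=
    (hη.continuous.comp continuous_fst).continuousOn.smul φ.continuousOn_toFun
  continuousOn_dt :=
    (((hη.continuous_deriv le_rfl).comp continuous_fst).continuousOn.smul
      φ.continuousOn_toFun).add
      ((hη.continuous.comp continuous_fst).continuousOn.smul φ.continuousOn_dt)
  continuousOn_grad :=
    (hη.continuous.comp continuous_fst).continuousOn.smul φ.continuousOn_grad
  hasFDerivAt p hp := by
    have h1 : HasFDerivAt (fun q : ℝ × Space d => η q.1) _ p :=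
      ((hη.differentiable one_ne_zero p.1).hasDerivAt.hasFDerivAt).comp p
        (hasFDerivAt_fst (p := p))
    refine (h1.fun_smul (φ.hasFDerivAt p hp)).congr_fderiv ?_
    refine ContinuousLinearMap.ext fun q => ?_
    simp only [add_apply, ContinuousLinearMap.smulRight_apply,
      ContinuousLinearMap.comp_apply, map_smul, smul_add, smul_apply,
      ContinuousLinearMap.coe_fst', ContinuousLinearMap.coe_snd', smul_smul,
      ContinuousLinearMap.toSpanSingleton_apply, smul_eq_mul, mul_comm]
    abel
  div_eq_zero p hp := by rw [Matrix.trace_smul, φ.div_eq_zero p hp, smul_zero]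
  tangential t ht x n hn := by
    rw [real_inner_smul_left, φ.tangential t ht x n hn, mul_zero]

/-- A real multiple of a test field. -/
noncomputable def smul (c : ℝ) (φ : TestField Ω T) : TestField Ω T where
  toFun p := c • φ.toFun p
  dt p := c • φ.dt p
  grad p := c • φ.grad p
  continuousOn_toFun := φ.continuousOn_toFun.const_smul c
  continuousOn_dt := φ.continuousOn_dt.const_smul c
  continuousOn_grad := φ.continuousOn_grad.const_smul c
  hasFDerivAt p hp := by
    refine ((φ.hasFDerivAt p hp).fun_const_smul c).congr_fderiv ?_
    refine ContinuousLinearMap.ext fun q => ?_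
    simp [smul_smul, mul_comm]
  div_eq_zero p hp := by rw [Matrix.trace_smul, φ.div_eq_zero p hp, smul_zero]
  tangential t ht x n hn := by
    rw [real_inner_smul_left, φ.tangential t ht x n hn, mul_zero]

/-- The test field which is constant in time and equal to a smooth divergence-free field with
compact support in `Ω`. -/
noncomputable def ofStatic (hΩ : IsOpen Ω) (T : ℝ) {ψ : Space d → Space d} (hψ : ContDiff ℝ ∞ ψ)
    (hsupp : tsupport ψ ⊆ Ω)
    (hdiv : ∀ x, LinearMap.trace ℝ (Space d) (fderiv ℝ ψ x).toLinearMap = 0) :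
    TestField Ω T where
  toFun p := ψ p.2
  dt _ := 0
  grad p := (Matrix.toEuclideanCLM (𝕜 := ℝ)).symm (fderiv ℝ ψ p.2)
  continuousOn_toFun := (hψ.continuous.comp continuous_snd).continuousOn
  continuousOn_dt := continuousOn_const
  continuousOn_grad := by
    have h1 : Continuous (fun L : Space d →L[ℝ] Space d =>
        (Matrix.toEuclideanCLM (𝕜 := ℝ) (n := Fin d)).symm L) :=
      LinearMap.continuous_of_finiteDimensional
        { toFun := (Matrix.toEuclideanCLM (𝕜 := ℝ) (n := Fin d)).symm
          map_add' := map_add _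
          map_smul' := map_smul _ }
    exact (h1.comp ((hψ.continuous_fderiv (by simp)).comp continuous_snd)).continuousOn
  hasFDerivAt p hp := by
    have h1 : HasFDerivAt (fun q : ℝ × Space d => ψ q.2) _ p :=
      ((hψ.differentiable (by simp) p.2).hasFDerivAt).comp p (hasFDerivAt_snd (p := p))
    refine h1.congr_fderiv ?_
    refine ContinuousLinearMap.ext fun q => ?_
    simp
  div_eq_zero p hp := by
    rw [← hdiv p.2, LinearMap.trace_eq_matrix_trace ℝ (EuclideanSpace.basisFun (Fin d) ℝ).toBasis]
    rfl
  tangential t ht x n hn := by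
    have hx : x ∉ tsupport ψ := fun h => by
      have := hn.mem_frontier.2
      rw [hΩ.interior_eq] at this
      exact this (hsupp h)
    rw [image_eq_zero_of_notMem_tsupport hx, inner_zero_left]

instance : Nonempty (TestField Ω T) :=
  ⟨{ toFun := 0, dt := 0, grad := 0
     continuousOn_toFun := continuousOn_const
     continuousOn_dt := continuousOn_const
     continuousOn_grad := continuousOn_const
     hasFDerivAt := fun p _ => by
       refine (hasFDerivAt_const (0 : Space d) p).congr_fderiv ?_
       refine ContinuousLinearMap.ext fun q => ?_
       simp
     div_eq_zero := fun _ _ => by simp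
     tangential := fun _ _ _ _ _ => by simp }⟩

end TestField

theorem symbol_add (φ ψ : TestField Ω T) : symbol (φ.add ψ) = symbol φ + symbol ψ := by
  ext p
  simp [TestField.add, quad_add]

theorem symbol_smul (c : ℝ) (φ : TestField Ω T) : symbol (φ.smul c) = c • symbol φ := by
  ext p
  simp [TestField.smul, quad_smul]

theorem regWeight_smul {c : ℝ} (hc : 0 ≤ c) (hd : 1 ≤ d) (hΩ : IsBoundedLipschitzDomain Ω)
    (φ : TestField Ω T) (τ : Icc 0 T) : regWeight Ω (φ.smul c) τ = c * regWeight Ω φ τ := by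
  rw [regWeight_eq hd hΩ, regWeight_eq hd hΩ, symbol_smul, negSup_smul hc]
  ring

theorem pairing_smul (c : ℝ) (u : Space d → Space d) (φ : TestField Ω T) (t : ℝ) :
    pairing Ω u (φ.smul c) t = c * pairing Ω u φ t := by
  simp only [pairing, TestField.smul, real_inner_smul_right, integral_const_mul]

theorem flux_smul (c : ℝ) (u : Space d → Space d) (M : Space d → Mat d) (φ : TestField Ω T)
    (t : ℝ) : flux Ω u M (φ.smul c) t = c * flux Ω u M φ t := by
  rw [flux, flux, ← integral_const_mul]
  congr 1 with x
  simp only [TestField.smul, real_inner_smul_right, frob, Matrix.smul_apply, smul_eq_mul,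
    mul_add, Finset.mul_sum]
  congr 1
  exact Finset.sum_congr rfl fun i _ => Finset.sum_congr rfl fun j _ => by ring

theorem frob_add_right (A B C : Mat d) : frob A (B + C) = frob A B + frob A C := by
  simp [frob, mul_add, Finset.sum_add_distrib]

theorem frob_smul_right (c : ℝ) (A B : Mat d) : frob A (c • B) = c * frob A B := by
  simp only [frob, Matrix.smul_apply, smul_eq_mul, Finset.mul_sum]
  exact Finset.sum_congr rfl fun i _ => Finset.sum_congr rfl fun j _ => by ring

theorem integrable_inner_of_continuousOn [hc : CompactSpace (closure Ω)] (hΩ : IsOpen Ω)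
    {u a : Space d → Space d} (hu : Integrable u (volume.restrict Ω))
    (ha : ContinuousOn a (closure Ω)) :
    Integrable (fun x => inner ℝ (u x) (a x)) (volume.restrict Ω) := by
  obtain ⟨B, hB⟩ := (isCompact_iff_compactSpace.mpr hc).exists_bound_of_continuousOn ha
  refine Integrable.mono' (hu.norm.mul_const B) (hu.1.inner
    ((ha.mono subset_closure).aestronglyMeasurable hΩ.measurableSet)) ?_
  filter_upwards [ae_restrict_mem hΩ.measurableSet] with x hx
  refine (norm_inner_le_norm _ _).trans ?_
  gcongr
  exact hB x (subset_closure hx)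

theorem TestField.continuousOn_slice (φ : TestField Ω T) {t : ℝ} (ht : t ∈ Icc 0 T) :
    ContinuousOn (fun x => φ.toFun (t, x)) (closure Ω) :=
  φ.continuousOn_toFun.comp (by fun_prop) fun _ hx => ⟨ht, hx⟩

theorem pairing_add [CompactSpace (closure Ω)] (hΩ : IsOpen Ω) {u : Space d → Space d}
    (hu : Integrable u (volume.restrict Ω)) (φ ψ : TestField Ω T) {t : ℝ} (ht : t ∈ Icc 0 T) :
    pairing Ω u (φ.add ψ) t = pairing Ω u φ t + pairing Ω u ψ t := by
  simp only [pairing, TestField.add, inner_add_right]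
  exact integral_add (integrable_inner_of_continuousOn hΩ hu (φ.continuousOn_slice ht))
    (integrable_inner_of_continuousOn hΩ hu (ψ.continuousOn_slice ht))

theorem IsFluxPair.flux_add [CompactSpace (closure Ω)] (hΩ : IsOpen Ω)
    {u : ℝ → Space d → Space d} {M : ℝ → Space d → Mat d} (h : IsFluxPair Ω T u M)
    (φ ψ : TestField Ω T) :
    ∀ᵐ t ∂timeMeasure T, flux Ω (u t) (M t) (φ.add ψ) t =
      flux Ω (u t) (M t) φ t + flux Ω (u t) (M t) ψ t := by
  filter_upwards [(h.linftyL1 hΩ φ).ae_integrable, (h.linftyL1 hΩ ψ).ae_integrable] with t h1 h2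
  rw [flux, flux, flux, ← integral_add h1 h2]
  congr 1 with x
  simp only [TestField.add, inner_add_right, frob_add_right]
  ring

/-- The flux tested with `η(t) φ`. -/
theorem IsFluxPair.flux_timeMul [CompactSpace (closure Ω)] (hΩ : IsOpen Ω)
    {u : ℝ → Space d → Space d} {M : ℝ → Space d → Mat d} (h : IsFluxPair Ω T u M)
    {η : ℝ → ℝ} (hη : ContDiff ℝ 1 η) (φ : TestField Ω T) :
    ∀ᵐ t ∂timeMeasure T, flux Ω (u t) (M t) (φ.timeMul hη) t =
      deriv η t * pairing Ω (u t) φ t + η t * flux Ω (u t) (M t) φ t := by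
  filter_upwards [(h.linftyL1 hΩ φ).ae_integrable,
    (h.velocity.inner_continuousOn hΩ φ.continuousOn_toFun).ae_integrable] with t h1 h2
  rw [flux, flux, pairing, ← integral_const_mul, ← integral_const_mul,
    ← integral_add (h2.const_mul _) (h1.const_mul _)]
  congr 1 with x
  simp only [TestField.timeMul, inner_add_right, frob_smul_right, real_inner_smul_right]
  ring

/-! ### Almost every time -/

theorem frequently_nhdsLT_of_ae (hT : 0 < T) {P : ℝ → Prop} (h : ∀ᵐ t ∂timeMeasure T, P t) :
    ∃ᶠ t in 𝓝[<] T, P t ∧ t ∈ Ioo 0 T := by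
  rw [frequently_iff]
  intro U hU
  obtain ⟨l, hl, hlU⟩ := (mem_nhdsLT_iff_exists_Ioo_subset' hT).mp hU
  have hpos : 0 < volume.restrict (Ioo 0 T) (Ioo (max l 0) T) := by
    rw [Measure.restrict_apply measurableSet_Ioo,
      inter_eq_left.mpr (Ioo_subset_Ioo_left (le_max_right _ _)), Real.volume_Ioo]
    simp [hT, mem_Iio.mp hl]
  have := frequently_ae_iff.mpr hpos.ne'
  obtain ⟨t, ht, htP⟩ := (this.and_eventually h).exists
  exact ⟨t, hlU ⟨(le_max_left _ _).trans_lt ht.1, ht.2⟩, htP,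
    (le_max_right _ _).trans_lt ht.1, ht.2⟩

theorem frequently_nhdsGT_of_ae (hT : 0 < T) {P : ℝ → Prop} (h : ∀ᵐ t ∂timeMeasure T, P t) :
    ∃ᶠ t in 𝓝[>] 0, P t ∧ t ∈ Ioo 0 T := by
  rw [frequently_iff]
  intro U hU
  obtain ⟨r, hr, hrU⟩ := (mem_nhdsGT_iff_exists_Ioo_subset' hT).mp hU
  have hpos : 0 < volume.restrict (Ioo 0 T) (Ioo 0 (min r T)) := by
    rw [Measure.restrict_apply measurableSet_Ioo,
      inter_eq_left.mpr (Ioo_subset_Ioo_right (min_le_right _ _)), Real.volume_Ioo]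
    simp [hT, mem_Ioi.mp hr]
  have := frequently_ae_iff.mpr hpos.ne'
  obtain ⟨t, ht, htP⟩ := (this.and_eventually h).exists
  exact ⟨t, hrU ⟨ht.1, ht.2.trans_le (min_le_left _ _)⟩, htP, ht.1,
    ht.2.trans_le (min_le_right _ _)⟩

theorem ae_mem_Ioo : ∀ᵐ t ∂timeMeasure T, t ∈ Ioo 0 T := ae_restrict_mem measurableSet_Ioo

theorem intervalIntegrable_of_integrable {f : ℝ → ℝ} (hf : Integrable f (timeMeasure T)) {a b : ℝ}
    (ha : a ∈ Icc 0 T) (hb : b ∈ Icc 0 T) : IntervalIntegrable f volume a b := by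
  rw [intervalIntegrable_iff]
  have h2 : IntegrableOn f (Icc 0 T) := by
    rw [integrableOn_Icc_iff_integrableOn_Ioo]
    exact hf
  refine h2.mono_set ?_
  exact uIoc_subset_uIcc.trans (uIcc_subset_Icc ha hb)

theorem intervalIntegral_congr_timeMeasure {f g : ℝ → ℝ} (h : ∀ᵐ t ∂timeMeasure T, f t = g t)
    {a b : ℝ} (ha : a ∈ Icc 0 T) (hb : b ∈ Icc 0 T) : ∫ t in a..b, f t = ∫ t in a..b, g t := by
  refine intervalIntegral.integral_congr_ae ?_
  have h1 := (ae_restrict_iff' measurableSet_Ioo).mp h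
  have h2 : ∀ᵐ t : ℝ, t ≠ T := by simp [ae_iff]
  filter_upwards [h1, h2] with t ht htT htm
  have h3 := uIoc_subset_uIcc.trans (uIcc_subset_Icc ha hb) htm
  have h4 : 0 < t := (le_min ha.1 hb.1).trans_lt htm.1
  exact ht ⟨h4, lt_of_le_of_ne h3.2 htT⟩

theorem integral_timeMeasure (hT : 0 < T) (f : ℝ → ℝ) :
    ∫ t, f t ∂timeMeasure T = ∫ t in 0..T, f t := by
  rw [intervalIntegral.integral_of_le hT.le, integral_Ioc_eq_integral_Ioo]

theorem continuousOn_primitive_timeMeasure (hT : 0 < T) {f : ℝ → ℝ}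
    (hf : Integrable f (timeMeasure T)) :
    ContinuousOn (fun t => ∫ τ in 0..t, f τ) (Icc 0 T) := by
  have := intervalIntegral.continuousOn_primitive_interval' (b₁ := 0) (b₂ := T)
    (intervalIntegrable_of_integrable hf (left_mem_Icc.mpr hT.le) (right_mem_Icc.mpr hT.le))
    (left_mem_uIcc)
  rwa [uIcc_of_le hT.le] at this

/-- Testing with `φ(t)` is close to testing with `φ(t₀)` for `t` close to `t₀`. -/
theorem exists_pairing_close [hc : CompactSpace (closure Ω)] (hΩ : IsOpen Ω)
    {u : ℝ → Space d → Space d} (hu : LinftyL1 Ω T fun p => u p.1 p.2) (φ : TestField Ω T) {t₀ : ℝ}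
    (ht₀ : t₀ ∈ Icc 0 T) {ε : ℝ} (hε : 0 < ε) :
    ∃ δ > 0, ∀ᵐ t ∂timeMeasure T, |t - t₀| < δ →
      |pairing Ω (u t) φ t - pairing Ω (u t) φ t₀| ≤ ε := by
  obtain ⟨C, hC0, hC⟩ := hu.exists_integral_norm_le
  have hcpt : IsCompact (Icc 0 T ×ˢ closure Ω) :=
    isCompact_Icc.prod (isCompact_iff_compactSpace.mpr hc)
  obtain ⟨δ, hδ, h⟩ := Metric.uniformContinuousOn_iff.mp
    (hcpt.uniformContinuousOn_of_continuous φ.continuousOn_toFun) (ε / (C + 1)) (by positivity)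
  refine ⟨δ, hδ, ?_⟩
  filter_upwards [hC, hu.ae_integrable, ae_mem_Ioo] with t hCt hint ht htδ
  have ht' := Ioo_subset_Icc_self ht
  rw [pairing, pairing, ← integral_sub
    (integrable_inner_of_continuousOn hΩ hint (φ.continuousOn_slice ht'))
    (integrable_inner_of_continuousOn hΩ hint (φ.continuousOn_slice ht₀))]
  calc |∫ x in Ω, (inner ℝ (u t x) (φ.toFun (t, x)) - inner ℝ (u t x) (φ.toFun (t₀, x)))|
      ≤ ∫ x in Ω, ‖u t x‖ * (ε / (C + 1)) := by
        refine norm_integral_le_of_norm_le (G := ℝ) (hint.norm.mul_const _) ?_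
        filter_upwards [ae_restrict_mem hΩ.measurableSet] with x hx
        rw [← inner_sub_right]
        refine (norm_inner_le_norm _ _).trans ?_
        gcongr
        rw [← dist_eq_norm]
        refine (h _ ⟨ht', subset_closure hx⟩ _ ⟨ht₀, subset_closure hx⟩ ?_).le
        simpa [Prod.dist_eq, Real.dist_eq] using htδ
    _ ≤ C * (ε / (C + 1)) := by
        rw [integral_mul_const]
        gcongr
    _ ≤ ε := by
        rw [mul_div_assoc', div_le_iff₀ (by positivity)]
        nlinarith

theorem IsGoodRep.exists_bound {E Eg : ℝ → ℝ} (h : IsGoodRep T E Eg) (hT : 0 ≤ T) :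
    ∃ C : ℝ, ∀ t ∈ Icc 0 T, |Eg t| ≤ C := by
  refine ⟨(eVariationOn Eg (Icc 0 T)).toReal + |Eg 0|, fun t ht => ?_⟩
  have h1 := h.boundedVariationOn.dist_le ht (left_mem_Icc.mpr hT)
  rw [Real.dist_eq] at h1
  linarith [abs_sub_abs_le_abs_sub (Eg t) (Eg 0)]

theorem IsGoodRep.integrable {E Eg : ℝ → ℝ} (h : IsGoodRep T E Eg) (hT : 0 ≤ T) :
    Integrable Eg (timeMeasure T) := by
  obtain ⟨p, q, hp, hq, hpq⟩ :=
    h.boundedVariationOn.locallyBoundedVariationOn.exists_monotoneOn_sub_monotoneOn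
  have hmeas : AEMeasurable Eg (timeMeasure T) := by
    rw [hpq]
    exact (aemeasurable_restrict_of_monotoneOn measurableSet_Ioo
      (hp.mono Ioo_subset_Icc_self)).sub (aemeasurable_restrict_of_monotoneOn measurableSet_Ioo
      (hq.mono Ioo_subset_Icc_self))
  obtain ⟨C, hC⟩ := h.exists_bound hT
  refine Integrable.of_bound hmeas.aestronglyMeasurable C ?_
  filter_upwards [ae_mem_Ioo] with t ht using hC t (Ioo_subset_Icc_self ht)

/-- The extension by constants of `negSup f` from `[0,T]` to `ℝ`. -/
noncomputable def negSupExt {Y : Type*} [TopologicalSpace Y] (hT : 0 ≤ T)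
    (f : C(Icc 0 T × Y, ℝ)) (τ : ℝ) : ℝ := negSup f (projIcc 0 T hT τ)

theorem regWeight_eq_negSupExt (hd : 1 ≤ d) (hΩ : IsBoundedLipschitzDomain Ω) (hT : 0 ≤ T)
    (φ : TestField Ω T) {τ : ℝ} (hτ : τ ∈ Icc 0 T) :
    regWeight Ω φ τ = 2 * negSupExt hT (symbol φ) τ := by
  rw [negSupExt, projIcc_of_mem hT hτ, ← regWeight_eq hd hΩ φ]

theorem continuous_negSupExt {Y : Type*} [TopologicalSpace Y] [CompactSpace Y] (hT : 0 ≤ T)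
    (f : C(Icc 0 T × Y, ℝ)) : Continuous (negSupExt hT f) :=
  (continuous_negSup f).comp continuous_projIcc

theorem integrable_continuous_mul {k w : ℝ → ℝ} (hk : Continuous k)
    (hw : Integrable w (timeMeasure T)) :
    Integrable (fun τ => k τ * w τ) (timeMeasure T) := by
  obtain ⟨C, hC⟩ := isCompact_Icc.exists_bound_of_continuousOn (s := Icc 0 T) hk.continuousOn
  refine hw.bdd_mul hk.aestronglyMeasurable (c := C) ?_
  filter_upwards [ae_mem_Ioo] with t ht using hC t (Ioo_subset_Icc_self ht)

/-- `τ ↦ 𝒦(φ)(τ) w(τ)` is integrable if `w` is. -/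
theorem integrable_regWeight_mul (hd : 1 ≤ d) (hΩ : IsBoundedLipschitzDomain Ω) (hT : 0 ≤ T)
    (φ : TestField Ω T) {w : ℝ → ℝ} (hw : Integrable w (timeMeasure T)) :
    Integrable (fun τ => regWeight Ω φ τ * w τ) (timeMeasure T) := by
  have := hΩ.compactSpace
  refine (integrable_continuous_mul (((continuous_negSupExt hT (symbol φ))).const_mul 2)
    hw).congr ?_
  filter_upwards [ae_mem_Ioo] with t ht
  rw [regWeight_eq_negSupExt hd hΩ hT φ (Ioo_subset_Icc_self ht)]

/-! ### Scaling the energy-variational inequality -/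

theorem enVarInequality_smul_iff (hd : 1 ≤ d) (hΩ : IsBoundedLipschitzDomain Ω)
    {v : ℝ → Space d → Space d} {E : ℝ → ℝ} {φ : TestField Ω T} {s t c : ℝ} (hc : 0 ≤ c)
    (us : Space d → Space d) (hs : s ∈ Icc 0 T) (ht : t ∈ Icc 0 T) :
    EnVarInequality Ω v E (φ.smul c) s us t ↔
      E t - E s + c * (pairing Ω us φ s - pairing Ω (v t) φ t +
        ∫ τ in s..t, (flux Ω (v τ) (tensorSq (v τ)) φ τ +
          regWeight Ω φ τ * (kinEnergy Ω (v τ) - E τ))) ≤ 0 := by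
  have h : ∫ τ in s..t, (flux Ω (v τ) (tensorSq (v τ)) (φ.smul c) τ +
      regWeight Ω (φ.smul c) τ * (kinEnergy Ω (v τ) - E τ)) =
      c * ∫ τ in s..t, (flux Ω (v τ) (tensorSq (v τ)) φ τ +
          regWeight Ω φ τ * (kinEnergy Ω (v τ) - E τ)) := by
    rw [← intervalIntegral.integral_const_mul]
    refine intervalIntegral.integral_congr fun τ hτ => ?_
    have hτ' := uIcc_subset_Icc hs ht hτ
    have := regWeight_smul hc hd hΩ φ ⟨τ, hτ'⟩
    simp only at this ⊢
    rw [flux_smul, this]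
    ring
  rw [EnVarInequality, h, pairing_smul, pairing_smul]
  constructor <;> intro h' <;> linarith

theorem ae_energy_le_of_enVarInequality (hd : 1 ≤ d) (hΩ : IsBoundedLipschitzDomain Ω)
    {v : ℝ → Space d → Space d} {Eg : ℝ → ℝ}
    (h : ∀ φ : TestField Ω T, ∀ᵐ s ∂timeMeasure T, ∀ᵐ t ∂timeMeasure T, s < t →
      EnVarInequality Ω v Eg φ s (v s) t) :
    ∀ᵐ s ∂timeMeasure T, ∀ᵐ t ∂timeMeasure T, s < t → Eg t ≤ Eg s := by
  obtain ⟨φ⟩ : Nonempty (TestField Ω T) := inferInstance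
  -- Testing with zero leaves only the energies.
  filter_upwards [h (φ.smul 0), ae_mem_Ioo] with s hs hs'
  filter_upwards [hs, ae_mem_Ioo] with t ht ht' hst
  have := (enVarInequality_smul_iff hd hΩ le_rfl (v s) (Ioo_subset_Icc_self hs')
    (Ioo_subset_Icc_self ht')).mp (ht hst)
  linarith

/-- The inequality that remains when the test field is replaced by `n φ` and `n → ∞`, for test
fields that vanish at time `T`. -/
theorem momentum_le_of_enVarInequality (hd : 1 ≤ d) (hΩ : IsBoundedLipschitzDomain Ω)
    (hT : 0 < T) {v₀ : Space d → Space d} {v : ℝ → Space d → Space d} {E Eg : ℝ → ℝ}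
    (hv : MemLinftyLsigma Ω T v) (hE : IsGoodRep T E Eg) {φ : TestField Ω T}
    (h : ∀ n : ℕ, ∀ᵐ t ∂timeMeasure T, EnVarInequality Ω v Eg (φ.smul n) 0 v₀ t)
    (hφ : ∀ x ∈ Ω, φ.toFun (T, x) = 0) :
    pairing Ω v₀ φ 0 + ∫ τ in 0..T, flux Ω (v τ) (tensorSq (v τ)) φ τ ≤
      ∫ τ in 0..T, 2 * negSupExt hT.le (symbol φ) τ * (Eg τ - kinEnergy Ω (v τ)) := by
  have := hΩ.compactSpace
  have h0 : (0 : ℝ) ∈ Icc 0 T := left_mem_Icc.mpr hT.le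
  have hTm : T ∈ Icc 0 T := right_mem_Icc.mpr hT.le
  have hflux := hv.isFluxPair.integrable_flux hΩ.isOpen φ
  have hw : Integrable (fun τ => kinEnergy Ω (v τ) - Eg τ) (timeMeasure T) :=
    hv.integrable_kinEnergy.sub (hE.integrable hT.le)
  have hreg := integrable_regWeight_mul hd hΩ hT.le φ hw
  set I : ℝ → ℝ := fun t => ∫ τ in 0..t, (flux Ω (v τ) (tensorSq (v τ)) φ τ +
          regWeight Ω φ τ * (kinEnergy Ω (v τ) - Eg τ)) with hI
  have h1 : ∀ᵐ t ∂timeMeasure T, pairing Ω v₀ φ 0 - pairing Ω (v t) φ t + I t ≤ 0 := by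
    filter_upwards [ae_all_iff.mpr h, ae_mem_Ioo] with t ht htm
    by_contra! hpos
    obtain ⟨n, hn⟩ := exists_nat_gt (-(Eg t - Eg 0) /
      (pairing Ω v₀ φ 0 - pairing Ω (v t) φ t + I t))
    rw [div_lt_iff₀ hpos] at hn
    have := (enVarInequality_smul_iff hd hΩ n.cast_nonneg v₀ h0
      (Ioo_subset_Icc_self htm)).mp (ht n)
    linarith
  -- The inequality holds for almost every time only, and is transported to `T` along a sequence.
  have hIcont : Tendsto I (𝓝[<] T) (𝓝 (I T)) :=
    ((continuousOn_primitive_timeMeasure hT (hflux.add hreg)).continuousWithinAt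
      hTm).tendsto.mono_left
      (nhdsWithin_le_of_mem (mem_nhdsLT_iff_exists_Ioo_subset.mpr
        ⟨0, hT, Ioo_subset_Icc_self⟩))
  have h2 : pairing Ω v₀ φ 0 + I T ≤ 0 := by
    refine le_of_forall_pos_le_add fun ε hε => ?_
    obtain ⟨δ, hδ, hclose⟩ :=
      exists_pairing_close hΩ.isOpen hv.linftyL1 φ hTm (half_pos hε)
    have hnear : ∀ᶠ t in 𝓝[<] T, |t - T| < δ :=
      nhdsWithin_le_nhds (Metric.ball_mem_nhds T hδ)
    have hIev : ∀ᶠ t in 𝓝[<] T, I T - ε / 2 < I t :=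
      hIcont.eventually (lt_mem_nhds (by linarith))
    obtain ⟨t, ⟨⟨ht1, ht2⟩, -⟩, ht3, ht4⟩ :=
      ((frequently_nhdsLT_of_ae hT (h1.and hclose)).and_eventually (hnear.and hIev)).exists
    have h3 := ht2 ht3
    have h4 : pairing Ω (v t) φ T = 0 := by
      rw [pairing]
      refine setIntegral_eq_zero_of_forall_eq_zero fun x hx => ?_
      rw [hφ x hx, inner_zero_right]
    rw [h4, sub_zero, abs_le] at h3
    linarith [h3.1, h3.2]
  have h3 : I T = (∫ τ in 0..T, flux Ω (v τ) (tensorSq (v τ)) φ τ) -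
      ∫ τ in 0..T, 2 * negSupExt hT.le (symbol φ) τ * (Eg τ - kinEnergy Ω (v τ)) := by
    rw [hI]
    simp only
    rw [intervalIntegral.integral_add (intervalIntegrable_of_integrable hflux h0 hTm)
      (intervalIntegrable_of_integrable hreg h0 hTm), sub_eq_add_neg,
      ← intervalIntegral.integral_neg]
    congr 1
    refine intervalIntegral.integral_congr fun τ hτ => ?_
    rw [uIcc_of_le hT.le] at hτ
    rw [regWeight_eq_negSupExt hd hΩ hT.le φ hτ]
    ring
  linarith

/-! ### Representation of functionals dominated by a supremum -/

section Representation

variable {Y : Type*} [TopologicalSpace Y] [CompactSpace Y] [Nonempty Y]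

/-- The sublinear functional `f ↦ ∫_0^T 2 w(τ) sup_y (-f(τ, y)) dτ`. -/
noncomputable def supFunctional (hT : 0 ≤ T) (w : ℝ → ℝ) (f : C(Icc 0 T × Y, ℝ)) : ℝ :=
  ∫ τ, 2 * negSupExt hT f τ * w τ ∂timeMeasure T

variable {w : ℝ → ℝ}

omit [Nonempty Y] in
theorem integrable_supFunctional (hT : 0 ≤ T) (hw : Integrable w (timeMeasure T))
    (f : C(Icc 0 T × Y, ℝ)) :
    Integrable (fun τ => 2 * negSupExt hT f τ * w τ) (timeMeasure T) :=
  integrable_continuous_mul ((continuous_negSupExt hT f).const_mul 2) hw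

theorem supFunctional_add_le (hT : 0 ≤ T) (hw : Integrable w (timeMeasure T))
    (hw0 : ∀ᵐ t ∂timeMeasure T, 0 ≤ w t) (f g : C(Icc 0 T × Y, ℝ)) :
    supFunctional hT w (f + g) ≤ supFunctional hT w f + supFunctional hT w g := by
  rw [supFunctional, supFunctional, supFunctional,
    ← integral_add (integrable_supFunctional hT hw f) (integrable_supFunctional hT hw g)]
  refine integral_mono_ae (integrable_supFunctional hT hw _)
    ((integrable_supFunctional hT hw f).add (integrable_supFunctional hT hw g)) ?_
  filter_upwards [hw0] with t ht
  have := negSup_add_le f g (projIcc 0 T hT t)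
  simp only [negSupExt]
  rw [← add_mul, ← mul_add]
  gcongr

omit [CompactSpace Y] [Nonempty Y] in
theorem supFunctional_smul (hT : 0 ≤ T) {c : ℝ} (hc : 0 ≤ c) (f : C(Icc 0 T × Y, ℝ)) :
    supFunctional hT w (c • f) = c * supFunctional hT w f := by
  rw [supFunctional, supFunctional, ← integral_const_mul]
  congr 1 with t
  rw [negSupExt, negSupExt, negSup_smul hc]
  ring

omit [CompactSpace Y] in
theorem supFunctional_nonpos (hT : 0 ≤ T) (hw0 : ∀ᵐ t ∂timeMeasure T, 0 ≤ w t)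
    {f : C(Icc 0 T × Y, ℝ)} (hf : ∀ p, 0 ≤ f p) : supFunctional hT w f ≤ 0 := by
  refine integral_nonpos_of_ae ?_
  filter_upwards [hw0] with t ht
  have : negSupExt hT f t ≤ 0 := negSup_le fun y => neg_nonpos.mpr (hf _)
  simp only [Pi.zero_apply]
  nlinarith

omit [CompactSpace Y] in
theorem supFunctional_of_time (hT : 0 ≤ T) {f : C(Icc 0 T × Y, ℝ)} {χ : ℝ → ℝ}
    (hf : ∀ p, f p = χ p.1) :
    supFunctional hT w f = -∫ t, 2 * w t * χ t ∂timeMeasure T := by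
  rw [supFunctional, ← integral_neg]
  refine integral_congr_ae ?_
  filter_upwards [ae_mem_Ioo] with t ht
  rw [negSupExt, projIcc_of_mem hT (Ioo_subset_Icc_self ht),
    negSup_of_forall_eq (c := χ t) fun y => hf _]
  ring

variable [MeasurableSpace Y] [BorelSpace Y] [SecondCountableTopology Y] [T2Space Y]

open scoped CompactlySupported in
/-- A linear relation dominated by `supFunctional` is integration against a positive measure whose
time marginal is `2 w(t) dt`. The linear functional is extended by the Hahn–Banach theorem and
represented by the Riesz–Markov–Kakutani theorem; the marginal is known exactly because the
supremum is linear on functions of time alone. -/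
theorem exists_measure_of_le_supFunctional (hT : 0 ≤ T) (hw : Integrable w (timeMeasure T))
    (hw0 : ∀ᵐ t ∂timeMeasure T, 0 ≤ w t) {ι : Type*} [Nonempty ι]
    (N : ι → C(Icc 0 T × Y, ℝ)) (ℓ : ι → ℝ)
    (hadd : ∀ a b, ∃ c, N c = N a + N b ∧ ℓ c = ℓ a + ℓ b)
    (hsmul : ∀ (r : ℝ) (a), ∃ c, N c = r • N a ∧ ℓ c = r * ℓ a)
    (hle : ∀ a, ℓ a ≤ supFunctional hT w (N a)) :
    ∃ m : Measure (ℝ × Y), IsFiniteMeasure m ∧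
      m.fst = (timeMeasure T).withDensity (fun t => ENNReal.ofReal (2 * w t)) ∧
      ∀ a, ∫ p, N a (projIcc 0 T hT p.1, p.2) ∂m = -ℓ a := by
  -- The graph of the functional on the span of the `N a`.
  let G : Submodule ℝ (C(Icc 0 T × Y, ℝ) × ℝ) :=
    { carrier := {p | ∃ a, p = (N a, ℓ a)}
      zero_mem' := by
        obtain ⟨a⟩ := ‹Nonempty ι›
        obtain ⟨c, hc, hc'⟩ := hsmul 0 a
        exact ⟨c, by rw [hc, hc', zero_smul, zero_mul]; rfl⟩
      add_mem' := by
        rintro _ _ ⟨a, rfl⟩ ⟨b, rfl⟩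
        obtain ⟨c, hc, hc'⟩ := hadd a b
        exact ⟨c, by simp [hc, hc']⟩
      smul_mem' := by
        rintro r _ ⟨a, rfl⟩
        obtain ⟨c, hc, hc'⟩ := hsmul r a
        exact ⟨c, by simp [hc, hc']⟩ }
  have hG : ∀ p ∈ G, p.1 = 0 → p.2 = 0 := by
    have hnonpos : ∀ a, N a = 0 → ℓ a ≤ 0 := fun a ha =>
      (hle a).trans (supFunctional_nonpos hT hw0 (by simp [ha]))
    rintro _ ⟨a, rfl⟩ ha
    obtain ⟨c, hc, hc'⟩ := hsmul (-1) a
    have h1 := hnonpos a ha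
    have h2 := hnonpos c (by rw [hc, show N a = 0 from ha, smul_zero])
    simp only
    linarith
  obtain ⟨L, hL, hLle⟩ := exists_extension_of_le_sublinear G.toLinearPMap (supFunctional hT w)
    (fun c hc f => supFunctional_smul hT hc.le f) (supFunctional_add_le hT hw hw0) (by
      intro x
      obtain ⟨a, ha⟩ := Submodule.mem_graph_toLinearPMap hG x
      have h1 := congrArg Prod.fst ha
      have h2 := congrArg Prod.snd ha
      simp only at h1 h2
      rw [h1, h2]
      exact hle a)
  have hLN : ∀ a, L (N a) = ℓ a := by
    intro a
    have hmem : N a ∈ G.toLinearPMap.domain := by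
      rw [Submodule.toLinearPMap_domain]
      exact ⟨(N a, ℓ a), ⟨a, rfl⟩, rfl⟩
    rw [hL ⟨N a, hmem⟩]
    have h1 := Submodule.mem_graph_toLinearPMap hG ⟨N a, hmem⟩
    have h2 := hG _ (G.sub_mem h1 (⟨a, rfl⟩ : (N a, ℓ a) ∈ G)) (by simp)
    exact sub_eq_zero.mp h2
  -- `supFunctional` is nonpositive on nonnegative functions, so it is `-L` that is positive.
  let Λ₀ : C_c(Icc 0 T × Y, ℝ) →ₗ[ℝ] ℝ :=
    { toFun := fun f => -L f.toContinuousMap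
      map_add' := fun f g => by
        rw [show (f + g).toContinuousMap = f.toContinuousMap + g.toContinuousMap from rfl, map_add]
        ring
      map_smul' := fun c f => by
        rw [show (c • f).toContinuousMap = c • f.toContinuousMap from rfl, map_smul]
        simp }
  let Λ : C_c(Icc 0 T × Y, ℝ) →ₚ[ℝ] ℝ := PositiveLinearMap.mk₀ Λ₀ fun f hf =>
    neg_nonneg.mpr ((hLle _).trans (supFunctional_nonpos hT hw0 fun p => hf p))
  have hΛ : ∀ f : C(Icc 0 T × Y, ℝ), ∫ p, f p ∂(RealRMK.rieszMeasure Λ) = -L f := fun f =>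
    RealRMK.integral_rieszMeasure Λ (CompactlySupportedContinuousMap.continuousMapEquiv f)
  set μ := RealRMK.rieszMeasure Λ
  have hemb : Measurable fun p : Icc 0 T × Y => ((p.1 : ℝ), p.2) := by fun_prop
  refine ⟨μ.map fun p => ((p.1 : ℝ), p.2), inferInstance, ?_, fun a => ?_⟩
  · have hfin : IsFiniteMeasure
        ((timeMeasure T).withDensity fun t => ENNReal.ofReal (2 * w t)) :=
      isFiniteMeasure_withDensity_ofReal (hw.const_mul 2).2
    refine ext_of_forall_integral_eq_of_IsFiniteMeasure fun χ => ?_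
    let f : C(Icc 0 T × Y, ℝ) := ⟨fun p => χ p.1, by fun_prop⟩
    -- The bounds at `f` and `-f` coincide, so the functional is determined at `f`.
    have h1 := hLle f
    have h2 := hLle (-f)
    rw [supFunctional_of_time hT (χ := χ) fun p => rfl] at h1
    rw [supFunctional_of_time hT (χ := fun t => -χ t) fun p => rfl, map_neg] at h2
    simp only [mul_neg, integral_neg, neg_neg] at h2
    rw [Measure.fst, Measure.map_map measurable_fst hemb,
      integral_map (by fun_prop) χ.continuous.aestronglyMeasurable]
    rw [integral_withDensity_eq_integral_toReal_smul₀ (by fun_prop)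
      (ae_of_all _ fun t => ENNReal.ofReal_lt_top)]
    have h3 : ∫ t, (ENNReal.ofReal (2 * w t)).toReal • χ t ∂timeMeasure T =
        ∫ t, 2 * w t * χ t ∂timeMeasure T := by
      refine integral_congr_ae ?_
      filter_upwards [hw0] with t ht
      rw [ENNReal.toReal_ofReal (by positivity), smul_eq_mul]
    rw [h3]
    refine (hΛ f).trans ?_
    linarith
  · rw [integral_map hemb.aemeasurable (Continuous.aestronglyMeasurable (by fun_prop)), ← hLN,
      ← hΛ]
    simp

end Representation

/-! ### Disintegration -/

/-- A finite measure on `ℝ × (X × S)` whose time marginal has a bounded density disintegrates into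
kernels `λ_t(dx)` and `ν_{t,x}(dθ)`, the mass of `λ_t` being the density. -/
theorem exists_kernels_of_fst_eq {X S : Type*} [MeasurableSpace X] [StandardBorelSpace X]
    [Nonempty X] [MeasurableSpace S] [StandardBorelSpace S] [Nonempty S]
    {ν : Measure ℝ} [SFinite ν] {ρ : ℝ → ℝ≥0∞} (hρ : Measurable ρ) {C : ℝ≥0∞} (hC : C ≠ ⊤)
    (hρC : ∀ t, ρ t ≤ C) (m : Measure (ℝ × (X × S))) [IsFiniteMeasure m]
    (hm : m.fst = ν.withDensity ρ) :
    ∃ (lam : Kernel ℝ X) (ν' : Kernel (ℝ × X) S), IsFiniteKernel lam ∧ IsMarkovKernel ν' ∧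
      (∀ t, lam t univ = ρ t) ∧ m = ν ⊗ₘ (lam ⊗ₖ ν') := by
  have hf : Measurable (Function.uncurry fun (t : ℝ) (_ : X) => ρ t) := hρ.comp measurable_fst
  have happ : ∀ t, Kernel.withDensity m.condKernel.fst (fun t _ => ρ t) t =
      ρ t • m.condKernel.fst t := fun t => by
    rw [Kernel.withDensity_apply _ hf, withDensity_const]
  have hfin : IsFiniteKernel (Kernel.withDensity m.condKernel.fst fun t _ => ρ t) :=
    ⟨C, hC.lt_top, fun t => by simp [happ, hρC]⟩
  refine ⟨Kernel.withDensity m.condKernel.fst fun t _ => ρ t, m.condKernel.condKernel, hfin,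
    inferInstance, fun t => by simp [happ], ?_⟩
  have hcomp : ∀ t, (Kernel.withDensity m.condKernel.fst (fun t _ => ρ t) ⊗ₖ
      m.condKernel.condKernel) t = ρ t • m.condKernel t := fun t => by
    ext s hs
    rw [Kernel.compProd_apply hs, happ, lintegral_smul_measure, ← Kernel.compProd_apply hs,
      Kernel.disintegrate, Measure.smul_apply]
  ext s hs
  conv_lhs => rw [← m.disintegrate m.condKernel, hm]
  rw [Measure.compProd_apply hs, Measure.compProd_apply hs,
    lintegral_withDensity_eq_lintegral_mul _ hρ (Kernel.measurable_kernel_prodMk_left hs)]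
  simp [hcomp]

/-! ### Integration by parts in time -/

/-- If `g` has the weak derivative `F` on `(0,T)` and the initial trace `g₀`, then `g` is almost
everywhere the primitive of `F` starting at `g₀`. -/
theorem ae_eq_primitive_of_weak (hT : 0 < T) {g F : ℝ → ℝ} {g₀ : ℝ}
    (hg : Integrable g (timeMeasure T)) (hF : Integrable F (timeMeasure T))
    (h : ∀ η : ℝ → ℝ, ContDiff ℝ 1 η → η T = 0 →
      η 0 * g₀ + ∫ t in 0..T, (deriv η t * g t + η t * F t) = 0) :
    ∀ᵐ t ∂timeMeasure T, g t = g₀ + ∫ τ in 0..t, F τ := by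
  have h0 : (0 : ℝ) ∈ Icc 0 T := left_mem_Icc.mpr hT.le
  have hTm : T ∈ Icc 0 T := right_mem_Icc.mpr hT.le
  set P : ℝ → ℝ := fun t => ∫ τ in 0..t, F τ with hP
  have hPint : Integrable P (timeMeasure T) := by
    have := (continuousOn_primitive_timeMeasure hT hF).integrableOn_Icc (μ := volume)
    rw [integrableOn_Icc_iff_integrableOn_Ioo] at this
    exact this
  have hloc : LocallyIntegrableOn (fun t => g t - (g₀ + P t)) (Ioo 0 T) := by
    refine IntegrableOn.locallyIntegrableOn ?_
    exact hg.sub ((integrable_const _).add hPint)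
  rw [ae_restrict_iff' measurableSet_Ioo]
  have key := isOpen_Ioo.ae_eq_zero_of_integral_contDiff_smul_eq_zero hloc ?_
  · filter_upwards [key] with t ht htm
    linarith [ht htm]
  intro χ hχ hχc hχs
  have hχcont : Continuous χ := hχ.continuous
  have hχ0 : ∀ t, t ∉ Ioo 0 T → χ t = 0 := fun t ht =>
    image_eq_zero_of_notMem_tsupport fun hmem => ht (hχs hmem)
  -- The primitive that vanishes at `T`; its value at `0` need not vanish and sees `g₀`.
  set η : ℝ → ℝ := fun t => ∫ r in T..t, χ r with hη
  have hηd : ∀ t, HasDerivAt η (χ t) t := fun t =>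
    intervalIntegral.integral_hasDerivAt_right (hχcont.intervalIntegrable _ _)
      (hχcont.stronglyMeasurableAtFilter _ _) hχcont.continuousAt
  have hηderiv : deriv η = χ := funext fun t => (hηd t).deriv
  have hηC : ContDiff ℝ 1 η := by
    rw [contDiff_one_iff_deriv, hηderiv]
    exact ⟨fun t => (hηd t).differentiableAt, hχcont⟩
  have hw := h η hηC (by simp [hη])
  have hχg : Integrable (fun t => χ t * g t) (timeMeasure T) :=
    integrable_continuous_mul hχcont hg
  have hχP : Integrable (fun t => χ t * P t) (timeMeasure T) :=
    integrable_continuous_mul hχcont hPint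
  have hηF : Integrable (fun t => η t * F t) (timeMeasure T) :=
    integrable_continuous_mul hηC.continuous hF
  -- The primitives are paired by exchanging the order of integration on the triangle `τ < r`.
  have hfub : ∫ t, η t * F t ∂timeMeasure T = -∫ t, χ t * P t ∂timeMeasure T := by
    have hprod : Integrable (fun p : ℝ × ℝ => {q : ℝ × ℝ | q.2 < q.1}.indicator
        (fun q => χ q.1 * F q.2) p) ((timeMeasure T).prod (timeMeasure T)) := by
      refine Integrable.indicator (Integrable.mul_prod ?_ hF)
        (measurableSet_lt measurable_snd measurable_fst)
      exact (hχcont.integrable_of_hasCompactSupport hχc).restrict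
    have e1 : ∫ t, χ t * P t ∂timeMeasure T =
        ∫ r, ∫ τ, {q : ℝ × ℝ | q.2 < q.1}.indicator (fun q => χ q.1 * F q.2) (r, τ)
          ∂timeMeasure T ∂timeMeasure T := by
      refine integral_congr_ae ?_
      filter_upwards [ae_mem_Ioo] with r hr
      have : (fun τ => {q : ℝ × ℝ | q.2 < q.1}.indicator (fun q => χ q.1 * F q.2) (r, τ)) =
          fun τ => (Iio r).indicator (fun τ => χ r * F τ) τ := by
        ext τ; simp [indicator]
      rw [this, integral_indicator measurableSet_Iio, integral_const_mul,
        Measure.restrict_restrict measurableSet_Iio, hP]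
      simp only
      rw [intervalIntegral.integral_of_le hr.1.le, integral_Ioc_eq_integral_Ioo,
        Iio_inter_Ioo, min_eq_left hr.2.le]
    have e2 : ∫ t, η t * F t ∂timeMeasure T =
        -∫ τ, ∫ r, {q : ℝ × ℝ | q.2 < q.1}.indicator (fun q => χ q.1 * F q.2) (r, τ)
          ∂timeMeasure T ∂timeMeasure T := by
      rw [← integral_neg]
      refine integral_congr_ae ?_
      filter_upwards [ae_mem_Ioo] with τ hτ
      have : (fun r => {q : ℝ × ℝ | q.2 < q.1}.indicator (fun q => χ q.1 * F q.2) (r, τ)) =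
          fun r => (Ioi τ).indicator (fun r => χ r * F τ) r := by
        ext r; simp [indicator]
      rw [this, integral_indicator measurableSet_Ioi, integral_mul_const,
        Measure.restrict_restrict measurableSet_Ioi, Ioi_inter_Ioo, max_eq_left hτ.1.le, hη]
      simp only
      rw [intervalIntegral.integral_symm, intervalIntegral.integral_of_le hτ.2.le,
        integral_Ioc_eq_integral_Ioo]
      ring
    rw [e1, e2]
    exact congrArg Neg.neg (integral_integral_swap hprod).symm
  have hη0 : η 0 = -∫ t, χ t ∂timeMeasure T := by
    rw [integral_timeMeasure hT, hη]
    simp only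
    rw [intervalIntegral.integral_symm]
  have hχint : Integrable χ (timeMeasure T) :=
    (hχcont.integrable_of_hasCompactSupport hχc).restrict
  rw [hηderiv, ← integral_timeMeasure hT, integral_add hχg hηF, hfub, hη0] at hw
  have e3 : ∫ t, χ t • (g t - (g₀ + P t)) = ∫ t, χ t • (g t - (g₀ + P t)) ∂timeMeasure T := by
    rw [timeMeasure, setIntegral_eq_integral_of_forall_compl_eq_zero]
    intro t ht
    rw [hχ0 t ht, zero_smul]
  have e4 : ∫ t, χ t • (g t - (g₀ + P t)) ∂timeMeasure T = (∫ t, χ t * g t ∂timeMeasure T) -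
      ((∫ t, χ t ∂timeMeasure T) * g₀ + ∫ t, χ t * P t ∂timeMeasure T) := by
    have hs : Integrable (fun t => χ t * g₀ + χ t * P t) (timeMeasure T) :=
      (hχint.mul_const _).add hχP
    rw [← integral_mul_const, ← integral_add (hχint.mul_const _) hχP, ← integral_sub hχg hs]
    congr 1 with t
    simp only [smul_eq_mul]
    ring
  rw [e3, e4]
  linarith

/-! ### The concentration term -/

/-- The concentration term `∫ ∇φ(τ) : ⟨ν_{x,τ}, θ ⊗ θ⟩ dλ_τ(x)` of the momentum equation. -/
noncomputable def concFlux (lam : Kernel ℝ (closure Ω)) (ν : Kernel (ℝ × closure Ω) (Sphere d))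
    (φ : TestField Ω T) (τ : ℝ) : ℝ :=
  ∫ x : closure Ω, frob (φ.grad (τ, x.1)) (sphereMoment (ν (τ, x))) ∂(lam τ)

theorem frob_sphereMoment (A : Mat d) (ν : Measure (Sphere d)) [IsFiniteMeasure ν] :
    frob A (sphereMoment ν) = ∫ θ, quad A (θ : Space d) ∂ν := by
  have hi : ∀ i j, Integrable (fun θ : Sphere d => A i j * (θ.1 i * θ.1 j)) ν := fun i j =>
    (Continuous.integrable_of_hasCompactSupport (by fun_prop) (.of_compactSpace _))
  simp only [quad, frob, sphereMoment]
  rw [integral_finsetSum _ fun i _ => integrable_finsetSum _ fun j _ => hi i j]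
  refine Finset.sum_congr rfl fun i _ => ?_
  rw [integral_finsetSum _ fun j _ => hi i j]
  exact Finset.sum_congr rfl fun j _ => (integral_const_mul _ _).symm

/-- The function `symbol φ`, extended from `[0,T]` to `ℝ` by constants in time. -/
noncomputable def symbolExt (hT : 0 ≤ T) (φ : TestField Ω T) (p : ℝ × (closure Ω × Sphere d)) : ℝ :=
  symbol φ (projIcc 0 T hT p.1, p.2)

theorem continuous_symbolExt (hT : 0 ≤ T) (φ : TestField Ω T) : Continuous (symbolExt hT φ) := by
  unfold symbolExt
  fun_prop

theorem exists_bound_symbolExt [CompactSpace (closure Ω)] (hT : 0 ≤ T) (φ : TestField Ω T) :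
    ∃ B : ℝ, 0 ≤ B ∧ ∀ p, ‖symbolExt hT φ p‖ ≤ B :=
  ⟨‖symbol φ‖, norm_nonneg _, fun _ => (symbol φ).norm_coe_le_norm _⟩

section

variable [CompactSpace (closure Ω)] (lam : Kernel ℝ (closure Ω))
  (ν : Kernel (ℝ × closure Ω) (Sphere d)) [IsFiniteKernel lam] [IsMarkovKernel ν]

theorem concFlux_eq (hT : 0 ≤ T) (φ : TestField Ω T) {τ : ℝ} (hτ : τ ∈ Icc 0 T) :
    concFlux lam ν φ τ = ∫ z, symbolExt hT φ (τ, z) ∂((lam ⊗ₖ ν) τ) := by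
  obtain ⟨B, -, hB⟩ := exists_bound_symbolExt hT φ
  rw [ProbabilityTheory.integral_compProd]
  · rw [concFlux]
    congr 1 with x
    rw [frob_sphereMoment]
    simp [symbolExt, projIcc_of_mem hT hτ]
  · exact Integrable.of_bound ((continuous_symbolExt hT φ).comp
      (Continuous.prodMk_right τ)).aestronglyMeasurable B (ae_of_all _ fun z => hB _)

theorem integrable_concFlux (hT : 0 ≤ T) (φ : TestField Ω T) :
    Integrable (concFlux lam ν φ) (timeMeasure T) := by
  obtain ⟨B, hB0, hB⟩ := exists_bound_symbolExt hT φ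
  have hm : StronglyMeasurable fun τ => ∫ z, symbolExt hT φ (τ, z) ∂((lam ⊗ₖ ν) τ) :=
    StronglyMeasurable.integral_kernel_prod_right'
      (continuous_symbolExt hT φ).stronglyMeasurable
  have hi : Integrable (fun τ => ∫ z, symbolExt hT φ (τ, z) ∂((lam ⊗ₖ ν) τ)) (timeMeasure T) := by
    refine Integrable.of_bound hm.aestronglyMeasurable
      (B * (lam ⊗ₖ ν).bound.toReal) (ae_of_all _ fun τ => ?_)
    refine (norm_integral_le_of_norm_le_const (ae_of_all _ fun z => hB _)).trans ?_
    gcongr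
    exact ENNReal.toReal_mono (Kernel.bound_ne_top _) (Kernel.measure_le_bound _ _ _)
  refine hi.congr ?_
  filter_upwards [ae_mem_Ioo] with τ hτ
  rw [concFlux_eq lam ν hT φ (Ioo_subset_Icc_self hτ)]

omit [CompactSpace (closure Ω)] [IsFiniteKernel lam] [IsMarkovKernel ν] in
theorem concFlux_timeMul {η : ℝ → ℝ} (hη : ContDiff ℝ 1 η) (φ : TestField Ω T) (τ : ℝ) :
    concFlux lam ν (φ.timeMul hη) τ = η τ * concFlux lam ν φ τ := by
  rw [concFlux, concFlux, ← integral_const_mul]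
  congr 1 with x
  rw [frob_comm, frob_comm (φ.grad _), ← frob_smul_right]
  rfl

theorem MemLsigma.integrable {u : Space d → Space d}
    (hu : MemLsigma Ω u) : Integrable u (volume.restrict Ω) := by
  have : IsFiniteMeasure (volume.restrict Ω) := ⟨by
    rw [Measure.restrict_apply_univ]
    exact (measure_mono subset_closure).trans_lt
      (isCompact_iff_compactSpace.mpr ‹_›).measure_lt_top⟩
  exact hu.memLp.integrable (by norm_num)

end

/-- An energy-variational solution satisfies the momentum equation with a concentration measure
whose mass is twice the energy defect. -/
theorem exists_concentration (hd : 1 ≤ d) (hΩ : IsBoundedLipschitzDomain Ω) (hT : 0 < T)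
    {v₀ : Space d → Space d} (hv₀ : MemLsigma Ω v₀) {v : ℝ → Space d → Space d} {E Eg : ℝ → ℝ}
    (hv : MemLinftyLsigma Ω T v) (hE : IsGoodRep T E Eg)
    (hkin : ∀ᵐ t ∂timeMeasure T, kinEnergy Ω (v t) ≤ Eg t)
    (h : ∀ φ : TestField Ω T, ∀ᵐ t ∂timeMeasure T, EnVarInequality Ω v Eg φ 0 v₀ t) :
    ∃ (lam : Kernel ℝ (closure Ω)) (ν : Kernel (ℝ × closure Ω) (Sphere d)),
      IsFiniteKernel lam ∧ IsMarkovKernel ν ∧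
      (∀ᵐ t ∂timeMeasure T, (lam t).real univ = 2 * (Eg t - kinEnergy Ω (v t))) ∧
      ∀ φ : TestField Ω T, ∀ᵐ t ∂timeMeasure T, pairing Ω (v t) φ t = pairing Ω v₀ φ 0 +
        ∫ τ in 0..t, (flux Ω (v τ) (tensorSq (v τ)) φ τ + concFlux lam ν φ τ) := by
  have := hΩ.compactSpace
  have := hΩ.nonempty_closure
  have := nonempty_sphere hd
  have h0 : (0 : ℝ) ∈ Icc 0 T := left_mem_Icc.mpr hT.le
  have hTm : T ∈ Icc 0 T := right_mem_Icc.mpr hT.le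
  have hstd : StandardBorelSpace (closure Ω) := isClosed_closure.measurableSet.standardBorel
  have hstd' : StandardBorelSpace (Sphere d) := Metric.isClosed_sphere.measurableSet.standardBorel
  have hflux := hv.isFluxPair.integrable_flux hΩ.isOpen
  -- A bounded Borel representative of the energy defect.
  obtain ⟨C, hC⟩ := hE.exists_bound hT.le
  have hw₀ : Integrable (fun t => Eg t - kinEnergy Ω (v t)) (timeMeasure T) :=
    (hE.integrable hT.le).sub hv.integrable_kinEnergy
  set w : ℝ → ℝ := fun t => max 0 (min C (hw₀.1.aemeasurable.mk _ t)) with hw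
  have hwm : Measurable w :=
    measurable_const.max (measurable_const.min hw₀.1.aemeasurable.measurable_mk)
  have hw0 : ∀ t, 0 ≤ w t := fun t => le_max_left _ _
  have hC0 : 0 ≤ C := (abs_nonneg _).trans (hC 0 h0)
  have hwC : ∀ t, w t ≤ C := fun t => max_le hC0 (min_le_left _ _)
  have hwae : ∀ᵐ t ∂timeMeasure T, w t = Eg t - kinEnergy Ω (v t) := by
    filter_upwards [hw₀.1.aemeasurable.ae_eq_mk, hkin, ae_mem_Ioo] with t h1 h2 ht
    have h3 : 0 ≤ kinEnergy Ω (v t) := by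
      rw [kinEnergy]
      positivity
    have h4 := (le_abs_self _).trans (hC t (Ioo_subset_Icc_self ht))
    simp only [hw]
    rw [← h1, min_eq_right (by linarith), max_eq_right (by linarith)]
  have hwint : Integrable w (timeMeasure T) := hw₀.congr (hwae.mono fun t ht => ht.symm)
  -- Only test fields vanishing at time `T` are used; they are enough for testing with `η(t) φ`,
  -- `η(T) = 0`.
  have hle : ∀ φ : {φ : TestField Ω T // ∀ x ∈ Ω, φ.toFun (T, x) = 0},
      pairing Ω v₀ φ.1 0 + ∫ τ in 0..T, flux Ω (v τ) (tensorSq (v τ)) φ.1 τ ≤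
        supFunctional hT.le w (symbol φ.1) := by
    intro φ
    refine (momentum_le_of_enVarInequality hd hΩ hT hv hE (fun n => h _) φ.2).trans ?_
    rw [supFunctional, integral_timeMeasure hT]
    refine (intervalIntegral_congr_timeMeasure ?_ h0 hTm).le
    filter_upwards [hwae] with t ht
    rw [ht]
  have hne : Nonempty {φ : TestField Ω T // ∀ x ∈ Ω, φ.toFun (T, x) = 0} := by
    obtain ⟨φ⟩ : Nonempty (TestField Ω T) := inferInstance
    exact ⟨⟨φ.smul 0, fun x _ => by simp [TestField.smul]⟩⟩
  obtain ⟨m, hmfin, hmfst, hm⟩ := exists_measure_of_le_supFunctional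
    (ι := {φ : TestField Ω T // ∀ x ∈ Ω, φ.toFun (T, x) = 0}) hT.le hwint
    (ae_of_all _ hw0) (fun φ => symbol φ.1)
    (fun φ => pairing Ω v₀ φ.1 0 + ∫ τ in 0..T, flux Ω (v τ) (tensorSq (v τ)) φ.1 τ)
    (fun a b => by
      refine ⟨⟨a.1.add b.1, fun x hx => ?_⟩, symbol_add _ _, ?_⟩
      · simp [TestField.add, a.2 x hx, b.2 x hx]
      · rw [pairing_add hΩ.isOpen hv₀.integrable _ _ h0,
          intervalIntegral_congr_timeMeasure (hv.isFluxPair.flux_add hΩ.isOpen a.1 b.1) h0 hTm,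
          intervalIntegral.integral_add (intervalIntegrable_of_integrable (hflux _) h0 hTm)
            (intervalIntegrable_of_integrable (hflux _) h0 hTm)]
        ring)
    (fun r a => by
      refine ⟨⟨a.1.smul r, fun x hx => ?_⟩, symbol_smul _ _, ?_⟩
      · simp [TestField.smul, a.2 x hx]
      · simp only [pairing_smul, flux_smul, intervalIntegral.integral_const_mul]
        ring)
    hle
  · obtain ⟨lam, ν, hlam, hν, hmass, hmcomp⟩ := exists_kernels_of_fst_eq
      (ρ := fun t => ENNReal.ofReal (2 * w t)) (by fun_prop)
      (C := ENNReal.ofReal (2 * C)) ENNReal.ofReal_ne_top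
      (fun t => ENNReal.ofReal_le_ofReal (by linarith [hwC t])) m hmfst
    refine ⟨lam, ν, hlam, hν, ?_, fun φ => ?_⟩
    · filter_upwards [hwae] with t ht
      rw [Measure.real, hmass, ENNReal.toReal_ofReal (by linarith [hw0 t]), ht]
    have hmφ : ∀ ψ : TestField Ω T, ∫ p, symbolExt hT.le ψ p ∂m =
        ∫ τ in 0..T, concFlux lam ν ψ τ := by
      intro ψ
      obtain ⟨B, -, hB⟩ := exists_bound_symbolExt hT.le ψ
      have hint : Integrable (symbolExt hT.le ψ) m := Integrable.of_bound
        (continuous_symbolExt hT.le ψ).aestronglyMeasurable B (ae_of_all _ hB)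
      rw [hmcomp] at hint ⊢
      rw [Measure.integral_compProd hint, ← integral_timeMeasure hT]
      refine integral_congr_ae ?_
      filter_upwards [ae_mem_Ioo] with τ hτ
      rw [concFlux_eq lam ν hT.le ψ (Ioo_subset_Icc_self hτ)]
    refine ae_eq_primitive_of_weak hT (hv.isFluxPair.integrable_pairing hΩ.isOpen φ)
      ((hflux φ).add (integrable_concFlux lam ν hT.le φ)) fun η hη hηT => ?_
    have h1 := hm ⟨φ.timeMul hη, fun x _ => by simp [TestField.timeMul, hηT]⟩
    have h2 : pairing Ω v₀ (φ.timeMul hη) 0 = η 0 * pairing Ω v₀ φ 0 := by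
      simp only [pairing, TestField.timeMul, real_inner_smul_right, integral_const_mul]
    have h3 := (h1.symm.trans (hmφ _))
    simp only [h2] at h3
    have h4 : ∫ τ in 0..T, (flux Ω (v τ) (tensorSq (v τ)) (φ.timeMul hη) τ +
        concFlux lam ν (φ.timeMul hη) τ) = ∫ t in 0..T, (deriv η t * pairing Ω (v t) φ t +
        η t * (flux Ω (v t) (tensorSq (v t)) φ t + concFlux lam ν φ t)) := by
      refine intervalIntegral_congr_timeMeasure ?_ h0 hTm
      filter_upwards [hv.isFluxPair.flux_timeMul hΩ.isOpen hη φ] with t ht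
      rw [ht, concFlux_timeMul]
      ring
    rw [intervalIntegral.integral_add (intervalIntegrable_of_integrable (hflux _) h0 hTm)
      (intervalIntegrable_of_integrable (integrable_concFlux lam ν hT.le _) h0 hTm)] at h4
    linarith

theorem integral_add_sub_integral_add {f g : ℝ → ℝ} (hf : Integrable f (timeMeasure T))
    (hg : Integrable g (timeMeasure T)) {s t : ℝ} (hs : s ∈ Icc 0 T) (ht : t ∈ Icc 0 T) :
    (∫ τ in 0..t, (f τ + g τ)) - ∫ τ in 0..s, (f τ + g τ) =
      (∫ τ in s..t, f τ) + ∫ τ in s..t, g τ := by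
  have h0 : (0 : ℝ) ∈ Icc 0 T := left_mem_Icc.mpr (hs.1.trans hs.2)
  have hfg : Integrable (fun τ => f τ + g τ) (timeMeasure T) := hf.add hg
  rw [intervalIntegral.integral_interval_sub_left (intervalIntegrable_of_integrable hfg h0 ht)
      (intervalIntegrable_of_integrable hfg h0 hs),
    intervalIntegral.integral_add (intervalIntegrable_of_integrable hf hs ht)
      (intervalIntegrable_of_integrable hg hs ht)]

/-! ### Weak continuity in time -/

/-- The space `L^2(Ω; ℝ^d)`. -/
noncomputable abbrev L2Space (Ω : Set (Space d)) := Lp (Space d) 2 (volume.restrict Ω)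

/-- The classes in `L^2(Ω)` of the smooth divergence-free fields with compact support in `Ω`. -/
noncomputable def solenoidalTest (Ω : Set (Space d)) : Submodule ℝ (L2Space Ω) where
  carrier := {f | ∃ ψ : Space d → Space d, ContDiff ℝ ∞ ψ ∧ HasCompactSupport ψ ∧ tsupport ψ ⊆ Ω ∧
    (∀ x, LinearMap.trace ℝ (Space d) (fderiv ℝ ψ x).toLinearMap = 0) ∧
    f =ᵐ[volume.restrict Ω] ψ}
  zero_mem' := ⟨0, contDiff_const, HasCompactSupport.zero, by simp, by simp, Lp.coeFn_zero _ _ _⟩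
  add_mem' := by
    rintro f g ⟨ψ, h1, h2, h3, h4, h5⟩ ⟨ψ', h1', h2', h3', h4', h5'⟩
    refine ⟨ψ + ψ', h1.add h1', h2.add h2',
      (tsupport_add ψ ψ').trans (union_subset h3 h3'), fun x => ?_,
      (Lp.coeFn_add f g).trans (h5.add h5')⟩
    rw [fderiv_add (h1.differentiable (by simp) x) (h1'.differentiable (by simp) x),
      ContinuousLinearMap.toLinearMap_add, map_add, h4, h4', add_zero]
  smul_mem' := by
    rintro c f ⟨ψ, h1, h2, h3, h4, h5⟩
    refine ⟨c • ψ, contDiff_const.smul h1, h2.smul_left (f := fun _ => c),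
      (tsupport_smul_subset_right (fun _ => c) ψ).trans h3, fun x => ?_,
      (Lp.coeFn_smul c f).trans (h5.const_smul c)⟩
    rw [fderiv_const_smul (h1.differentiable (by simp) x),
      ContinuousLinearMap.toLinearMap_smul, map_smul, h4, smul_zero]

theorem MemLsigma.toLp_mem {u : Space d → Space d} (hu : MemLsigma Ω u) :
    hu.memLp.toLp u ∈ (solenoidalTest Ω).topologicalClosure := by
  rw [← SetLike.mem_coe, Submodule.topologicalClosure_coe, Metric.mem_closure_iff]
  intro ε hε
  obtain ⟨ψ, h1, h2, h3, h4, h5⟩ := hu.approx ε hε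
  have hψ : MemLp ψ 2 (volume.restrict Ω) :=
    (h1.continuous.memLp_of_hasCompactSupport h2).restrict Ω
  refine ⟨hψ.toLp ψ, ⟨ψ, h1, h2, h3, h4, hψ.coeFn_toLp⟩, ?_⟩
  rw [dist_eq_norm, ← MemLp.toLp_sub, Lp.norm_toLp]
  exact ENNReal.toReal_lt_of_lt_ofReal h5

theorem inner_toLp_eq {u : Space d → Space d} (hu : MemLp u 2 (volume.restrict Ω)) {f : L2Space Ω}
    {ψ : Space d → Space d} (hf : f =ᵐ[volume.restrict Ω] ψ) :
    inner ℝ (hu.toLp u) f = ∫ x in Ω, inner ℝ (u x) (ψ x) := by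
  rw [L2.inner_def]
  refine integral_congr_ae ?_
  filter_upwards [hu.coeFn_toLp, hf] with x h1 h2
  rw [h1, h2]

theorem le_of_ae_le_of_continuousOn (hT : 0 < T) {f : ℝ → ℝ} {c : ℝ}
    (hf : ContinuousOn f (Icc 0 T)) (h : ∀ᵐ t ∂timeMeasure T, f t ≤ c) :
    ∀ t ∈ Icc 0 T, f t ≤ c := by
  have hcl : closure (Ioo 0 T) = Icc 0 T := closure_Ioo hT.ne
  intro t ht
  refine le_on_closure (s := Ioo 0 T) (f := f) (g := fun _ => c) ?_ (by rwa [hcl])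
    continuousOn_const (by rwa [hcl])
  by_contra! hne
  obtain ⟨z, hz, hzlt⟩ := hne
  have hopen := (hf.mono Ioo_subset_Icc_self).isOpen_inter_preimage isOpen_Ioo
    (isOpen_Ioi (a := c))
  refine hopen.measure_ne_zero volume ⟨z, hz, hzlt⟩ ?_
  refine measure_mono_null ?_ (ae_iff.mp ((ae_restrict_iff' measurableSet_Ioo).mp h))
  rintro w ⟨hw, hlt⟩ hcontra
  exact absurd (hcontra hw) (not_le.mpr hlt)

/-- If the pairings with smooth solenoidal fields have continuous representatives, then so have the
pairings with all fields in `L^2(Ω)`: only the projection onto `L^2_σ(Ω)` is seen, and it is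
approximated by smooth solenoidal fields. -/
theorem exists_continuous_pairing (hT : 0 < T)
    {v₀ : Space d → Space d} (hv₀ : MemLsigma Ω v₀) {v : ℝ → Space d → Space d}
    (hv : MemLinftyLsigma Ω T v)
    (h : ∀ ψ : Space d → Space d, ContDiff ℝ ∞ ψ → HasCompactSupport ψ → tsupport ψ ⊆ Ω →
      (∀ x, LinearMap.trace ℝ (Space d) (fderiv ℝ ψ x).toLinearMap = 0) →
      ∃ g : ℝ → ℝ, ContinuousOn g (Icc 0 T) ∧
        (∀ᵐ t ∂timeMeasure T, g t = ∫ x in Ω, inner ℝ (v t x) (ψ x)) ∧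
        g 0 = ∫ x in Ω, inner ℝ (v₀ x) (ψ x))
    {ψ : Space d → Space d} (hψ : MemLp ψ 2 (volume.restrict Ω)) :
    ∃ g : ℝ → ℝ, ContinuousOn g (Icc 0 T) ∧
      (∀ᵐ t ∂timeMeasure T, g t = ∫ x in Ω, inner ℝ (v t x) (ψ x)) ∧
      g 0 = ∫ x in Ω, inner ℝ (v₀ x) (ψ x) := by
  have h0 : (0 : ℝ) ∈ Icc 0 T := left_mem_Icc.mpr hT.le
  set K := (solenoidalTest Ω).topologicalClosure with hK
  have : CompleteSpace K := (Submodule.isClosed_topologicalClosure _).completeSpace_coe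
  set Ψ : L2Space Ω := hψ.toLp ψ
  have hproj : ∀ {u : Space d → Space d} (hu : MemLsigma Ω u),
      inner ℝ (hu.memLp.toLp u) (K.starProjection Ψ) = ∫ x in Ω, inner ℝ (u x) (ψ x) := by
    intro u hu
    rw [← inner_toLp_eq hu.memLp hψ.coeFn_toLp,
      ← Submodule.inner_starProjection_left_eq_right,
      Submodule.starProjection_eq_self_iff.mpr hu.toLp_mem]
  have hmem : K.starProjection Ψ ∈ closure (solenoidalTest Ω : Set (L2Space Ω)) := by
    rw [← Submodule.topologicalClosure_coe]
    exact Submodule.starProjection_apply_mem K Ψ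
  obtain ⟨f, hfD, hf⟩ := mem_closure_iff_seq_limit.mp hmem
  choose χ hχ1 hχ2 hχ3 hχ4 hχ5 using hfD
  choose g hgc hgae hg0 using fun n => h (χ n) (hχ1 n) (hχ2 n) (hχ3 n) (hχ4 n)
  obtain ⟨C, hC⟩ := hv.bounded
  set C' := max C 0
  have hgae' : ∀ᵐ t ∂timeMeasure T, ∃ V : L2Space Ω, ‖V‖ ≤ C' ∧
      (∀ n, g n t = inner ℝ V (f n)) ∧
      inner ℝ V (K.starProjection Ψ) = ∫ x in Ω, inner ℝ (v t x) (ψ x) := by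
    filter_upwards [ae_all_iff.mpr hgae, hC, hv.mem] with t h1 h2 h3
    refine ⟨h3.memLp.toLp _, ?_, fun n => ?_, hproj h3⟩
    · rw [Lp.norm_toLp]
      exact ENNReal.toReal_le_of_le_ofReal (le_max_right _ _)
        (h2.trans (ENNReal.ofReal_le_ofReal (le_max_left _ _)))
    · rw [h1, inner_toLp_eq h3.memLp (hχ5 n)]
  let G : ℕ → C(Icc 0 T, ℝ) := fun n => ⟨(Icc 0 T).domRestrict (g n), (hgc n).domRestrict⟩
  -- The continuous functions `g n` are uniformly Cauchy: their almost everywhere bound extends to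
  -- all times by continuity.
  have hdist : ∀ n m, dist (G n) (G m) ≤ C' * dist (f n) (f m) := by
    intro n m
    rw [ContinuousMap.dist_le (by positivity)]
    rintro ⟨t, ht⟩
    refine le_of_ae_le_of_continuousOn hT (f := fun t => dist (g n t) (g m t))
      (continuous_dist.comp_continuousOn ((hgc n).prodMk (hgc m))) ?_ t ht
    filter_upwards [hgae'] with s hs
    obtain ⟨V, hV, hVn, -⟩ := hs
    rw [hVn, hVn, Real.dist_eq, ← inner_sub_right, dist_eq_norm]
    exact (abs_real_inner_le_norm _ _).trans (by gcongr)
  have hcauchy : CauchySeq G := by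
    rw [Metric.cauchySeq_iff]
    intro ε hε
    obtain ⟨N, hN⟩ := Metric.cauchySeq_iff.mp hf.cauchySeq (ε / (C' + 1)) (by positivity)
    refine ⟨N, fun m hm n hn => (hdist m n).trans_lt ?_⟩
    have h1 := hN m hm n hn
    rw [lt_div_iff₀ (by positivity)] at h1
    nlinarith [dist_nonneg (x := f m) (y := f n)]
  obtain ⟨G', hG'⟩ := cauchySeq_tendsto_of_complete hcauchy
  have hpt : ∀ t (ht : t ∈ Icc 0 T), Tendsto (fun n => g n t) atTop (𝓝 (G' ⟨t, ht⟩)) :=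
    fun t ht => ((continuous_eval_const (⟨t, ht⟩ : Icc 0 T)).tendsto G').comp hG'
  refine ⟨IccExtend hT.le G', (G'.continuous.Icc_extend').continuousOn, ?_, ?_⟩
  · filter_upwards [hgae', ae_mem_Ioo] with t ht htm
    obtain ⟨V, -, hVn, hV⟩ := ht
    rw [IccExtend_of_mem hT.le _ (Ioo_subset_Icc_self htm), ← hV]
    refine tendsto_nhds_unique (hpt t _) ?_
    simp only [hVn]
    exact tendsto_const_nhds.inner hf
  · rw [IccExtend_of_mem hT.le _ h0, ← hproj hv₀]
    refine tendsto_nhds_unique (hpt 0 _) ?_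
    simp only [hg0, ← inner_toLp_eq hv₀.memLp (hχ5 _)]
    exact tendsto_const_nhds.inner hf

/-! ### Measure-valued solutions from energy-variational solutions -/

theorem MemLsigma.congr_ae {u u' : Space d → Space d} (hu : MemLsigma Ω u)
    (h : u =ᵐ[volume.restrict Ω] u') : MemLsigma Ω u' := by
  refine ⟨hu.memLp.ae_eq h, fun ε hε => ?_⟩
  obtain ⟨ψ, h1, h2, h3, h4, h5⟩ := hu.approx ε hε
  refine ⟨ψ, h1, h2, h3, h4, ?_⟩
  rwa [eLpNorm_congr_ae (h.symm.sub (ae_eq_refl ψ))]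

theorem pairing_congr_ae {u u' : Space d → Space d} (h : u =ᵐ[volume.restrict Ω] u')
    (φ : TestField Ω T) (t : ℝ) : pairing Ω u φ t = pairing Ω u' φ t := by
  refine integral_congr_ae ?_
  filter_upwards [h] with x hx
  rw [hx]

theorem mean_dirac (a : Space d) : mean (Measure.dirac a) = a := integral_dirac _ _

theorem secondMoment_dirac (a : Space d) :
    secondMoment (Measure.dirac a) = fun i j => a i * a j := by
  ext i j
  exact integral_dirac (fun ξ : Space d => ξ i * ξ j) a

theorem IsEnergyVariationalSolution.exists_measureValued (hd : 1 ≤ d)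
    (hΩ : IsBoundedLipschitzDomain Ω) (hT : 0 < T) {v₀ : Space d → Space d}
    (hv₀ : MemLsigma Ω v₀) {v : ℝ → Space d → Space d} {E : ℝ → ℝ}
    (h : IsEnergyVariationalSolution Ω T v₀ v E) :
    ∃ (νo : Kernel (ℝ × Space d) (Space d)) (lam : Kernel ℝ (closure Ω))
      (νinf : Kernel (ℝ × closure Ω) (Sphere d)), IsMeasureValuedSolution Ω T v₀ νo lam νinf ∧
      (∀ᵐ p ∂cylMeasure Ω T, mean (νo p) = v p.1 p.2) ∧
      (∀ᵐ t ∂timeMeasure T, E t = mvEnergy Ω νo lam t) := by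
  have := hΩ.compactSpace
  have h0 : (0 : ℝ) ∈ Icc 0 T := left_mem_Icc.mpr hT.le
  have hv := h.velocity
  obtain ⟨Eg, hE, hkin, hineq⟩ := h.energy
  obtain ⟨lam, ν, hlam, hν, hmass, heq⟩ :=
    exists_concentration hd hΩ hT hv₀ hv hE hkin fun φ => (hineq φ).2
  set v' := hv.aestronglyMeasurable.mk _ with hv'
  have hv'm : Measurable v' := hv.aestronglyMeasurable.stronglyMeasurable_mk.measurable
  have hae : ∀ᵐ p ∂cylMeasure Ω T, v' p = v p.1 p.2 :=
    hv.aestronglyMeasurable.ae_eq_mk.mono fun p hp => hp.symm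
  have hae' : ∀ᵐ t ∂timeMeasure T, (fun x => v' (t, x)) =ᵐ[volume.restrict Ω] v t :=
    Measure.ae_ae_of_ae_prod hae
  set νo := Kernel.deterministic v' hv'm
  have hmean : ∀ p, mean (νo p) = v' p := fun p => by
    rw [Kernel.deterministic_apply, mean_dirac]
  have hen : ∀ᵐ t ∂timeMeasure T, mvEnergy Ω νo lam t = Eg t := by
    filter_upwards [hae', hmass] with t h1 h2
    have h3 : ∫ x in Ω, ∫ ξ, ‖ξ‖ ^ 2 ∂(νo (t, x)) = ∫ x in Ω, ‖v t x‖ ^ 2 := by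
      refine integral_congr_ae ?_
      filter_upwards [h1] with x hx
      rw [Kernel.deterministic_apply, integral_dirac, hx]
    rw [mvEnergy, h2, h3, kinEnergy]
    ring
  have hrep : ∀ φ : TestField Ω T, ∃ F : ℝ → ℝ, Integrable F (timeMeasure T) ∧
      ∀ᵐ t ∂timeMeasure T, pairing Ω (v t) φ t = pairing Ω v₀ φ 0 + ∫ τ in 0..t, F τ :=
    fun φ => ⟨_, (hv.isFluxPair.integrable_flux hΩ.isOpen φ).add
      (integrable_concFlux lam ν hT.le φ), heq φ⟩
  refine ⟨νo, lam, ν, ⟨inferInstance, hlam, hν, ?_, fun φ => ?_, ?_, ?_, fun ψ hψ => ?_⟩, ?_, ?_⟩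
  · obtain ⟨C, hC⟩ := hv.linftyL1_norm_sq.bounded
    refine ⟨C, ?_⟩
    filter_upwards [hC, hae'] with t h1 h2
    refine le_trans (le_of_eq ?_) h1
    refine lintegral_congr_ae ?_
    filter_upwards [h2] with x hx
    rw [Kernel.deterministic_apply, lintegral_dirac, hx, enorm_pow, enorm_norm]
  · have hflux := hv.isFluxPair.integrable_flux hΩ.isOpen φ
    have hconc := integrable_concFlux lam ν hT.le φ
    filter_upwards [heq φ, hae', ae_mem_Ioo] with s h1 h2 hs
    filter_upwards [heq φ, hae', ae_mem_Ioo] with t h1' h2' ht hst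
    have hs' := Ioo_subset_Icc_self hs
    have ht' := Ioo_subset_Icc_self ht
    simp only [hmean]
    rw [pairing_congr_ae h2, pairing_congr_ae h2', h1, h1', add_sub_add_left_eq_sub,
      integral_add_sub_integral_add hflux hconc hs' ht']
    congr 1
    refine intervalIntegral_congr_timeMeasure ?_ hs' ht'
    filter_upwards [hae'] with τ hτ
    refine integral_congr_ae ?_
    filter_upwards [hτ] with x hx
    rw [Kernel.deterministic_apply, secondMoment_dirac, hx]
    rfl
  · filter_upwards [hv.mem, hae'] with t h1 h2
    simp only [hmean]
    exact h1.congr_ae h2.symm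
  · filter_upwards [ae_energy_le_of_enVarInequality hd hΩ fun φ => (hineq φ).1, hen] with s h1 h2
    filter_upwards [h1, hen] with t h1' h2' hst
    rw [h2, h2']
    exact h1' hst
  · have hψ2 : MemLp ψ 2 (volume.restrict Ω) := by
      have : IsFiniteMeasure (volume.restrict Ω) := ⟨by
        rw [Measure.restrict_apply_univ]
        exact hΩ.isBounded.measure_lt_top⟩
      obtain ⟨B, hB⟩ :=
        hΩ.isBounded.isCompact_closure.exists_bound_of_continuousOn hψ
      refine MemLp.of_bound ((hψ.mono subset_closure).aestronglyMeasurable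
        hΩ.isOpen.measurableSet) B ?_
      filter_upwards [ae_restrict_mem hΩ.isOpen.measurableSet] with x hx
        using hB x (subset_closure hx)
    obtain ⟨g, hgc, hgae, hg0⟩ := exists_continuous_pairing hT hv₀ hv
      (fun χ h1 h2 h3 h4 => by
        obtain ⟨F, hF, hFeq⟩ := hrep (TestField.ofStatic hΩ.isOpen T h1 h3 h4)
        refine ⟨fun t => (∫ x in Ω, inner ℝ (v₀ x) (χ x)) + ∫ τ in 0..t, F τ,
          continuousOn_const.add (continuousOn_primitive_timeMeasure hT hF), ?_, by simp⟩
        filter_upwards [hFeq] with t ht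
        exact ht.symm) hψ2
    refine ⟨g, hgc, ?_, hg0⟩
    filter_upwards [hgae, hae'] with t h1 h2
    rw [h1]
    refine integral_congr_ae ?_
    filter_upwards [h2] with x hx
    rw [hmean, hx]
  · filter_upwards [hae] with p hp
    rw [hmean, hp]
  · filter_upwards [hen, hE.ae_eq] with t h1 h2
    rw [h1, h2]

/-! ### Integrals against signed and matrix-valued measures -/

section Signed

variable {X : Type*} [MeasurableSpace X]

instance isFiniteMeasure_variation (μ : SignedMeasure X) : IsFiniteMeasure μ.variation := by
  rw [← SignedMeasure.totalVariation_eq_variation]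
  infer_instance

theorem sintegral_comp_simpleFunc (μ : SignedMeasure X) (g : SimpleFunc X X) (f : X → ℝ) :
    sintegral μ (fun x => f (g x)) = ∑ y ∈ g.range, f y * μ (g ⁻¹' {y}) := by
  have h1 : (fun x => f (g x)) =
      fun x => ∑ y ∈ g.range, (g ⁻¹' {y}).indicator (fun _ => f y) x := by
    funext x
    rw [Finset.sum_eq_single (g x)]
    · simp
    · intro y _ hy
      exact indicator_of_notMem (fun h => hy h.symm) _
    · intro h
      exact absurd (g.mem_range_self x) h
  rw [sintegral, h1, VectorMeasure.integral_finsetSum]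
  · refine Finset.sum_congr rfl fun y _ => ?_
    rw [VectorMeasure.integral_indicator_const _ (g.measurableSet_fiber y)]
    rfl
  · intro y _
    exact (integrable_const (μ := μ.variation) (f y)).indicator (g.measurableSet_fiber y)

theorem exists_simpleFunc_tendsto [TopologicalSpace X] [CompactSpace X]
    [TopologicalSpace.MetrizableSpace X] [BorelSpace X] :
    ∃ g : ℕ → SimpleFunc X X, ∀ x, Tendsto (fun n => g n x) atTop (𝓝 x) := by
  let := TopologicalSpace.metrizableSpaceMetric X
  rcases isEmpty_or_nonempty X with hX | ⟨⟨x₀⟩⟩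
  · exact ⟨fun _ => SimpleFunc.ofIsEmpty, fun x => isEmptyElim x⟩
  · exact ⟨fun n => SimpleFunc.approxOn id measurable_id univ x₀ (mem_univ _) n,
      fun x => SimpleFunc.tendsto_approxOn measurable_id (mem_univ _) (by simp)⟩

theorem tendsto_sintegral [TopologicalSpace X] [CompactSpace X]
    [TopologicalSpace.MetrizableSpace X] [BorelSpace X] (μ : SignedMeasure X)
    {g : ℕ → SimpleFunc X X} (hg : ∀ x, Tendsto (fun n => g n x) atTop (𝓝 x)) {f : X → ℝ}
    (hf : Continuous f) :
    Tendsto (fun n => ∑ y ∈ (g n).range, f y * μ (g n ⁻¹' {y})) atTop (𝓝 (sintegral μ f)) := by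
  obtain ⟨B, hB⟩ := isCompact_univ.exists_bound_of_continuousOn hf.continuousOn
  simp only [← sintegral_comp_simpleFunc]
  refine VectorMeasure.tendsto_integral_of_dominated_convergence (fun _ => B) (fun n => ?_)
    (integrable_const B) (fun n => ae_of_all _ fun x => hB _ (mem_univ _))
    (ae_of_all _ fun x => (hf.tendsto x).comp (hg x))
  exact (hf.measurable.comp (g n).measurable).aestronglyMeasurable

end Signed

/-- A matrix-valued measure with positive semidefinite values is tested from below by the lower
bound of the quadratic form of the integrand. -/
theorem neg_matIntegral_le [CompactSpace (closure Ω)] {R : MatMeasure Ω}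
    (hR : ∀ A : Set (closure Ω), MeasurableSet A → (Matrix.of fun i j => R i j A).PosSemidef)
    {A : Space d → Mat d} (hA : ContinuousOn A (closure Ω)) {c : ℝ}
    (hc : ∀ x ∈ closure Ω, ∀ ξ, -quad (A x) ξ ≤ c * ‖ξ‖ ^ 2) :
    -matIntegral R A ≤ c * ∑ i, R i i univ := by
  obtain ⟨g, hg⟩ := exists_simpleFunc_tendsto (X := closure Ω)
  have hcont : ∀ i j, Continuous fun x : closure Ω => A x i j := fun i j =>
    (hA.domRestrict).matrix_elem i j
  have hlim := (tendsto_finsetSum Finset.univ fun i _ => tendsto_finsetSum Finset.univ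
    fun j _ => tendsto_sintegral (R i j) hg (hcont i j)).neg
  refine le_of_tendsto' hlim fun n => ?_
  -- Both sides are sums over the fibres of the simple function `g n`, on which the claim is one
  -- about matrices.
  have h1 : ∑ i, R i i univ = ∑ y ∈ (g n).range,
      (Matrix.of fun i j => R i j (g n ⁻¹' {y})).trace := by
    simp only [Matrix.trace, Matrix.diag_apply, Matrix.of_apply]
    rw [Finset.sum_comm]
    refine Finset.sum_congr rfl fun i _ => ?_
    rw [← VectorMeasure.of_biUnion_finset]
    · congr 1
      exact (eq_univ_of_forall fun x => mem_iUnion₂.mpr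
        ⟨g n x, (g n).mem_range_self x, rfl⟩).symm
    · intro y _ z _ hyz
      exact Disjoint.preimage _ (by simpa using hyz)
    · exact fun y _ => (g n).measurableSet_fiber y
  rw [h1, Finset.mul_sum]
  have h2 : ∑ i, ∑ j, ∑ y ∈ (g n).range, A y i j * R i j (g n ⁻¹' {y}) =
      ∑ y ∈ (g n).range, frob (A y) (Matrix.of fun i j => R i j (g n ⁻¹' {y})) := by
    simp only [frob, Matrix.of_apply]
    rw [Finset.sum_comm]
    simp only [Finset.sum_comm (s := (g n).range)]
    rw [Finset.sum_comm]
  rw [h2, ← Finset.sum_neg_distrib]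
  refine Finset.sum_le_sum fun y _ => ?_
  exact neg_frob_le_of_posSemidef (hc y y.2) (hR _ ((g n).measurableSet_fiber y))

section Moment

variable {X : Type*} [MeasurableSpace X]

/-- The matrix-valued measure of second moments `∫ ζ ⊗ ζ` in the second variable of a measure on
`X × ℝ^d`, given by its entries. -/
noncomputable def momentMeasure (η : Measure (X × Space d)) (i j : Fin d) : SignedMeasure X :=
  (η.withDensityᵥ fun z => z.2 i * z.2 j).map Prod.fst

variable {η : Measure (X × Space d)}

theorem integrable_coord_mul (hη : Integrable (fun z => ‖z.2‖ ^ 2) η) (i j : Fin d) :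
    Integrable (fun z : X × Space d => z.2 i * z.2 j) η := by
  refine hη.mono' ?_ (ae_of_all _ fun z => abs_coord_mul_le z.2 i j)
  have hc : ∀ k, Measurable fun z : X × Space d => z.2 k := fun k =>
    (EuclideanSpace.proj (𝕜 := ℝ) k).continuous.measurable.comp measurable_snd
  exact ((hc i).mul (hc j)).aestronglyMeasurable

theorem momentMeasure_apply (hη : Integrable (fun z => ‖z.2‖ ^ 2) η) (i j : Fin d) {A : Set X}
    (hA : MeasurableSet A) :
    momentMeasure η i j A = ∫ z in Prod.fst ⁻¹' A, z.2 i * z.2 j ∂η := by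
  rw [momentMeasure, VectorMeasure.map_apply _ measurable_fst hA,
    withDensityᵥ_apply (integrable_coord_mul hη i j) (measurable_fst hA)]

theorem posSemidef_momentMeasure (hη : Integrable (fun z => ‖z.2‖ ^ 2) η) {A : Set X}
    (hA : MeasurableSet A) : (Matrix.of fun i j => momentMeasure η i j A).PosSemidef := by
  refine Matrix.PosSemidef.of_dotProduct_mulVec_nonneg ?_ fun w => ?_
  · ext i j
    simp [momentMeasure_apply hη _ _ hA, mul_comm]
  · have h1 : star w ⬝ᵥ (Matrix.of fun i j => momentMeasure η i j A).mulVec w =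
        ∫ z in Prod.fst ⁻¹' A, (∑ i, w i * z.2 i) ^ 2 ∂η := by
      have hint : ∀ i j, Integrable (fun z : X × Space d => w i * (z.2 i * z.2 j * w j))
          (η.restrict (Prod.fst ⁻¹' A)) := fun i j =>
        ((integrable_coord_mul hη i j).restrict.mul_const _).const_mul _
      have h2 : ∀ z : X × Space d, (∑ i, w i * z.2 i) ^ 2 =
          ∑ i, ∑ j, w i * (z.2 i * z.2 j * w j) := by
        intro z
        rw [sq, Finset.sum_mul_sum]
        exact Finset.sum_congr rfl fun i _ => Finset.sum_congr rfl fun j _ => by ring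
      simp only [h2]
      rw [integral_finsetSum _ fun i _ => integrable_finsetSum _ fun j _ => hint i j]
      refine Finset.sum_congr rfl fun i _ => ?_
      rw [integral_finsetSum _ fun j _ => hint i j]
      simp only [Matrix.mulVec, dotProduct, Matrix.of_apply, momentMeasure_apply hη _ _ hA,
        star_trivial, integral_const_mul, integral_mul_const, Finset.mul_sum]
    rw [h1]
    exact integral_nonneg fun z => sq_nonneg _

theorem variation_momentMeasure_le (hη : Integrable (fun z => ‖z.2‖ ^ 2) η) (i j : Fin d) :
    (momentMeasure η i j).variation univ ≤ ∫⁻ z, ‖z.2‖ₑ ^ 2 ∂η := by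
  refine (VectorMeasure.variation_map_le univ).trans ?_
  rw [Measure.map_apply measurable_fst MeasurableSet.univ, preimage_univ,
    Measure.variation_withDensityᵥ (integrable_coord_mul hη i j), withDensity_apply _ .univ,
    Measure.restrict_univ]
  refine lintegral_mono fun z => ?_
  rw [← enorm_norm z.2, ← enorm_pow, enorm_le_iff_norm_le]
  simpa using abs_coord_mul_le z.2 i j

theorem sintegral_momentMeasure [TopologicalSpace X] [CompactSpace X]
    [TopologicalSpace.MetrizableSpace X] [BorelSpace X] (hη : Integrable (fun z => ‖z.2‖ ^ 2) η)
    (i j : Fin d) {f : X → ℝ} (hf : Continuous f) :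
    sintegral (momentMeasure η i j) f = ∫ z, f z.1 * (z.2 i * z.2 j) ∂η := by
  obtain ⟨g, hg⟩ := exists_simpleFunc_tendsto (X := X)
  obtain ⟨B, hB⟩ := isCompact_univ.exists_bound_of_continuousOn hf.continuousOn
  have hint := integrable_coord_mul hη i j
  refine tendsto_nhds_unique (tendsto_sintegral _ hg hf) ?_
  have h1 : ∀ n, ∑ y ∈ (g n).range, f y * momentMeasure η i j (g n ⁻¹' {y}) =
      ∫ z, f (g n z.1) * (z.2 i * z.2 j) ∂η := by
    intro n
    have h2 : ∀ z : X × Space d, f (g n z.1) * (z.2 i * z.2 j) = ∑ y ∈ (g n).range,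
        (Prod.fst ⁻¹' (g n ⁻¹' {y})).indicator
          (fun z : X × Space d => f y * (z.2 i * z.2 j)) z := by
      intro z
      rw [Finset.sum_eq_single (g n z.1)]
      · simp
      · intro y _ hy
        exact indicator_of_notMem (fun h => hy h.symm) _
      · intro h
        exact absurd ((g n).mem_range_self z.1) h
    simp only [h2]
    rw [integral_finsetSum]
    · refine Finset.sum_congr rfl fun y _ => ?_
      have hm := (g n).measurableSet_fiber y
      rw [integral_indicator (measurable_fst hm), integral_const_mul,
        momentMeasure_apply hη i j hm]
    · exact fun y _ => (hint.const_mul _).indicator (measurable_fst ((g n).measurableSet_fiber y))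
  simp only [h1]
  refine tendsto_integral_of_dominated_convergence (fun z => B * ‖z.2 i * z.2 j‖) (fun n => ?_)
    (hint.norm.const_mul B) (fun n => ae_of_all _ fun z => ?_) (ae_of_all _ fun z => ?_)
  · exact ((hf.measurable.comp (g n).measurable).comp measurable_fst).aestronglyMeasurable.mul
      hint.1
  · rw [norm_mul]
    gcongr
    exact hB _ (mem_univ _)
  · exact ((hf.tendsto z.1).comp (hg z.1)).mul_const _

theorem sum_momentMeasure_univ (hη : Integrable (fun z => ‖z.2‖ ^ 2) η) :
    ∑ i, momentMeasure η i i univ = ∫ z, ‖z.2‖ ^ 2 ∂η := by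
  simp only [momentMeasure_apply hη _ _ MeasurableSet.univ, preimage_univ, Measure.restrict_univ]
  rw [← integral_finsetSum _ fun i _ => integrable_coord_mul hη i i]
  refine integral_congr_ae (ae_of_all _ fun z => ?_)
  simp only [EuclideanSpace.norm_sq_eq, Real.norm_eq_abs, sq_abs, ← sq]

end Moment

theorem integrable_entry_mul [CompactSpace (closure Ω)] {η : Measure (closure Ω × Space d)}
    (hη : Integrable (fun z => ‖z.2‖ ^ 2) η) {A : Space d → Mat d}
    (hA : ContinuousOn A (closure Ω)) (i j : Fin d) :
    Integrable (fun z : closure Ω × Space d => A z.1 i j * (z.2 i * z.2 j)) η := by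
  have hcont : Continuous fun x : closure Ω => A x i j := (hA.domRestrict).matrix_elem i j
  obtain ⟨B, hB⟩ := isCompact_univ.exists_bound_of_continuousOn hcont.continuousOn
  exact (integrable_coord_mul hη i j).bdd_mul
    (hcont.measurable.comp measurable_fst).aestronglyMeasurable
    (ae_of_all _ fun z => hB _ (mem_univ _))

theorem integrable_quad [CompactSpace (closure Ω)] {η : Measure (closure Ω × Space d)}
    (hη : Integrable (fun z => ‖z.2‖ ^ 2) η) {A : Space d → Mat d}
    (hA : ContinuousOn A (closure Ω)) :
    Integrable (fun z : closure Ω × Space d => quad (A z.1) z.2) η := by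
  have hint := fun i j => integrable_entry_mul hη hA i j
  simp only [quad, frob]
  exact integrable_finsetSum _ fun i _ => integrable_finsetSum _ fun j _ => hint i j

theorem matIntegral_momentMeasure [CompactSpace (closure Ω)] {η : Measure (closure Ω × Space d)}
    (hη : Integrable (fun z => ‖z.2‖ ^ 2) η) {A : Space d → Mat d}
    (hA : ContinuousOn A (closure Ω)) :
    matIntegral (momentMeasure η) A = ∫ z, quad (A z.1) z.2 ∂η := by
  have hcont : ∀ i j, Continuous fun x : closure Ω => A x i j := fun i j =>
    (hA.domRestrict).matrix_elem i j
  have hint := fun i j => integrable_entry_mul hη hA i j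
  simp only [matIntegral, quad, frob, sintegral_momentMeasure hη _ _ (hcont _ _)]
  rw [integral_finsetSum _ fun i _ => integrable_finsetSum _ fun j _ => hint i j]
  refine Finset.sum_congr rfl fun i _ => ?_
  rw [integral_finsetSum _ fun j _ => hint i j]

/-! ### Energy-variational solutions from dissipative weak solutions -/

/-- Only the dominating function is assumed integrable: if `f` is not, its integral is zero and the
claim follows from `0 ≤ g`. -/
theorem neg_intervalIntegral_le {f g : ℝ → ℝ} {s t : ℝ} (hs : s ∈ Icc 0 T) (ht : t ∈ Icc 0 T)
    (hst : s ≤ t) (hg : Integrable g (timeMeasure T))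
    (hg0 : ∀ᵐ τ ∂timeMeasure T, 0 ≤ g τ) (h : ∀ᵐ τ ∂timeMeasure T, -f τ ≤ g τ) :
    -∫ τ in s..t, f τ ≤ ∫ τ in s..t, g τ := by
  have hsub : Ioo s t ⊆ Ioo 0 T := Ioo_subset_Ioo hs.1 ht.2
  have hgi := intervalIntegrable_of_integrable hg hs ht
  by_cases hf : IntervalIntegrable f volume s t
  · rw [← intervalIntegral.integral_neg]
    refine intervalIntegral.integral_mono_ae_restrict hst hf.neg hgi ?_
    rw [← Measure.restrict_congr_set Ioo_ae_eq_Icc]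
    exact ae_restrict_of_ae_restrict_of_subset hsub h
  · rw [intervalIntegral.integral_undef hf, neg_zero]
    refine intervalIntegral.integral_nonneg_of_ae_restrict hst ?_
    rw [← Measure.restrict_congr_set Ioo_ae_eq_Icc]
    exact ae_restrict_of_ae_restrict_of_subset hsub hg0

theorem regWeight_nonneg (φ : TestField Ω T) (τ : ℝ) : 0 ≤ regWeight Ω φ τ := by
  rw [regWeight]
  positivity

theorem IsDissipativeWeakSolution.isEnergyVariationalSolution (hd : 1 ≤ d)
    (hΩ : IsBoundedLipschitzDomain Ω) (hT : 0 < T) {v₀ : Space d → Space d}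
    {v : ℝ → Space d → Space d} {E : ℝ → ℝ} (h : IsDissipativeWeakSolution Ω T v₀ v E) :
    IsEnergyVariationalSolution Ω T v₀ v E := by
  have := hΩ.compactSpace
  have h0 : (0 : ℝ) ∈ Icc 0 T := left_mem_Icc.mpr hT.le
  have hv := h.velocity
  obtain ⟨Eg, R, hE, hR, heq, hanti, hen⟩ := h.defect
  have htr : ∀ᵐ t ∂timeMeasure T, 0 ≤ ∑ i, R t i i univ := by
    filter_upwards [hR.posSemidef] with t ht
    exact Finset.sum_nonneg fun i _ => (ht univ .univ).diag_nonneg (i := i)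
  have hkin : ∀ᵐ t ∂timeMeasure T, kinEnergy Ω (v t) ≤ Eg t := by
    filter_upwards [htr, hen] with t h1 h2
    linarith
  have hEi := hE.integrable hT.le
  have hki := hv.integrable_kinEnergy
  have key : ∀ (φ : TestField Ω T) {s t : ℝ} {us : Space d → Space d}, s ∈ Icc 0 T →
      t ∈ Icc 0 T → s ≤ t → DissWeakEquation Ω v R φ s us t → EnVarInequality Ω v Eg φ s us t := by
    intro φ s t us hs ht hst hw
    have hfi := intervalIntegrable_of_integrable (hv.isFluxPair.integrable_flux hΩ.isOpen φ) hs ht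
    have hgi := integrable_regWeight_mul hd hΩ hT.le φ (hEi.sub hki)
    have h1 := neg_intervalIntegral_le hs ht hst hgi (f := fun τ => matIntegral (R τ)
        fun x => φ.grad (τ, x)) ?_ ?_
    · have h2 : ∫ τ in s..t, (flux Ω (v τ) (tensorSq (v τ)) φ τ +
          regWeight Ω φ τ * (kinEnergy Ω (v τ) - Eg τ)) =
          (∫ τ in s..t, flux Ω (v τ) (tensorSq (v τ)) φ τ) -
            ∫ τ in s..t, regWeight Ω φ τ * (Eg - fun τ => kinEnergy Ω (v τ)) τ := by
        rw [← intervalIntegral.integral_sub hfi (intervalIntegrable_of_integrable hgi hs ht)]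
        refine intervalIntegral.integral_congr fun τ _ => ?_
        simp only [Pi.sub_apply]
        ring
      rw [DissWeakEquation] at hw
      rw [EnVarInequality, h2]
      linarith [hanti hs ht hst]
    · filter_upwards [hkin] with τ hτ
      exact mul_nonneg (regWeight_nonneg φ τ) (sub_nonneg.mpr hτ)
    · filter_upwards [hen, hR.posSemidef, ae_mem_Ioo] with τ h1 h2 hτ
      have hτ' := Ioo_subset_Icc_self hτ
      have h3 := neg_matIntegral_le h2 (A := fun x => φ.grad (τ, x))
        (φ.continuousOn_grad.comp (by fun_prop) fun _ hx => ⟨hτ', hx⟩)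
        fun x hx ξ => neg_quad_le_negSup_symbol φ ⟨τ, hτ'⟩ hx ξ
      have h4 : regWeight Ω φ τ = _ := regWeight_eq hd hΩ φ ⟨τ, hτ'⟩
      have h5 := regWeight_nonneg φ τ
      simp only [Pi.sub_apply]
      have h6 := mul_le_mul_of_nonneg_left h1 h5
      rw [mul_add, h4] at h6
      rw [h4]
      linarith
  refine ⟨hv, Eg, hE, hkin, fun φ => ⟨?_, ?_⟩⟩
  · filter_upwards [(heq φ).1, ae_mem_Ioo] with s h1 hs
    filter_upwards [h1, ae_mem_Ioo] with t h2 ht hst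
    exact key φ (Ioo_subset_Icc_self hs) (Ioo_subset_Icc_self ht) hst.le h2
  · filter_upwards [(heq φ).2, ae_mem_Ioo] with t h2 ht
    exact key φ h0 (Ioo_subset_Icc_self ht) ht.1.le h2

/-! ### Representatives of almost everywhere defined functions of time -/

/-- A bounded function of time that is non-increasing up to null sets agrees almost everywhere with
a non-increasing function, namely with its essential supremum over later times. -/
theorem exists_antitone_ae_eq {E : ℝ → ℝ} {C : ℝ} (hC : ∀ᵐ t ∂timeMeasure T, |E t| ≤ C)
    (h : ∀ᵐ s ∂timeMeasure T, ∀ᵐ t ∂timeMeasure T, s < t → E t ≤ E s) :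
    ∃ F : ℝ → ℝ, Antitone F ∧ (∀ t, |F t| ≤ max C 0) ∧ ∀ᵐ t ∂timeMeasure T, F t = E t := by
  set D := max C 0
  have hD : 0 ≤ D := le_max_right _ _
  have hED : ∀ᵐ t ∂timeMeasure T, |E t| ≤ D := hC.mono fun t ht => ht.trans (le_max_left _ _)
  -- The constraint `-D ≤ a` keeps `S t` bounded below also for `t ≥ T`, where the other condition
  -- is void and the infimum would be a junk value.
  set S : ℝ → Set ℝ := fun t => {a | -D ≤ a ∧ ∀ᵐ s ∂timeMeasure T, t < s → E s ≤ a}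
  have hbdd : ∀ t, BddBelow (S t) := fun t => ⟨-D, fun a ha => ha.1⟩
  have hmem : ∀ t, D ∈ S t := fun t =>
    ⟨by linarith, hED.mono fun s hs _ => (le_abs_self _).trans hs⟩
  set F : ℝ → ℝ := fun t => sInf (S t)
  have hanti : Antitone F := fun t t' htt' => csInf_le_csInf (hbdd t') ⟨D, hmem t⟩
    fun a ha => ⟨ha.1, ha.2.mono fun s hs hlt => hs (htt'.trans_lt hlt)⟩
  have hle : ∀ t, ∀ᵐ s ∂timeMeasure T, t < s → E s ≤ F t := by
    intro t
    have h1 : ∀ n : ℕ, ∀ᵐ s ∂timeMeasure T, t < s → E s ≤ F t + 1 / ((n : ℝ) + 1) := by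
      intro n
      obtain ⟨a, ha, hlt⟩ := exists_lt_of_csInf_lt ⟨D, hmem t⟩
        (lt_add_of_pos_right (F t) (Nat.one_div_pos_of_nat (n := n)))
      exact ha.2.mono fun s hs hts => (hs hts).trans hlt.le
    filter_upwards [ae_all_iff.mpr h1] with s hs hts
    exact ge_of_tendsto' (by simpa using tendsto_one_div_add_atTop_nhds_zero_nat.const_add (F t))
      fun n => hs n hts
  refine ⟨F, hanti, fun t => abs_le.mpr ⟨le_csInf ⟨D, hmem t⟩ fun a ha => ha.1,
    csInf_le (hbdd t) (hmem t)⟩, ?_⟩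
  have hcount : ∀ᵐ t ∂timeMeasure T, ContinuousAt F t :=
    ae_restrict_of_ae ((hanti.countable_not_continuousAt.ae_notMem volume).mono
      fun t ht => not_not.mp ht)
  -- At continuity points of `F`, rational times to the left suffice for the lower bound.
  have hq : ∀ᵐ s ∂timeMeasure T, ∀ q : ℚ, (q : ℝ) < s → E s ≤ F q :=
    ae_all_iff.mpr fun q => hle q
  filter_upwards [hcount, hq, h, hED] with t h1 h2 h3 h4
  refine le_antisymm (csInf_le (hbdd t) ⟨(abs_le.mp h4).1, h3⟩) ?_
  refine ge_of_tendsto (h1.tendsto.mono_left nhdsWithin_le_nhds : Tendsto F (𝓝[<] t) _) ?_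
  filter_upwards [self_mem_nhdsWithin] with s hs
  obtain ⟨q, hq1, hq2⟩ := exists_rat_btwn (mem_Iio.mp hs)
  exact (h2 q hq2).trans (hanti hq1.le)

theorem exists_isGoodRep_antitoneOn {E : ℝ → ℝ} {C : ℝ} (hC : ∀ᵐ t ∂timeMeasure T, |E t| ≤ C)
    (h : ∀ᵐ s ∂timeMeasure T, ∀ᵐ t ∂timeMeasure T, s < t → E t ≤ E s) :
    ∃ Eg : ℝ → ℝ, IsGoodRep T E Eg ∧ AntitoneOn Eg (Icc 0 T) := by
  obtain ⟨F, hF, hFC, hFE⟩ := exists_antitone_ae_eq hC h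
  set D := max C 0
  set Eg : ℝ → ℝ := fun t => if t < T then Function.rightLim F t else Function.leftLim F T
  have hlt : ∀ t, t < T → Eg t = Function.rightLim F t := fun t ht => if_pos ht
  have hTT : Eg T = Function.leftLim F T := if_neg (lt_irrefl T)
  have hright : ∀ t, |Function.rightLim F t| ≤ D := fun t => abs_le.mpr
    ⟨(abs_le.mp (hFC (t + 1))).1.trans (hF.le_rightLim (lt_add_one t)),
      (hF.rightLim_le le_rfl).trans (abs_le.mp (hFC t)).2⟩
  have hleft : |Function.leftLim F T| ≤ D := abs_le.mpr
    ⟨(abs_le.mp (hFC T)).1.trans (hF.le_leftLim le_rfl),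
      (hF.leftLim_le (sub_one_lt T)).trans (abs_le.mp (hFC (T - 1))).2⟩
  have hanti : AntitoneOn Eg (Icc 0 T) := by
    intro s _ t ht hst
    rcases ht.2.lt_or_eq with h1 | rfl
    · rw [hlt t h1, hlt s (hst.trans_lt h1)]
      exact hF.rightLim hst
    · rcases hst.lt_or_eq with h2 | rfl
      · rw [hTT, hlt s h2]
        exact hF.leftLim_le_rightLim h2
      · exact le_rfl
  have hbd : ∀ t, |Eg t| ≤ D := by
    intro t
    by_cases ht : t < T
    · rw [hlt t ht]
      exact hright t
    · simp only [Eg, if_neg ht]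
      exact hleft
  refine ⟨Eg, ⟨?_, fun t ht => ?_, ?_, ?_⟩, hanti⟩
  · have h1 := (hanti.neg.boundedVariationOn (C := D)
      fun t _ => by simpa using hbd t)
    simpa [BoundedVariationOn, eVariationOn] using h1
  · have h1 : Tendsto F (𝓝[>] t) (𝓝 (Function.rightLim F t)) := hF.tendsto_rightLim t
    -- For `s > t` the right limit at `s` lies between `F (2 s - t)` and `F s`.
    have h2 : Tendsto (fun s => 2 * s - t) (𝓝[>] t) (𝓝[>] t) := by
      refine tendsto_nhdsWithin_iff.mpr ⟨?_, ?_⟩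
      · refine Tendsto.mono_left ?_ nhdsWithin_le_nhds
        have : Continuous fun s : ℝ => 2 * s - t := by fun_prop
        simpa [two_mul] using this.tendsto t
      · filter_upwards [self_mem_nhdsWithin] with s hs
        simp only [mem_Ioi] at hs ⊢
        linarith
    rw [ContinuousWithinAt, hlt t ht.2]
    have h3 : ∀ᶠ s in 𝓝[>] t, t < s ∧ s < T :=
      Filter.Eventually.and self_mem_nhdsWithin (nhdsWithin_le_nhds (Iio_mem_nhds ht.2))
    refine tendsto_of_tendsto_of_tendsto_of_le_of_le' (h1.comp h2) h1 ?_ ?_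
    · filter_upwards [h3] with s hs
      rw [hlt s hs.2]
      exact hF.le_rightLim (by linarith)
    · filter_upwards [h3] with s hs
      rw [hlt s hs.2]
      exact hF.rightLim_le le_rfl
  · rw [ContinuousWithinAt, hTT]
    refine tendsto_of_tendsto_of_tendsto_of_le_of_le' tendsto_const_nhds (hF.tendsto_leftLim T)
      ?_ ?_
    · filter_upwards [self_mem_nhdsWithin] with s hs
      rw [hlt s hs]
      exact hF.leftLim_le_rightLim hs
    · filter_upwards [self_mem_nhdsWithin] with s hs
      rw [hlt s hs]
      exact hF.rightLim_le le_rfl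
  · have hcount : ∀ᵐ t ∂timeMeasure T, ContinuousAt F t :=
      ae_restrict_of_ae ((hF.countable_not_continuousAt.ae_notMem volume).mono
        fun t ht => not_not.mp ht)
    filter_upwards [hcount, hFE, ae_mem_Ioo] with t h1 h2 ht
    rw [hlt t ht.2, h1.continuousWithinAt.rightLim_eq, h2]

/-- If the increments of `P` between almost all times are those of the continuous function `Φ`, and
`P` is close to the continuous function `g` at small times, then `P` is determined by `g 0`. -/
theorem ae_eq_add_of_ae_increment (hT : 0 < T) {P Φ g : ℝ → ℝ} (hΦ : ContinuousOn Φ (Icc 0 T))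
    (hΦ0 : Φ 0 = 0) (hg : ContinuousOn g (Icc 0 T))
    (hPg : ∀ ε > 0, ∃ δ > 0, ∀ᵐ t ∂timeMeasure T, t < δ → |P t - g t| ≤ ε)
    (h : ∀ᵐ s ∂timeMeasure T, ∀ᵐ t ∂timeMeasure T, s < t → P t - P s = Φ t - Φ s) :
    ∀ᵐ t ∂timeMeasure T, P t = g 0 + Φ t := by
  have h0 : (0 : ℝ) ∈ Icc 0 T := left_mem_Icc.mpr hT.le
  have hsmall : ∀ n : ℕ, ∃ s ∈ Ioo 0 T, s < 1 / ((n : ℝ) + 1) ∧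
      (∀ᵐ t ∂timeMeasure T, s < t → P t - P s = Φ t - Φ s) ∧
      |P s - Φ s - g 0| ≤ 3 * (1 / ((n : ℝ) + 1)) := by
    intro n
    have hε : 0 < 1 / ((n : ℝ) + 1) := Nat.one_div_pos_of_nat
    set ε := 1 / ((n : ℝ) + 1)
    obtain ⟨δ, hδ, hclose⟩ := hPg ε hε
    have hnear : ∀ {f : ℝ → ℝ}, ContinuousOn f (Icc 0 T) →
        ∀ᶠ s in 𝓝[>] (0 : ℝ), s ∈ Ioo 0 T → |f s - f 0| ≤ ε := by
      intro f hf
      have h1 := (hf 0 h0).eventually (Metric.closedBall_mem_nhds (f 0) hε)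
      rw [eventually_nhdsWithin_iff] at h1
      refine (h1.filter_mono nhdsWithin_le_nhds).mono fun s hs hsT => ?_
      simpa [Real.dist_eq] using hs (Ioo_subset_Icc_self hsT)
    have hlt : ∀ᶠ s in 𝓝[>] (0 : ℝ), s < min ε δ :=
      nhdsWithin_le_nhds (Iio_mem_nhds (lt_min hε hδ))
    obtain ⟨s, ⟨⟨h1, h2⟩, hs⟩, h3, h4, h5⟩ :=
      ((frequently_nhdsGT_of_ae hT (h.and hclose)).and_eventually
        ((hnear hΦ).and ((hnear hg).and hlt))).exists
    refine ⟨s, hs, h5.trans_le (min_le_left _ _), h1, ?_⟩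
    have a1 := abs_le.mp (h2 (h5.trans_le (min_le_right _ _)))
    have a2 := abs_le.mp (h3 hs)
    have a3 := abs_le.mp (h4 hs)
    rw [hΦ0] at a2
    rw [abs_le]
    constructor <;> linarith
  choose s hs hsn hsP hsL using hsmall
  filter_upwards [ae_all_iff.mpr hsP, ae_mem_Ioo] with t h1 ht
  have hlim := tendsto_one_div_add_atTop_nhds_zero_nat (𝕜 := ℝ)
  have h2 : ∀ᶠ n : ℕ in atTop, |P t - Φ t - g 0| ≤ 3 * (1 / ((n : ℝ) + 1)) := by
    filter_upwards [hlim.eventually (gt_mem_nhds ht.1)] with n hn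
    have h3 := h1 n ((hsn n).trans hn)
    rw [show P t - Φ t - g 0 = P (s n) - Φ (s n) - g 0 by linarith]
    exact hsL n
  have h3 : |P t - Φ t - g 0| ≤ 0 := ge_of_tendsto (by simpa using hlim.const_mul 3) h2
  linarith [abs_nonpos_iff.mp h3]

/-! ### Moments of probability measures -/

section Moments

variable {ν : Measure (Space d)}

theorem quad_one (ξ : Space d) : quad 1 ξ = ‖ξ‖ ^ 2 := by
  simp [quad, frob, Matrix.one_apply, EuclideanSpace.norm_sq_eq, ← sq]

theorem integrable_norm_sq (h : ∫⁻ ξ, ‖ξ‖ₑ ^ 2 ∂ν ≠ ⊤) :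
    Integrable (fun ξ : Space d => ‖ξ‖ ^ 2) ν := by
  refine ⟨by fun_prop, ?_⟩
  simpa [HasFiniteIntegral, enorm_pow] using h.lt_top

theorem integrable_coord_mul_coord (h : Integrable (fun ξ : Space d => ‖ξ‖ ^ 2) ν) (i j : Fin d) :
    Integrable (fun ξ : Space d => ξ i * ξ j) ν :=
  h.mono' (by fun_prop) (ae_of_all _ fun ξ => abs_coord_mul_le ξ i j)

theorem integrable_id_of_norm_sq [IsProbabilityMeasure ν]
    (h : Integrable (fun ξ : Space d => ‖ξ‖ ^ 2) ν) : Integrable (fun ξ : Space d => ξ) ν := by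
  refine ((integrable_const (1 : ℝ)).add h).mono' (by fun_prop) (ae_of_all _ fun ξ => ?_)
  simp only [Pi.add_apply]
  nlinarith [sq_nonneg (‖ξ‖ - 1)]

/-- The covariance matrix: second moments about the mean. -/
theorem integral_quad_sub_mean [IsProbabilityMeasure ν]
    (h : Integrable (fun ξ : Space d => ‖ξ‖ ^ 2) ν) (A : Mat d) :
    ∫ ξ, quad A (ξ - mean ν) ∂ν = frob A (secondMoment ν) - quad A (mean ν) := by
  have hid := integrable_id_of_norm_sq h
  have hmean : ∀ i, ∫ ξ : Space d, ξ i ∂ν = mean ν i := fun i =>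
    (EuclideanSpace.proj (𝕜 := ℝ) i).integral_comp_comm hid
  have hci : ∀ i, Integrable (fun ξ : Space d => ξ i) ν := fun i =>
    (EuclideanSpace.proj (𝕜 := ℝ) i).integrable_comp hid
  have hcc := integrable_coord_mul_coord h
  have hexp : ∀ i j (ξ : Space d), A i j * ((ξ - mean ν) i * (ξ - mean ν) j) =
      A i j * (ξ i * ξ j - ξ i * mean ν j - mean ν i * ξ j + mean ν i * mean ν j) := by
    intro i j ξ
    simp only [PiLp.sub_apply]
    ring
  have hi1 : ∀ i j, Integrable (fun ξ : Space d => ξ i * mean ν j) ν :=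
    fun i j => (hci i).mul_const _
  have hi2 : ∀ i j, Integrable (fun ξ : Space d => mean ν i * ξ j) ν :=
    fun i j => (hci j).const_mul _
  have hi3 : ∀ i j, Integrable (fun ξ : Space d => ξ i * ξ j - ξ i * mean ν j) ν :=
    fun i j => (hcc i j).sub (hi1 i j)
  have hi4 : ∀ i j, Integrable (fun ξ : Space d => ξ i * ξ j - ξ i * mean ν j - mean ν i * ξ j) ν :=
    fun i j => (hi3 i j).sub (hi2 i j)
  have hint' : ∀ i j, Integrable (fun ξ : Space d => A i j *
      (ξ i * ξ j - ξ i * mean ν j - mean ν i * ξ j + mean ν i * mean ν j)) ν :=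
    fun i j => ((hi4 i j).add (integrable_const _)).const_mul _
  simp only [quad, frob, hexp, ← Finset.sum_sub_distrib]
  rw [integral_finsetSum _ fun i _ => integrable_finsetSum _ fun j _ => hint' i j]
  refine Finset.sum_congr rfl fun i _ => ?_
  rw [integral_finsetSum _ fun j _ => hint' i j]
  refine Finset.sum_congr rfl fun j _ => ?_
  rw [integral_const_mul, integral_add (hi4 i j) (integrable_const _),
    integral_sub (hi3 i j) (hi2 i j), integral_sub (hcc i j) (hi1 i j), integral_mul_const,
    integral_const_mul, hmean, hmean, integral_const, secondMoment]
  simp only [probReal_univ, one_smul]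
  ring

theorem frob_one_secondMoment (h : Integrable (fun ξ : Space d => ‖ξ‖ ^ 2) ν) :
    frob 1 (secondMoment ν) = ∫ ξ, ‖ξ‖ ^ 2 ∂ν := by
  simp only [EuclideanSpace.norm_sq_eq, Real.norm_eq_abs, sq_abs]
  rw [integral_finsetSum _ fun i _ => by simpa [sq] using integrable_coord_mul_coord h i i]
  simp [frob, Matrix.one_apply, secondMoment, sq]

theorem integral_norm_sub_mean_sq [IsProbabilityMeasure ν]
    (h : Integrable (fun ξ : Space d => ‖ξ‖ ^ 2) ν) :
    ∫ ξ, ‖ξ - mean ν‖ ^ 2 ∂ν = (∫ ξ, ‖ξ‖ ^ 2 ∂ν) - ‖mean ν‖ ^ 2 := by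
  have h1 := integral_quad_sub_mean h 1
  simpa only [quad_one, frob_one_secondMoment h] using h1

theorem norm_mean_sq_le [IsProbabilityMeasure ν]
    (h : Integrable (fun ξ : Space d => ‖ξ‖ ^ 2) ν) :
    ‖mean ν‖ ^ 2 ≤ ∫ ξ, ‖ξ‖ ^ 2 ∂ν := by
  have h1 : 0 ≤ ∫ ξ, ‖ξ - mean ν‖ ^ 2 ∂ν := integral_nonneg fun ξ => by positivity
  linarith [integral_norm_sub_mean_sq h]

theorem ofReal_integral_norm_sq (h : Integrable (fun ξ : Space d => ‖ξ‖ ^ 2) ν) :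
    ENNReal.ofReal (∫ ξ, ‖ξ‖ ^ 2 ∂ν) = ∫⁻ ξ, ‖ξ‖ₑ ^ 2 ∂ν := by
  rw [ofReal_integral_eq_lintegral_ofReal h (ae_of_all _ fun ξ => by positivity)]
  simp [ENNReal.ofReal_pow]

theorem enorm_mean_sq_le [IsProbabilityMeasure ν] :
    ‖mean ν‖ₑ ^ 2 ≤ ∫⁻ ξ, ‖ξ‖ₑ ^ 2 ∂ν := by
  by_cases h : ∫⁻ ξ, ‖ξ‖ₑ ^ 2 ∂ν = ⊤
  · rw [h]
    exact le_top
  · have hi := integrable_norm_sq h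
    rw [← ofReal_integral_norm_sq hi, ← ofReal_norm, ← ENNReal.ofReal_pow (norm_nonneg _)]
    exact ENNReal.ofReal_le_ofReal (norm_mean_sq_le hi)

theorem lintegral_enorm_sub_mean_sq_le [IsProbabilityMeasure ν] :
    ∫⁻ ξ, ‖ξ - mean ν‖ₑ ^ 2 ∂ν ≤ ∫⁻ ξ, ‖ξ‖ₑ ^ 2 ∂ν := by
  by_cases h : ∫⁻ ξ, ‖ξ‖ₑ ^ 2 ∂ν = ⊤
  · rw [h]
    exact le_top
  · have hi := integrable_norm_sq h
    have hi' : Integrable (fun ξ : Space d => ‖ξ - mean ν‖ ^ 2) ν := by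
      refine ((hi.const_mul 2).add (integrable_const (2 * ‖mean ν‖ ^ 2))).mono' (by fun_prop)
        (ae_of_all _ fun ξ => ?_)
      simp only [Pi.add_apply, norm_pow, norm_norm]
      nlinarith [norm_sub_le ξ (mean ν), sq_nonneg (‖ξ‖ - ‖mean ν‖), norm_nonneg (ξ - mean ν),
        norm_nonneg ξ, norm_nonneg (mean ν)]
    calc ∫⁻ ξ, ‖ξ - mean ν‖ₑ ^ 2 ∂ν = ENNReal.ofReal (∫ ξ, ‖ξ - mean ν‖ ^ 2 ∂ν) := by
          rw [ofReal_integral_eq_lintegral_ofReal hi' (ae_of_all _ fun ξ => by positivity)]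
          simp [ENNReal.ofReal_pow]
      _ ≤ ENNReal.ofReal (∫ ξ, ‖ξ‖ ^ 2 ∂ν) := by
          rw [integral_norm_sub_mean_sq hi]
          exact ENNReal.ofReal_le_ofReal (sub_le_self _ (by positivity))
      _ = _ := ofReal_integral_norm_sq hi

end Moments

/-! ### The velocity field of a measure-valued solution -/

section Velocity

variable {v₀ : Space d → Space d} {νo : Kernel (ℝ × Space d) (Space d)}
  {lam : Kernel ℝ (closure Ω)} {νinf : Kernel (ℝ × closure Ω) (Sphere d)}

theorem stronglyMeasurable_mean (ν : Kernel (ℝ × Space d) (Space d)) :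
    StronglyMeasurable fun p => mean (ν p) :=
  StronglyMeasurable.integral_kernel stronglyMeasurable_id

theorem IsMeasureValuedSolution.linftyL1_moment (h : IsMeasureValuedSolution Ω T v₀ νo lam νinf)
    {f : Space d → ℝ} (hf : Continuous f) (hle : ∀ ξ, |f ξ| ≤ ‖ξ‖ ^ 2) :
    LinftyL1 Ω T fun p => ∫ ξ, f ξ ∂(νo p) := by
  obtain ⟨C, hC⟩ := h.finite_energy
  refine ⟨(StronglyMeasurable.integral_kernel hf.stronglyMeasurable).aestronglyMeasurable, C, ?_⟩
  filter_upwards [hC] with t ht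
  refine le_trans (lintegral_mono fun x => ?_) ht
  refine (enorm_integral_le_lintegral_enorm _).trans (lintegral_mono fun ξ => ?_)
  rw [← enorm_norm ξ, ← enorm_pow, enorm_le_iff_norm_le]
  simpa using hle ξ

theorem MemLinftyLsigma.congr_ae {v w : ℝ → Space d → Space d} (hv : MemLinftyLsigma Ω T v)
    (h : ∀ᵐ p ∂cylMeasure Ω T, v p.1 p.2 = w p.1 p.2) : MemLinftyLsigma Ω T w := by
  have h' : ∀ᵐ t ∂timeMeasure T, v t =ᵐ[volume.restrict Ω] w t := Measure.ae_ae_of_ae_prod h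
  refine ⟨hv.aestronglyMeasurable.congr h, ?_, ?_⟩
  · filter_upwards [hv.mem, h'] with t h1 h2 using h1.congr_ae h2
  · obtain ⟨C, hC⟩ := hv.bounded
    refine ⟨C, ?_⟩
    filter_upwards [hC, h'] with t h1 h2
    rwa [← eLpNorm_congr_ae h2]

theorem IsMeasureValuedSolution.memLinftyLsigma (h : IsMeasureValuedSolution Ω T v₀ νo lam νinf) :
    MemLinftyLsigma Ω T fun t x => mean (νo (t, x)) := by
  have := h.oscillation
  refine ⟨(stronglyMeasurable_mean νo).aestronglyMeasurable, h.solenoidal, ?_⟩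
  obtain ⟨C, hC⟩ := h.finite_energy
  refine ⟨√C, ?_⟩
  filter_upwards [hC] with t ht
  have h1 : ∫⁻ x in Ω, ‖mean (νo (t, x))‖ₑ ^ 2 ≤ ENNReal.ofReal C :=
    (lintegral_mono fun x => enorm_mean_sq_le).trans ht
  rw [eLpNorm_eq_lintegral_rpow_enorm_toReal (by simp) (by simp), Real.sqrt_eq_rpow]
  simp only [ENNReal.toReal_ofNat, ENNReal.rpow_ofNat]
  rcases le_or_gt 0 C with hC0 | hC0
  · rw [← ENNReal.ofReal_rpow_of_nonneg hC0 (by norm_num)]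
    exact ENNReal.rpow_le_rpow h1 (by norm_num)
  · rw [ENNReal.ofReal_of_nonpos hC0.le, nonpos_iff_eq_zero] at h1
    rw [h1]
    simp

theorem IsMeasureValuedSolution.isFluxPair [CompactSpace (closure Ω)]
    (h : IsMeasureValuedSolution Ω T v₀ νo lam νinf) :
    IsFluxPair Ω T (fun t x => mean (νo (t, x))) fun t x => secondMoment (νo (t, x)) :=
  ⟨h.memLinftyLsigma.linftyL1, fun i j =>
    h.linftyL1_moment (f := fun ξ => ξ i * ξ j) (by fun_prop) fun ξ => abs_coord_mul_le ξ i j⟩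

end Velocity

/-! ### The Reynolds defect of a measure-valued solution -/

section Defect

/-- The law of `ξ - ⟨ν_a, ξ⟩` under `ν_a`, as a kernel in `a`. -/
noncomputable def centered {α : Type*} [MeasurableSpace α] (ν : Kernel α (Space d)) :
    Kernel α (Space d) :=
  (Kernel.id ×ₖ ν).map fun q => q.2 - mean (ν q.1)

theorem centered_apply {α : Type*} [MeasurableSpace α] (ν : Kernel α (Space d)) [IsSFiniteKernel ν]
    (a : α) : centered ν a = (ν a).map fun ξ => ξ - mean (ν a) := by
  have hm : Measurable fun q : α × Space d => q.2 - mean (ν q.1) :=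
    measurable_snd.sub ((StronglyMeasurable.integral_kernel
      (κ := ν) stronglyMeasurable_id).measurable.comp measurable_fst)
  rw [centered, Kernel.map_apply _ hm, Kernel.prod_apply, Kernel.id_apply,
    Measure.dirac_prod, Measure.map_map hm (by fun_prop)]
  rfl

instance isMarkovKernel_centered {α : Type*} [MeasurableSpace α] (ν : Kernel α (Space d))
    [IsMarkovKernel ν] : IsMarkovKernel (centered ν) := by
  refine ⟨fun a => ?_⟩
  rw [centered_apply]
  exact Measure.isProbabilityMeasure_map (by fun_prop)

/-- Lebesgue measure on `Ω`, as a measure on `closure Ω`. -/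
noncomputable def closureVolume (Ω : Set (Space d)) : Measure (closure Ω) :=
  (volume.restrict Ω).comap Subtype.val

theorem map_closureVolume :
    (closureVolume Ω).map Subtype.val = (volume.restrict Ω : Measure (Space d)) := by
  rw [closureVolume, (MeasurableEmbedding.subtype_coe isClosed_closure.measurableSet).map_comap,
    Subtype.range_coe, Measure.restrict_restrict isClosed_closure.measurableSet,
    inter_eq_right.mpr subset_closure]

theorem integral_closureVolume (f : Space d → ℝ) :
    ∫ x, f x ∂closureVolume Ω = ∫ x in Ω, f x := by
  rw [← map_closureVolume,
    (MeasurableEmbedding.subtype_coe isClosed_closure.measurableSet).integral_map]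

theorem lintegral_closureVolume (f : Space d → ℝ≥0∞) :
    ∫⁻ x, f x ∂closureVolume Ω = ∫⁻ x in Ω, f x := by
  rw [← map_closureVolume,
    (MeasurableEmbedding.subtype_coe isClosed_closure.measurableSet).lintegral_map]

instance isFiniteMeasure_closureVolume [CompactSpace (closure Ω)] :
    IsFiniteMeasure (closureVolume Ω) := by
  refine ⟨?_⟩
  have h1 := lintegral_closureVolume (Ω := Ω) fun _ => 1
  simp only [lintegral_const, one_mul, Measure.restrict_apply_univ] at h1
  rw [h1]
  exact (measure_mono subset_closure).trans_lt
    (isCompact_iff_compactSpace.mpr inferInstance).measure_lt_top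

variable (νo : Kernel (ℝ × Space d) (Space d)) (lam : Kernel ℝ (closure Ω))
  (νinf : Kernel (ℝ × closure Ω) (Sphere d))

/-- The oscillations `ν^o` about their mean, over the closed domain. -/
noncomputable def oscKernel (Ω : Set (Space d)) (νo : Kernel (ℝ × Space d) (Space d)) :
    Kernel (ℝ × closure Ω) (Space d) :=
  centered (νo.comap (fun p : ℝ × closure Ω => (p.1, (p.2 : Space d))) (by fun_prop))

/-- The measures on `closure Ω × ℝ^d` whose second moments form the Reynolds defect: the
oscillations of `ν^o` about its mean, distributed over `Ω`, plus the directions `ν^∞` of the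
concentrations, distributed according to `λ`. -/
noncomputable def defectKernel : Kernel ℝ (closure Ω × Space d) :=
  Kernel.const ℝ (closureVolume Ω) ⊗ₖ oscKernel Ω νo + lam ⊗ₖ νinf.map Subtype.val

theorem defectKernel_apply (t : ℝ) : defectKernel νo lam νinf t =
    (Kernel.const ℝ (closureVolume Ω) ⊗ₖ oscKernel Ω νo) t + (lam ⊗ₖ νinf.map Subtype.val) t :=
  rfl

variable [IsMarkovKernel νo] [IsFiniteKernel lam] [IsMarkovKernel νinf]

instance isMarkovKernel_oscKernel : IsMarkovKernel (oscKernel Ω νo) := by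
  rw [oscKernel]
  infer_instance

theorem oscKernel_apply (t : ℝ) (x : closure Ω) :
    oscKernel Ω νo (t, x) = (νo (t, x)).map fun ξ => ξ - mean (νo (t, x)) := by
  rw [oscKernel, centered_apply, Kernel.comap_apply]

theorem lintegral_defectKernel_le [CompactSpace (closure Ω)] (t : ℝ) :
    ∫⁻ z, ‖z.2‖ₑ ^ 2 ∂(defectKernel νo lam νinf t) ≤
      (∫⁻ x in Ω, ∫⁻ ξ, ‖ξ‖ₑ ^ 2 ∂(νo (t, x))) + lam t univ := by
  have hm : Measurable fun z : closure Ω × Space d => ‖z.2‖ₑ ^ 2 := by fun_prop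
  rw [defectKernel_apply, lintegral_add_measure, Kernel.lintegral_compProd _ _ _ hm,
    Kernel.lintegral_compProd _ _ _ hm]
  refine add_le_add ?_ ?_
  · rw [Kernel.const_apply,
      ← lintegral_closureVolume fun x => ∫⁻ ξ, ‖ξ‖ₑ ^ 2 ∂(νo (t, x))]
    refine lintegral_mono fun x => ?_
    rw [oscKernel_apply, lintegral_map (by fun_prop) (by fun_prop)]
    exact lintegral_enorm_sub_mean_sq_le
  · refine le_of_eq ?_
    calc ∫⁻ x, ∫⁻ ξ, ‖ξ‖ₑ ^ 2 ∂((νinf.map Subtype.val) (t, x)) ∂(lam t)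
        = ∫⁻ _, 1 ∂(lam t) := by
          refine lintegral_congr fun x => ?_
          rw [Kernel.map_apply _ measurable_subtype_coe,
            lintegral_map (by fun_prop) measurable_subtype_coe]
          simp [← ofReal_norm]
      _ = lam t univ := by simp

/-- The second moments of the defect measures are the excess of the second moments of `ν^o` over the
square of its mean, plus the second moments of the concentrations. -/
theorem integral_quad_defectKernel [CompactSpace (closure Ω)] {t : ℝ}
    (ht : ∀ᵐ x ∂volume.restrict Ω, Integrable (fun ξ : Space d => ‖ξ‖ ^ 2) (νo (t, x)))
    (hη : Integrable (fun z => ‖z.2‖ ^ 2) (defectKernel νo lam νinf t)) {A : Space d → Mat d}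
    (hA : ContinuousOn A (closure Ω)) :
    ∫ z, quad (A z.1) z.2 ∂(defectKernel νo lam νinf t) =
      (∫ x in Ω, (frob (A x) (secondMoment (νo (t, x))) - quad (A x) (mean (νo (t, x))))) +
        ∫ x : closure Ω, frob (A x) (sphereMoment (νinf (t, x))) ∂(lam t) := by
  have hi := integrable_quad hη hA
  rw [defectKernel_apply] at hi ⊢
  obtain ⟨hi1, hi2⟩ := integrable_add_measure.mp hi
  have hq : ∀ B : Mat d, Continuous (quad B) := fun B =>
    continuous_quad.comp (Continuous.prodMk continuous_const continuous_id)
  rw [integral_add_measure hi1 hi2, ProbabilityTheory.integral_compProd hi1,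
    ProbabilityTheory.integral_compProd hi2]
  congr 1
  · rw [Kernel.const_apply]
    calc ∫ x, ∫ ξ, quad (A x) ξ ∂(oscKernel Ω νo (t, x)) ∂closureVolume Ω
        = ∫ x, (fun x : Space d => ∫ ξ, quad (A x) (ξ - mean (νo (t, x))) ∂(νo (t, x))) x
            ∂closureVolume Ω := by
          refine integral_congr_ae (ae_of_all _ fun x => ?_)
          simp only
          rw [oscKernel_apply, integral_map (by fun_prop) (hq _).aestronglyMeasurable]
      _ = ∫ x in Ω, ∫ ξ, quad (A x) (ξ - mean (νo (t, x))) ∂(νo (t, x)) :=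
          integral_closureVolume fun x => ∫ ξ, quad (A x) (ξ - mean (νo (t, x))) ∂(νo (t, x))
      _ = _ := by
          refine integral_congr_ae ?_
          filter_upwards [ht] with x hx
          exact integral_quad_sub_mean hx (A x)
  · refine integral_congr_ae (ae_of_all _ fun x => ?_)
    simp only
    rw [Kernel.map_apply _ measurable_subtype_coe,
      integral_map measurable_subtype_coe.aemeasurable (hq _).aestronglyMeasurable,
      frob_sphereMoment]

end Defect

/-! ### Dissipative weak solutions from measure-valued solutions -/

section Dissipative

variable {v₀ : Space d → Space d} {νo : Kernel (ℝ × Space d) (Space d)}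
  {lam : Kernel ℝ (closure Ω)} {νinf : Kernel (ℝ × closure Ω) (Sphere d)}

theorem IsMeasureValuedSolution.ae_integrable_norm_sq
    (h : IsMeasureValuedSolution Ω T v₀ νo lam νinf) :
    ∀ᵐ t ∂timeMeasure T, ∀ᵐ x ∂volume.restrict Ω,
      Integrable (fun ξ : Space d => ‖ξ‖ ^ 2) (νo (t, x)) := by
  obtain ⟨C, hC⟩ := h.finite_energy
  filter_upwards [hC] with t ht
  have hm : Measurable fun x => ∫⁻ ξ, ‖ξ‖ₑ ^ 2 ∂(νo (t, x)) :=
    (Measurable.lintegral_kernel (κ := νo) (f := fun ξ => ‖ξ‖ₑ ^ 2) (by fun_prop)).comp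
      measurable_prodMk_left
  filter_upwards [ae_lt_top hm (ht.trans_lt ENNReal.ofReal_lt_top).ne] with x hx
    using integrable_norm_sq hx.ne

theorem IsMeasureValuedSolution.ae_integrable_defect [CompactSpace (closure Ω)]
    (h : IsMeasureValuedSolution Ω T v₀ νo lam νinf) :
    ∃ C : ℝ, ∀ᵐ t ∂timeMeasure T,
      ∫⁻ z, ‖z.2‖ₑ ^ 2 ∂(defectKernel νo lam νinf t) ≤ ENNReal.ofReal C ∧
      Integrable (fun z => ‖z.2‖ ^ 2) (defectKernel νo lam νinf t) := by
  have := h.oscillation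
  have := h.concentration
  have := h.angle
  obtain ⟨C, hC⟩ := h.finite_energy
  refine ⟨max C 0 + lam.bound.toReal, ?_⟩
  filter_upwards [hC] with t ht
  have h1 : ∫⁻ z, ‖z.2‖ₑ ^ 2 ∂(defectKernel νo lam νinf t) ≤
      ENNReal.ofReal (max C 0 + lam.bound.toReal) := by
    refine (lintegral_defectKernel_le νo lam νinf t).trans ?_
    rw [ENNReal.ofReal_add (le_max_right _ _) ENNReal.toReal_nonneg,
      ENNReal.ofReal_toReal lam.bound_ne_top]
    exact add_le_add (ht.trans (ENNReal.ofReal_le_ofReal (le_max_left _ _)))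
      (lam.measure_le_bound t univ)
  refine ⟨h1, by fun_prop, ?_⟩
  simpa [HasFiniteIntegral, enorm_pow] using h1.trans_lt ENNReal.ofReal_lt_top

theorem IsMeasureValuedSolution.isReynoldsDefect [CompactSpace (closure Ω)]
    (h : IsMeasureValuedSolution Ω T v₀ νo lam νinf) :
    IsReynoldsDefect Ω T fun t => momentMeasure (defectKernel νo lam νinf t) := by
  have := h.oscillation
  have := h.concentration
  have := h.angle
  obtain ⟨C, hC⟩ := h.ae_integrable_defect
  refine ⟨fun i j f => ?_, ⟨C, ?_⟩, ?_⟩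
  · have hm : StronglyMeasurable fun t => ∫ z : closure Ω × Space d,
        f z.1 * (z.2 i * z.2 j) ∂(defectKernel νo lam νinf t) :=
      StronglyMeasurable.integral_kernel (Continuous.stronglyMeasurable (by fun_prop))
    refine hm.measurable.aemeasurable.congr ?_
    filter_upwards [hC] with t ht
    exact (sintegral_momentMeasure ht.2 i j f.continuous).symm
  · filter_upwards [hC] with t ht i j
    exact (variation_momentMeasure_le ht.2 i j).trans ht.1
  · filter_upwards [hC] with t ht A hA
    exact posSemidef_momentMeasure ht.2 hA

/-- The total stress of a measure-valued solution splits into the stress of its mean and the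
Reynolds defect. -/
theorem IsMeasureValuedSolution.flux_add_matIntegral [CompactSpace (closure Ω)] (hΩ : IsOpen Ω)
    (h : IsMeasureValuedSolution Ω T v₀ νo lam νinf) (φ : TestField Ω T) :
    ∀ᵐ τ ∂timeMeasure T,
      flux Ω (fun x => mean (νo (τ, x))) (tensorSq fun x => mean (νo (τ, x))) φ τ +
          matIntegral (momentMeasure (defectKernel νo lam νinf τ)) (fun x => φ.grad (τ, x)) =
        flux Ω (fun x => mean (νo (τ, x))) (fun x => secondMoment (νo (τ, x))) φ τ +
          concFlux lam νinf φ τ := by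
  have := h.oscillation
  have := h.concentration
  have := h.angle
  obtain ⟨C, hC⟩ := h.ae_integrable_defect
  filter_upwards [hC, h.ae_integrable_norm_sq, (h.isFluxPair.linftyL1 hΩ φ).ae_integrable,
    (h.memLinftyLsigma.isFluxPair.linftyL1 hΩ φ).ae_integrable, ae_mem_Ioo] with τ h1 h2 h3 h4 hτ
  have hgrad : ContinuousOn (fun x => φ.grad (τ, x)) (closure Ω) :=
    φ.continuousOn_grad.comp (by fun_prop) fun _ hx => ⟨Ioo_subset_Icc_self hτ, hx⟩
  rw [matIntegral_momentMeasure h1.2 hgrad,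
    integral_quad_defectKernel νo lam νinf h2 h1.2 hgrad, ← add_assoc, concFlux]
  congr 1
  have h5 : ∫ x in Ω, (frob (φ.grad (τ, x)) (secondMoment (νo (τ, x))) -
      quad (φ.grad (τ, x)) (mean (νo (τ, x)))) =
      flux Ω (fun x => mean (νo (τ, x))) (fun x => secondMoment (νo (τ, x))) φ τ -
        flux Ω (fun x => mean (νo (τ, x))) (tensorSq fun x => mean (νo (τ, x))) φ τ := by
    rw [flux, flux, ← integral_sub h3 h4]
    refine integral_congr_ae (ae_of_all _ fun x => ?_)
    simp only
    rw [frob_comm, quad, frob_comm _ (fun i j => _ * _)]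
    change _ = _ - (_ + frob (fun i j => _ * _) _)
    ring
  rw [h5]
  ring

theorem IsMeasureValuedSolution.kinEnergy_add [CompactSpace (closure Ω)]
    (h : IsMeasureValuedSolution Ω T v₀ νo lam νinf) :
    ∀ᵐ t ∂timeMeasure T, kinEnergy Ω (fun x => mean (νo (t, x))) +
      (1 / 2) * ∑ i, momentMeasure (defectKernel νo lam νinf t) i i univ = mvEnergy Ω νo lam t := by
  have := h.oscillation
  have := h.concentration
  have := h.angle
  obtain ⟨C, hC⟩ := h.ae_integrable_defect
  filter_upwards [hC, h.ae_integrable_norm_sq,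
    (h.linftyL1_moment (f := fun ξ => ‖ξ‖ ^ 2) (by fun_prop) fun ξ => by simp).ae_integrable,
    h.memLinftyLsigma.linftyL1_norm_sq.ae_integrable] with t h1 h2 h3 h4
  have h5 := integral_quad_defectKernel νo lam νinf h2 h1.2 (A := fun _ => 1)
    continuousOn_const
  simp only [quad_one, frob_sphereMoment, norm_eq_of_mem_sphere, one_pow, integral_const,
    probReal_univ, smul_eq_mul, mul_one] at h5
  have h6 : ∫ x in Ω, (frob 1 (secondMoment (νo (t, x))) - ‖mean (νo (t, x))‖ ^ 2) =
      (∫ x in Ω, ∫ ξ, ‖ξ‖ ^ 2 ∂(νo (t, x))) - ∫ x in Ω, ‖mean (νo (t, x))‖ ^ 2 := by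
    rw [← integral_sub h3 h4]
    refine integral_congr_ae ?_
    filter_upwards [h2] with x hx
    rw [frob_one_secondMoment hx]
  rw [sum_momentMeasure_univ h1.2, h5, h6, kinEnergy, mvEnergy]
  ring

theorem IsMeasureValuedSolution.exists_mvEnergy_le
    (h : IsMeasureValuedSolution Ω T v₀ νo lam νinf) :
    ∃ C : ℝ, ∀ᵐ t ∂timeMeasure T, |mvEnergy Ω νo lam t| ≤ C := by
  have := h.concentration
  obtain ⟨C, -, hC⟩ := (h.linftyL1_moment (f := fun ξ => ‖ξ‖ ^ 2) (by fun_prop)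
    fun ξ => by simp).exists_integral_norm_le
  refine ⟨1 / 2 * C + 1 / 2 * lam.bound.toReal, ?_⟩
  filter_upwards [hC] with t ht
  have h1 : 0 ≤ ∫ x in Ω, ∫ ξ, ‖ξ‖ ^ 2 ∂(νo (t, x)) :=
    integral_nonneg fun x => integral_nonneg fun ξ => by positivity
  have h2 : (lam t).real univ ≤ lam.bound.toReal :=
    ENNReal.toReal_mono lam.bound_ne_top (lam.measure_le_bound t univ)
  have h3 : ∫ x in Ω, ∫ ξ, ‖ξ‖ ^ 2 ∂(νo (t, x)) ≤ C :=
    (le_abs_self _).trans ((norm_integral_le_integral_norm _).trans ht)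
  rw [mvEnergy, abs_of_nonneg (by positivity)]
  linarith

theorem IsMeasureValuedSolution.integrable_flux_add_concFlux [CompactSpace (closure Ω)]
    (hΩ : IsOpen Ω) (hT : 0 < T) (h : IsMeasureValuedSolution Ω T v₀ νo lam νinf)
    (φ : TestField Ω T) :
    Integrable (fun τ => flux Ω (fun x => mean (νo (τ, x)))
      (fun x => secondMoment (νo (τ, x))) φ τ + concFlux lam νinf φ τ) (timeMeasure T) := by
  have := h.concentration
  have := h.angle
  exact (h.isFluxPair.integrable_flux hΩ φ).add (integrable_concFlux lam νinf hT.le φ)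

/-- The momentum equation started from the initial velocity, which enters through the weak
continuity of the mean at time zero. -/
theorem IsMeasureValuedSolution.ae_pairing_eq [CompactSpace (closure Ω)] (hΩ : IsOpen Ω)
    (hT : 0 < T) (h : IsMeasureValuedSolution Ω T v₀ νo lam νinf) (φ : TestField Ω T) :
    ∀ᵐ t ∂timeMeasure T, pairing Ω (fun x => mean (νo (t, x))) φ t = pairing Ω v₀ φ 0 +
      ∫ τ in 0..t, (flux Ω (fun x => mean (νo (τ, x))) (fun x => secondMoment (νo (τ, x))) φ τ +
        concFlux lam νinf φ τ) := by
  have := h.concentration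
  have := h.angle
  have h0 : (0 : ℝ) ∈ Icc 0 T := left_mem_Icc.mpr hT.le
  have hflux := h.isFluxPair.integrable_flux hΩ φ
  have hconc := integrable_concFlux lam νinf hT.le φ
  obtain ⟨g, hgc, hgae, hg0⟩ := h.initial (fun x => φ.toFun (0, x)) (φ.continuousOn_slice h0)
  rw [pairing, ← hg0]
  refine ae_eq_add_of_ae_increment hT (P := fun t => pairing Ω (fun x => mean (νo (t, x))) φ t)
    (continuousOn_primitive_timeMeasure hT (h.integrable_flux_add_concFlux hΩ hT φ)) (by simp) hgc
    (fun ε hε => ?_) ?_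
  · obtain ⟨δ, hδ, hclose⟩ := exists_pairing_close hΩ
      (u := fun t x => mean (νo (t, x))) h.memLinftyLsigma.linftyL1 φ h0 hε
    refine ⟨δ, hδ, ?_⟩
    filter_upwards [hclose, hgae, ae_mem_Ioo] with t h1 h2 ht htδ
    rw [h2]
    exact h1 (by rwa [sub_zero, abs_of_pos ht.1])
  · filter_upwards [h.equation φ, ae_mem_Ioo] with s h1 hs
    filter_upwards [h1, ae_mem_Ioo] with t h2 ht hst
    rw [integral_add_sub_integral_add hflux hconc (Ioo_subset_Icc_self hs)
      (Ioo_subset_Icc_self ht)]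
    exact h2 hst

theorem IsMeasureValuedSolution.isDissipativeWeakSolution (hΩ : IsBoundedLipschitzDomain Ω)
    (hT : 0 < T) {E : ℝ → ℝ} (h : IsMeasureValuedSolution Ω T v₀ νo lam νinf)
    (hE : ∀ᵐ t ∂timeMeasure T, E t = mvEnergy Ω νo lam t) :
    IsDissipativeWeakSolution Ω T v₀ (fun t x => mean (νo (t, x))) E := by
  have := hΩ.compactSpace
  have h0 : (0 : ℝ) ∈ Icc 0 T := left_mem_Icc.mpr hT.le
  have hmono : ∀ᵐ s ∂timeMeasure T, ∀ᵐ t ∂timeMeasure T, s < t → E t ≤ E s := by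
    filter_upwards [h.energy_ineq, hE] with s h1 hs
    filter_upwards [h1, hE] with t h2 ht hst
    rw [hs, ht]
    exact h2 hst
  obtain ⟨C, hC⟩ := h.exists_mvEnergy_le
  obtain ⟨Eg, hEg, hanti⟩ := exists_isGoodRep_antitoneOn (E := E) (C := C)
    (by filter_upwards [hC, hE] with t h1 h2; rwa [h2]) hmono
  refine ⟨h.memLinftyLsigma, Eg, fun t => momentMeasure (defectKernel νo lam νinf t), hEg,
    h.isReynoldsDefect, fun φ => ?_, hanti, ?_⟩
  · have htot := h.integrable_flux_add_concFlux hΩ.isOpen hT φ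
    have hflux := h.memLinftyLsigma.isFluxPair.integrable_flux hΩ.isOpen φ
    have hsplit := h.flux_add_matIntegral hΩ.isOpen φ
    have hmat : Integrable (fun τ => matIntegral (momentMeasure (defectKernel νo lam νinf τ))
        fun x => φ.grad (τ, x)) (timeMeasure T) := by
      refine (htot.sub hflux).congr ?_
      filter_upwards [hsplit] with τ hτ
      simp only [Pi.sub_apply]
      rw [← hτ, add_sub_cancel_left]
    have hstress : ∀ t ∈ Icc 0 T, ∫ τ in 0..t, (flux Ω (fun x => mean (νo (τ, x)))
        (fun x => secondMoment (νo (τ, x))) φ τ + concFlux lam νinf φ τ) =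
        ∫ τ in 0..t, (flux Ω (fun x => mean (νo (τ, x)))
          (tensorSq fun x => mean (νo (τ, x))) φ τ +
          matIntegral (momentMeasure (defectKernel νo lam νinf τ)) fun x => φ.grad (τ, x)) :=
      fun t ht => (intervalIntegral_congr_timeMeasure hsplit h0 ht).symm
    refine ⟨?_, ?_⟩
    · filter_upwards [h.ae_pairing_eq hΩ.isOpen hT φ, ae_mem_Ioo] with s h1 hs
      filter_upwards [h.ae_pairing_eq hΩ.isOpen hT φ, ae_mem_Ioo] with t h2 ht
      have hs' := Ioo_subset_Icc_self hs
      have ht' := Ioo_subset_Icc_self ht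
      rw [DissWeakEquation, h1, h2, hstress s hs', hstress t ht', add_sub_add_left_eq_sub,
        integral_add_sub_integral_add hflux hmat hs' ht']
    · filter_upwards [h.ae_pairing_eq hΩ.isOpen hT φ, ae_mem_Ioo] with t h2 ht
      have ht' := Ioo_subset_Icc_self ht
      rw [DissWeakEquation, h2, hstress t ht', add_sub_cancel_left]
      exact intervalIntegral.integral_add (intervalIntegrable_of_integrable hflux h0 ht')
        (intervalIntegrable_of_integrable hmat h0 ht')
  · filter_upwards [h.kinEnergy_add, hE, hEg.ae_eq] with t h1 h2 h3
    rw [h1, h3, h2]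

end Dissipative

theorem flux_tensorSq_congr_ae {u w : Space d → Space d} (h : u =ᵐ[volume.restrict Ω] w)
    (φ : TestField Ω T) (t : ℝ) : flux Ω u (tensorSq u) φ t = flux Ω w (tensorSq w) φ t := by
  refine integral_congr_ae ?_
  filter_upwards [h] with x hx
  have h1 : tensorSq u x = tensorSq w x := by
    ext i j
    rw [tensorSq, tensorSq, hx]
  rw [hx, h1]

theorem IsDissipativeWeakSolution.congr_ae (hT : 0 ≤ T) {v₀ : Space d → Space d}
    {v w : ℝ → Space d → Space d} {E : ℝ → ℝ} (h : IsDissipativeWeakSolution Ω T v₀ v E)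
    (hvw : ∀ᵐ p ∂cylMeasure Ω T, v p.1 p.2 = w p.1 p.2) :
    IsDissipativeWeakSolution Ω T v₀ w E := by
  have h0 : (0 : ℝ) ∈ Icc 0 T := left_mem_Icc.mpr hT
  have hae : ∀ᵐ t ∂timeMeasure T, v t =ᵐ[volume.restrict Ω] w t := Measure.ae_ae_of_ae_prod hvw
  obtain ⟨Eg, R, hE, hR, heq, hanti, hen⟩ := h.defect
  have hflux : ∀ (φ : TestField Ω T) {s t : ℝ}, s ∈ Icc 0 T → t ∈ Icc 0 T →
      ∫ τ in s..t, flux Ω (w τ) (tensorSq (w τ)) φ τ =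
        ∫ τ in s..t, flux Ω (v τ) (tensorSq (v τ)) φ τ := fun φ s t hs ht =>
    intervalIntegral_congr_timeMeasure
      (hae.mono fun τ hτ => (flux_tensorSq_congr_ae hτ φ τ).symm) hs ht
  refine ⟨h.velocity.congr_ae hvw, Eg, R, hE, hR, fun φ => ⟨?_, ?_⟩, hanti, ?_⟩
  · filter_upwards [(heq φ).1, hae, ae_mem_Ioo] with s h1 h2 hs
    filter_upwards [h1, hae, ae_mem_Ioo] with t h1' h2' ht
    rw [DissWeakEquation, ← pairing_congr_ae h2, ← pairing_congr_ae h2',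
      hflux φ (Ioo_subset_Icc_self hs) (Ioo_subset_Icc_self ht)]
    exact h1'
  · filter_upwards [(heq φ).2, hae, ae_mem_Ioo] with t h1' h2' ht
    rw [DissWeakEquation, ← pairing_congr_ae h2', hflux φ h0 (Ioo_subset_Icc_self ht)]
    exact h1'
  · filter_upwards [hen, hae] with t h1 h2
    have h3 : kinEnergy Ω (w t) = kinEnergy Ω (v t) := by
      rw [kinEnergy, kinEnergy]
      congr 1
      refine integral_congr_ae ?_
      filter_upwards [h2] with x hx
      rw [hx]
    rwa [h3]

end IncompressibleEuler

theorem theorem3p1 {d : ℕ} (hd : 1 ≤ d) {Ω : Set (Space d)} (hΩ : IsBoundedLipschitzDomain Ω)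
    {T : ℝ} (hT : 0 < T) {v₀ : Space d → Space d} (hv₀ : MemLsigma Ω v₀)
    (v : ℝ → Space d → Space d) (E : ℝ → ℝ) :
    List.TFAE
      [IsEnergyVariationalSolution Ω T v₀ v E,
       IsDissipativeWeakSolution Ω T v₀ v E,
       ∃ (νo : Kernel (ℝ × Space d) (Space d)) (lam : Kernel ℝ (closure Ω))
         (νinf : Kernel (ℝ × closure Ω) (Sphere d)),
         IsMeasureValuedSolution Ω T v₀ νo lam νinf ∧
         (∀ᵐ p ∂cylMeasure Ω T, mean (νo p) = v p.1 p.2) ∧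
         (∀ᵐ t ∂timeMeasure T, E t = mvEnergy Ω νo lam t)] := by
  tfae_have 1 → 3 := fun h => h.exists_measureValued hd hΩ hT hv₀
  tfae_have 3 → 2 := by
    rintro ⟨νo, lam, νinf, h, hv, hE⟩
    exact (h.isDissipativeWeakSolution hΩ hT hE).congr_ae hT.le hv
  tfae_have 2 → 1 := fun h => h.isEnergyVariationalSolution hd hΩ hT
  tfae_finish
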